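/- All algebras are over $\mathbb{C}$ and all gradings are cohomological $\mathbb{Z}$-gradings. An $A_\infty$-algebra has operations $m_n$ of degree $2-n$ ($n\ge 1$), and an $A_\infty$-morphism $f$ has components $f_n$ of degree $1-n$ ($n\ge1$); $f$ is an $A_\infty$-quasi-isomorphism if $f_1$ induces an isomorphism on $m_1$-cohomology. Let $\mathcal{A}$ be a unital DG-algebra whose unit is not a coboundary, and put $\mathsf{1}=[1_{\mathcal{A}}]\in \mathrm{H}^0(\mathcal{A})$. A strictly unital minimal model of $\mathcal{A}$ is an $A_\infty$-structure on $\mathrm{H}^*(\mathcal{A})$ with $m_1=0$ and strict unit $\mathsf{1}$, together with strictly unital $A_\infty$-quasi-isomorphisms $i\colon \mathrm{H}^*(\mathcal{A})\rightsquigarrow\mathcal{A}$ and $p\colon\mathcal{A}\rightsquigarrow \mathrm{H}^*(\mathcal{A})$ such that $i_1$ sends each class to a representing cocycle and $p_1\circ i_1=\mathrm{Id}$. Its operations restrict to the graded subspace $\mathcal{N}_{\mathcal{A}}=\mathbb{C}\mathsf{1}\oplus \mathrm{H}^{>0}(\mathcal{A})$; with the restricted structure this is the unitally positive $A_\infty$-algebra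 of $\mathcal{A}$. Proposition. Let $\mathcal{A}$ and $\mathcal{B}$ be unital DG-algebras whose units are not coboundaries, and suppose that they are quasi-isomorphic as unital DG-algebras, i.e. connected by a finite zigzag of unit-preserving quasi-isomorphisms of unital DG-algebras. Then $\mathcal{A}$ and $\mathcal{B}$ have strictly unital minimal models, and for any choice of these the resulting unitally positive algebras are connected by an $A_\infty$-quasi-isomorphism $\mathcal{N}_{\mathcal{A}}\rightsquigarrow\mathcal{N}_{\mathcal{B}}$. -/

import Mathlib

universe v u w

/-! ### Cohomology of a complex, presented as a module with an endomorphism `δ` -/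

/-- The cohomology `ker δ / im δ` (used for `δ` with `δ ∘ δ = 0`). -/
abbrev Cohomology {k : Type v} [Field k] {V : Type u} [AddCommGroup V] [Module k V]
    (δ : V →ₗ[k] V) : Type u :=
  LinearMap.ker δ ⧸ (LinearMap.range δ).submoduleOf (LinearMap.ker δ)

/-- The cohomology class of a cocycle. -/
def cohomologyClass {k : Type v} [Field k] {V : Type u} [AddCommGroup V] [Module k V]
    (δ : V →ₗ[k] V) : LinearMap.ker δ →ₗ[k] Cohomology δ :=
  Submodule.mkQ _

/-- The induced grading on cohomology: degree `i` consists of the classes of cocycles of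
degree `i`. -/
def cohomologyGrading {k : Type v} [Field k] {V : Type u} [AddCommGroup V] [Module k V]
    (δ : V →ₗ[k] V) (𝒱 : ℤ → Submodule k V) (i : ℤ) : Submodule k (Cohomology δ) :=
  ((𝒱 i).submoduleOf (LinearMap.ker δ)).map (cohomologyClass δ)

/-- The map induced in cohomology by a linear map commuting with the differentials. -/
def cohomologyMap {k : Type v} [Field k] {V : Type u} [AddCommGroup V] [Module k V]
    {W : Type w} [AddCommGroup W] [Module k W] {δ : V →ₗ[k] V} {ε : W →ₗ[k] W}
    (φ : V →ₗ[k] W) (h : φ ∘ₗ δ = ε ∘ₗ φ) : Cohomology δ →ₗ[k] Cohomology ε :=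
  Submodule.mapQ _ _
    (φ.restrict (p := LinearMap.ker δ) (q := LinearMap.ker ε) (fun x hx => by
      have h1 := LinearMap.congr_fun h x
      simp only [LinearMap.comp_apply] at h1
      rw [LinearMap.mem_ker] at hx ⊢
      rw [← h1, hx, map_zero]))
    (by
      rintro ⟨x, hx⟩ ⟨y, hy⟩
      refine ⟨φ y, ?_⟩
      have h1 := LinearMap.congr_fun h y
      simp only [LinearMap.comp_apply] at h1
      rw [← h1, hy]
      rfl)

/-- A linear map is a quasi-isomorphism if it commutes with the differentials and induces a
bijection in cohomology. -/
def IsQuasiIsoMap {k : Type v} [Field k] {V : Type u} [AddCommGroup V] [Module k V]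
    {W : Type w} [AddCommGroup W] [Module k W] (δ : V →ₗ[k] V) (ε : W →ₗ[k] W)
    (φ : V →ₗ[k] W) : Prop :=
  ∃ h : φ ∘ₗ δ = ε ∘ₗ φ, Function.Bijective (cohomologyMap φ h)

/-! ### `A_∞`-algebras and `A_∞`-morphisms -/

/-- The sequence `a₀, …, a_{r-1}, x, a_{r+s}, a_{r+s+1}, …` obtained from `a` by replacing the
block `a_r, …, a_{r+s-1}` (with `s ≥ 1`) by the single entry `x`. -/
def replaceBlock {V : Type u} (a : ℕ → V) (r s : ℕ) (x : V) : ℕ → V :=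
  fun i => if i < r then a i else if i = r then x else a (i + s - 1)

/-- An `A_∞`-algebra structure on a `ℤ`-graded vector space `V = ⨁ 𝒱 i` (cohomological grading).
The operations are `m n : V^{⊗ n} → V` for `n ≥ 1` (and `m 0 = 0` by convention), `m n` has degree
`2 - n`, and for all `n ≥ 1`
`∑_{n = r + s + t, s ≥ 1} (-1)^{r + s t} m_{r+1+t} (1^{⊗ r} ⊗ m_s ⊗ 1^{⊗ t}) = 0`.
The identity is evaluated on homogeneous elements, with the Koszul sign
`(-1)^{(2 - s) (|a₀| + ⋯ + |a_{r-1}|)}`. -/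
structure AInfStructure {k : Type v} [Field k] {V : Type u} [AddCommGroup V] [Module k V]
    (𝒱 : ℤ → Submodule k V) where
  isInternal : DirectSum.IsInternal 𝒱
  m : ∀ n : ℕ, MultilinearMap k (fun _ : Fin n => V) V
  m_zero : m 0 = 0
  m_mem : ∀ (n : ℕ) (a : Fin n → V) (d : Fin n → ℤ), (∀ i, a i ∈ 𝒱 (d i)) →
    m n a ∈ 𝒱 ((∑ i, d i) + 2 - n)
  stasheff : ∀ (n : ℕ) (a : ℕ → V) (d : ℕ → ℤ), (∀ i, a i ∈ 𝒱 (d i)) →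
    ∑ s ∈ Finset.Icc 1 n, ∑ r ∈ Finset.range (n - s + 1),
      ((r : ℤ) + s * (n - r - s) + (2 - s) * ∑ j ∈ Finset.range r, d j).negOnePow •
        m (n - s + 1) (fun i => replaceBlock a r s (m s (fun j => a (r + j))) i) = 0

namespace AInfStructure

/-- The differential `m₁` as a linear map. -/
def differential {k : Type v} [Field k] {V : Type u} [AddCommGroup V] [Module k V]
    {𝒱 : ℤ → Submodule k V} (S : AInfStructure 𝒱) : V →ₗ[k] V :=
  (MultilinearMap.ofSubsingleton k V V (0 : Fin 1)).symm (S.m 1)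

/-- `η` is a strict unit of the `A_∞`-algebra. -/
structure IsStrictUnit {k : Type v} [Field k] {V : Type u} [AddCommGroup V] [Module k V]
    {𝒱 : ℤ → Submodule k V} (S : AInfStructure 𝒱) (η : V) : Prop where
  mem : η ∈ 𝒱 0
  right : ∀ a : V, S.m 2 ![a, η] = a
  left : ∀ a : V, S.m 2 ![η, a] = a
  vanish : ∀ n : ℕ, n ≠ 2 → ∀ a : Fin n → V, (∃ j, a j = η) → S.m n a = 0

end AInfStructure

/-- An `A_∞`-morphism with components `f n : V^{⊗ n} → W` of degree `1 - n` for `n ≥ 1` (and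
`f 0 = 0` by convention), such that for all `n ≥ 1`
`∑_{n = r + s + t, s ≥ 1} (-1)^{r + s t} f_{r+1+t} (1^{⊗ r} ⊗ m_s ⊗ 1^{⊗ t})
  = ∑_{n = i₁ + ⋯ + i_l} (-1)^{(l-1)(i₁-1) + (l-2)(i₂-1) + ⋯ + (i_{l-1}-1)}
      m_l (f_{i₁} ⊗ ⋯ ⊗ f_{i_l})`.
The identity is evaluated on homogeneous elements, with the Koszul signs. -/
structure AInfHom {k : Type v} [Field k] {V : Type u} [AddCommGroup V] [Module k V]
    {W : Type w} [AddCommGroup W] [Module k W]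
    {𝒱 : ℤ → Submodule k V} {𝒲 : ℤ → Submodule k W}
    (S : AInfStructure 𝒱) (T : AInfStructure 𝒲) where
  f : ∀ n : ℕ, MultilinearMap k (fun _ : Fin n => V) W
  f_zero : f 0 = 0
  f_mem : ∀ (n : ℕ) (a : Fin n → V) (d : Fin n → ℤ), (∀ i, a i ∈ 𝒱 (d i)) →
    f n a ∈ 𝒲 ((∑ i, d i) + 1 - n)
  rel : ∀ (n : ℕ) (a : ℕ → V) (d : ℕ → ℤ), (∀ i, a i ∈ 𝒱 (d i)) →
    ∑ s ∈ Finset.Icc 1 n, ∑ r ∈ Finset.range (n - s + 1),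
      ((r : ℤ) + s * (n - r - s) + (2 - s) * ∑ j ∈ Finset.range r, d j).negOnePow •
        f (n - s + 1) (fun i => replaceBlock a r s (S.m s (fun j => a (r + j))) i) =
    ∑ c : Composition n,
      (∑ p : Fin c.length, (((c.length : ℤ) - 1 - p) * (c.blocksFun p - 1) +
          (1 - c.blocksFun p) * ∑ j ∈ Finset.range (c.sizeUpTo p), d j)).negOnePow •
        T.m c.length (fun p => f (c.blocksFun p) (fun j => a (c.sizeUpTo p + j)))

namespace AInfHom

/-- The linear component `f₁`. -/
def linear {k : Type v} [Field k] {V : Type u} [AddCommGroup V] [Module k V]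
    {W : Type w} [AddCommGroup W] [Module k W]
    {𝒱 : ℤ → Submodule k V} {𝒲 : ℤ → Submodule k W}
    {S : AInfStructure 𝒱} {T : AInfStructure 𝒲} (F : AInfHom S T) : V →ₗ[k] W :=
  (MultilinearMap.ofSubsingleton k V W (0 : Fin 1)).symm (F.f 1)

/-- An `A_∞`-morphism is an `A_∞`-quasi-isomorphism if its linear component is a
quasi-isomorphism. -/
def IsQuasiIso {k : Type v} [Field k] {V : Type u} [AddCommGroup V] [Module k V]
    {W : Type w} [AddCommGroup W] [Module k W]
    {𝒱 : ℤ → Submodule k V} {𝒲 : ℤ → Submodule k W}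
    {S : AInfStructure 𝒱} {T : AInfStructure 𝒲} (F : AInfHom S T) : Prop :=
  IsQuasiIsoMap S.differential T.differential F.linear

/-- Strict unitality of an `A_∞`-morphism with respect to the strict units `η` and `θ`. -/
structure IsStrictlyUnital {k : Type v} [Field k] {V : Type u} [AddCommGroup V] [Module k V]
    {W : Type w} [AddCommGroup W] [Module k W]
    {𝒱 : ℤ → Submodule k V} {𝒲 : ℤ → Submodule k W}
    {S : AInfStructure 𝒱} {T : AInfStructure 𝒲} (F : AInfHom S T) (η : V) (θ : W) : Prop where
  map_unit : F.linear η = θ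
  vanish : ∀ n : ℕ, n ≠ 1 → ∀ a : Fin n → V, (∃ j, a j = η) → F.f n a = 0

end AInfHom

/-! ### The unitally positive part of a strictly unital `A_∞`-algebra -/

/-- The graded subspace `k η ⊕ ⨁_{i > 0} 𝒱 i`. -/
def unitalPositivePart {k : Type v} [Field k] {V : Type u} [AddCommGroup V] [Module k V]
    (𝒱 : ℤ → Submodule k V) (η : V) : Submodule k V :=
  Submodule.span k {η} ⊔ ⨆ i : {i : ℤ // 0 < i}, 𝒱 i

/-- The grading of `k η ⊕ ⨁_{i > 0} 𝒱 i` induced from the grading `𝒱`. -/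
def unitalPositiveGrading {k : Type v} [Field k] {V : Type u} [AddCommGroup V] [Module k V]
    (𝒱 : ℤ → Submodule k V) (η : V) (i : ℤ) : Submodule k (unitalPositivePart 𝒱 η) :=
  (𝒱 i).submoduleOf (unitalPositivePart 𝒱 η)

theorem unitalPositiveGrading_isInternal {k : Type v} [Field k] {V : Type u} [AddCommGroup V]
    [Module k V] {𝒱 : ℤ → Submodule k V} (h𝒱 : DirectSum.IsInternal 𝒱) {η : V} (hη : η ∈ 𝒱 0) :
    DirectSum.IsInternal (unitalPositiveGrading 𝒱 η) := by
  rw [DirectSum.isInternal_submodule_iff_iSupIndep_and_iSup_eq_top] at h𝒱 ⊢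
  have hinj : Function.Injective (unitalPositivePart 𝒱 η).subtype :=
    (unitalPositivePart 𝒱 η).subtype_injective
  refine ⟨?_, ?_⟩
  · intro i
    rw [Submodule.disjoint_def]
    intro x hx hx'
    have h1 := (Submodule.disjoint_def.1 (h𝒱.1 i)) x.1 hx ?_
    · exact Subtype.ext h1
    · have h2 : (unitalPositivePart 𝒱 η).subtype x ∈
          (⨆ j, ⨆ (_ : j ≠ i), unitalPositiveGrading 𝒱 η j).map
            (unitalPositivePart 𝒱 η).subtype := ⟨x, hx', rfl⟩
      simp only [Submodule.map_iSup] at h2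
      have h3 : ∀ j, (unitalPositiveGrading 𝒱 η j).map (unitalPositivePart 𝒱 η).subtype ≤ 𝒱 j := by
        rintro j _ ⟨y, hy, rfl⟩
        exact hy
      exact iSup₂_mono (fun j _ => h3 j) h2
  · rw [eq_top_iff]
    have key : unitalPositivePart 𝒱 η ≤ (⨆ i, unitalPositiveGrading 𝒱 η i).map
        (unitalPositivePart 𝒱 η).subtype := by
      rw [Submodule.map_iSup]
      conv_lhs => rw [unitalPositivePart]
      refine sup_le ?_ (iSup_le ?_)
      · rw [Submodule.span_le, Set.singleton_subset_iff]
        have hm : η ∈ unitalPositivePart 𝒱 η :=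
          Submodule.mem_sup_left (Submodule.mem_span_singleton_self η)
        exact Submodule.mem_iSup_of_mem 0 ⟨⟨η, hm⟩, hη, rfl⟩
      · rintro ⟨i, hi⟩ x hx
        have hm : x ∈ unitalPositivePart 𝒱 η :=
          Submodule.mem_sup_right (Submodule.mem_iSup_of_mem ⟨i, hi⟩ hx)
        exact Submodule.mem_iSup_of_mem i ⟨⟨x, hm⟩, hx, rfl⟩
    intro x _
    obtain ⟨y, hy, hyx⟩ := key x.2
    have : y = x := hinj hyx
    exact this ▸ hy

/-- The operations of a strictly unital `A_∞`-algebra preserve the unitally positive part. -/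
theorem AInfStructure.IsStrictUnit.m_mem_unitalPositivePart {k : Type v} [Field k] {V : Type u}
    [AddCommGroup V] [Module k V] {𝒱 : ℤ → Submodule k V} {S : AInfStructure 𝒱} {η : V}
    (hη : S.IsStrictUnit η) (n : ℕ) (a : Fin n → V)
    (ha : ∀ i, a i ∈ unitalPositivePart 𝒱 η) : S.m n a ∈ unitalPositivePart 𝒱 η := by
  classical
  set N := unitalPositivePart 𝒱 η with hN
  set G : Set V := {x | x = η ∨ ∃ i : ℤ, 0 < i ∧ x ∈ 𝒱 i} with hG
  have hposN : ∀ (i : ℤ), 0 < i → ∀ x ∈ 𝒱 i, x ∈ N := fun i hi x hx =>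
    Submodule.mem_sup_right (Submodule.mem_iSup_of_mem (⟨i, hi⟩ : {i : ℤ // 0 < i}) hx)
  have hηN : η ∈ N := Submodule.mem_sup_left (Submodule.mem_span_singleton_self η)
  have hGN : ∀ x ∈ G, x ∈ N := by
    rintro x (rfl | ⟨i, hi, hx⟩)
    · exact hηN
    · exact hposN i hi x hx
  have hNG : N ≤ Submodule.span k G := by
    refine sup_le (Submodule.span_mono ?_) (iSup_le ?_)
    · rintro x rfl
      exact Or.inl rfl
    · rintro ⟨i, hi⟩ x hx
      exact Submodule.subset_span (Or.inr ⟨i, hi, hx⟩)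
  -- the case of generators
  have base : ∀ b : Fin n → V, (∀ i, b i ∈ G) → S.m n b ∈ N := by
    intro b hb
    by_cases hu : ∃ j, b j = η
    · by_cases h2 : n = 2
      · subst h2
        obtain ⟨j, hj⟩ := hu
        have hbe : b = ![b 0, b 1] := by
          funext i
          fin_cases i <;> rfl
        fin_cases j
        · have hj' : b 0 = η := hj
          rw [hbe, hj', hη.left]
          exact hGN _ (hb 1)
        · have hj' : b 1 = η := hj
          rw [hbe, hj', hη.right]
          exact hGN _ (hb 0)
      · rw [hη.vanish n h2 b hu]
        exact N.zero_mem
    · have hpos : ∀ i, ∃ e : ℤ, 0 < e ∧ b i ∈ 𝒱 e := by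
        intro i
        rcases hb i with h | h
        · exact absurd ⟨i, h⟩ hu
        · exact h
      choose e he hbe using hpos
      refine hposN _ ?_ _ (S.m_mem n b e hbe)
      have : ∑ _i : Fin n, (1 : ℤ) ≤ ∑ i, e i := Finset.sum_le_sum fun i _ => he i
      simp at this
      omega
  -- reduction to generators, one entry at a time
  have step : ∀ (t : Finset (Fin n)) (b : Fin n → V), (∀ i ∈ t, b i ∈ N) →
      (∀ i, i ∉ t → b i ∈ G) → S.m n b ∈ N := by
    intro t
    induction t using Finset.induction_on with
    | empty => exact fun b _ hb => base b fun i => hb i (Finset.notMem_empty i)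
    | insert j t hjt ih =>
      intro b hb hb'
      have hle : Submodule.span k G ≤ N.comap ((S.m n).toLinearMap b j) := by
        rw [Submodule.span_le]
        intro x hx
        refine ih (Function.update b j x) ?_ ?_
        · intro i hi
          have hij : i ≠ j := fun h => hjt (h ▸ hi)
          rw [Function.update_of_ne hij]
          exact hb i (Finset.mem_insert_of_mem hi)
        · intro i hi
          by_cases hij : i = j
          · subst hij
            simpa using hx
          · rw [Function.update_of_ne hij]
            exact hb' i (by simp [hij, hi])
      have h1 := hle (hNG (hb j (Finset.mem_insert_self j t)))
      simpa using h1
  exact step Finset.univ a (fun i _ => ha i) (fun i hi => absurd (Finset.mem_univ i) hi)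

/-- The `A_∞`-structure on `k η ⊕ ⨁_{i > 0} 𝒱 i` obtained by restricting the operations of a
strictly unital `A_∞`-algebra. -/
def AInfStructure.unitalPositive {k : Type v} [Field k] {V : Type u} [AddCommGroup V]
    [Module k V] {𝒱 : ℤ → Submodule k V} (S : AInfStructure 𝒱) {η : V}
    (hη : S.IsStrictUnit η) : AInfStructure (unitalPositiveGrading 𝒱 η) where
  isInternal := unitalPositiveGrading_isInternal S.isInternal hη.mem
  m n := ((S.m n).compLinearMap fun _ => (unitalPositivePart 𝒱 η).subtype).codRestrict
    (unitalPositivePart 𝒱 η) fun a => hη.m_mem_unitalPositivePart n _ fun i => (a i).2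
  m_zero := by
    ext a
    simp [S.m_zero]
  m_mem n a d h := S.m_mem n (fun i => (a i : V)) d h
  stasheff n a d h := by
    apply Subtype.ext
    have h1 := S.stasheff n (fun i => (a i : V)) d h
    rw [ZeroMemClass.coe_zero, ← h1, AddSubmonoidClass.coe_finsetSum]
    refine Finset.sum_congr rfl fun s _ => ?_
    rw [AddSubmonoidClass.coe_finsetSum]
    refine Finset.sum_congr rfl fun r _ => ?_
    have hs : ∀ (e : ℤˣ) (x : unitalPositivePart 𝒱 η), ((e • x : unitalPositivePart 𝒱 η) : V) =
        e • (x : V) := by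
      intro e x
      rcases Int.units_eq_one_or e with rfl | rfl <;> simp
    rw [hs]
    congr 1
    change S.m _ _ = S.m _ _
    congr 1
    funext i
    simp only [replaceBlock, Submodule.subtype_apply]
    split_ifs <;> rfl

/-! ### Unital DG-algebras -/

/-- A unital DG-algebra over `k`, with cohomological `ℤ`-grading. -/
structure DGAlgebra (k : Type v) [Field k] where
  carrier : Type u
  [ring : Ring carrier]
  [algebra : Algebra k carrier]
  grading : ℤ → Submodule k carrier
  isInternal : DirectSum.IsInternal grading
  one_mem : (1 : carrier) ∈ grading 0
  mul_mem : ∀ {i j : ℤ} {a b : carrier}, a ∈ grading i → b ∈ grading j → a * b ∈ grading (i + j)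
  d : carrier →ₗ[k] carrier
  d_mem : ∀ {i : ℤ} {a : carrier}, a ∈ grading i → d a ∈ grading (i + 1)
  d_d : ∀ a : carrier, d (d a) = 0
  leibniz : ∀ {i : ℤ} {a : carrier}, a ∈ grading i → ∀ b : carrier,
    d (a * b) = d a * b + i.negOnePow • (a * d b)

attribute [instance] DGAlgebra.ring DGAlgebra.algebra

namespace DGAlgebra

/-- The unit is not a coboundary. -/
def UnitNotCoboundary {k : Type v} [Field k] (A : DGAlgebra.{v, u} k) : Prop :=
  (1 : A.carrier) ∉ LinearMap.range A.d

theorem d_one {k : Type v} [Field k] (A : DGAlgebra.{v, u} k) : A.d 1 = 0 := by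
  have h := A.leibniz A.one_mem 1
  simpa using h

/-- A morphism of unital DG-algebras; as an algebra map it preserves the unit. -/
structure Hom {k : Type v} [Field k] (A B : DGAlgebra.{v, u} k) where
  toAlgHom : A.carrier →ₐ[k] B.carrier
  map_mem : ∀ {i : ℤ} {a : A.carrier}, a ∈ A.grading i → toAlgHom a ∈ B.grading i
  map_d : ∀ a : A.carrier, toAlgHom (A.d a) = B.d (toAlgHom a)

/-- A quasi-isomorphism of unital DG-algebras. -/
def Hom.IsQuasiIso {k : Type v} [Field k] {A B : DGAlgebra.{v, u} k} (f : Hom A B) : Prop :=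
  IsQuasiIsoMap A.d B.d f.toAlgHom.toLinearMap

/-- Two unital DG-algebras are quasi-isomorphic if they are connected by a finite zigzag of
quasi-isomorphisms of unital DG-algebras. -/
def QuasiIsomorphic {k : Type v} [Field k] (A B : DGAlgebra.{v, u} k) : Prop :=
  Relation.EqvGen (fun A B : DGAlgebra.{v, u} k => ∃ f : Hom A B, f.IsQuasiIso) A B

/-- The operations of a DG-algebra seen as an `A_∞`-algebra: `m₁ = d`, `m₂` is the product and
`m_n = 0` otherwise. -/
def mul {k : Type v} [Field k] (A : DGAlgebra.{v, u} k) :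
    ∀ n : ℕ, MultilinearMap k (fun _ : Fin n => A.carrier) A.carrier
  | 1 => MultilinearMap.ofSubsingleton k A.carrier A.carrier (0 : Fin 1) A.d
  | 2 => MultilinearMap.mkPiAlgebraFin k 2 A.carrier
  | _ => 0

theorem mul_one_apply {k : Type v} [Field k] (A : DGAlgebra.{v, u} k) (a : Fin 1 → A.carrier) :
    A.mul 1 a = A.d (a 0) := rfl

theorem mul_two_apply {k : Type v} [Field k] (A : DGAlgebra.{v, u} k) (a : Fin 2 → A.carrier) :
    A.mul 2 a = a 0 * a 1 := by
  simp [mul]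

theorem mul_eq_zero {k : Type v} [Field k] (A : DGAlgebra.{v, u} k) {n : ℕ} (h1 : n ≠ 1)
    (h2 : n ≠ 2) : A.mul n = 0 := by
  match n with
  | 0 => rfl
  | 1 => exact absurd rfl h1
  | 2 => exact absurd rfl h2
  | n + 3 => rfl

/-- A DG-algebra as an `A_∞`-algebra. -/
def toAInf {k : Type v} [Field k] (A : DGAlgebra.{v, u} k) : AInfStructure A.grading where
  isInternal := A.isInternal
  m := A.mul
  m_zero := rfl
  m_mem n a d h := by
    by_cases h1 : n = 1
    · subst h1
      rw [mul_one_apply]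
      have := A.d_mem (h 0)
      convert this using 2
      simp
      ring
    by_cases h2 : n = 2
    · subst h2
      rw [mul_two_apply]
      have := A.mul_mem (h 0) (h 1)
      convert this using 2
      simp
    rw [A.mul_eq_zero h1 h2]
    exact Submodule.zero_mem _
  stasheff n a d h := by
    match n with
    | 0 => simp
    | 1 =>
      simp [mul_one_apply, replaceBlock, A.d_d]
    | 2 =>
      have h2 : Finset.Icc 1 2 = {1, 2} := rfl
      rw [h2]
      simp [mul_one_apply, mul_two_apply, replaceBlock, Finset.sum_range_succ,
        A.leibniz (h 0), Int.negOnePow_add]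
      abel
    | 3 =>
      have h3 : Finset.Icc 1 3 = {1, 2, 3} := rfl
      rw [h3]
      simp [mul_two_apply, replaceBlock, Finset.sum_range_succ, mul_assoc,
        A.mul_eq_zero (n := 3) (by decide) (by decide), mul_one_apply,
        Int.negOnePow_even 2 (by decide)]
    | n + 4 =>
      refine Finset.sum_eq_zero fun s hs => Finset.sum_eq_zero fun r hr => ?_
      rw [Finset.mem_Icc] at hs
      by_cases hs3 : s ≤ 2
      · rw [A.mul_eq_zero (n := n + 4 - s + 1) (by omega) (by omega)]
        simp
      · have : A.mul s = 0 := A.mul_eq_zero (by omega) (by omega)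
        rw [this]
        rw [Finset.mem_range] at hr
        have h0 : A.mul (n + 4 - s + 1) (fun i =>
            replaceBlock a r s ((0 : MultilinearMap k (fun _ : Fin s => A.carrier) A.carrier)
              (fun j => a (r + j))) i) = 0 :=
          (A.mul (n + 4 - s + 1)).map_coord_zero ⟨r, hr⟩ (by simp [replaceBlock])
        rw [h0, smul_zero]

/-- The total cohomology `H^*(A)`. -/
abbrev Coh {k : Type v} [Field k] (A : DGAlgebra.{v, u} k) : Type u :=
  Cohomology A.d

/-- The grading `i ↦ H^i(A)` of the total cohomology. -/
abbrev cohGrading {k : Type v} [Field k] (A : DGAlgebra.{v, u} k) : ℤ → Submodule k A.Coh :=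
  cohomologyGrading A.d A.grading

/-- The class of the unit in `H^0(A)`. -/
def unitClass {k : Type v} [Field k] (A : DGAlgebra.{v, u} k) : A.Coh :=
  cohomologyClass A.d ⟨1, A.d_one⟩

/-- A strictly unital minimal model of `A`: a minimal `A_∞`-structure on `H^*(A)` for which the
class of the unit is a strict unit, with strictly unital `A_∞`-quasi-isomorphisms
`H^*(A) ⇝ A` and `A ⇝ H^*(A)` whose linear components are an inclusion (choosing a representative
of each cohomology class) and a projection that is a left inverse of it. -/
structure StrictlyUnitalMinimalModel {k : Type v} [Field k] (A : DGAlgebra.{v, u} k) where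
  str : AInfStructure A.cohGrading
  minimal : str.m 1 = 0
  strictUnit : str.IsStrictUnit A.unitClass
  incl : AInfHom str A.toAInf
  proj : AInfHom A.toAInf str
  incl_isQuasiIso : incl.IsQuasiIso
  proj_isQuasiIso : proj.IsQuasiIso
  incl_unital : incl.IsStrictlyUnital A.unitClass 1
  proj_unital : proj.IsStrictlyUnital 1 A.unitClass
  incl_class : ∀ x : A.Coh, ∃ h : incl.linear x ∈ LinearMap.ker A.d,
    cohomologyClass A.d ⟨incl.linear x, h⟩ = x
  proj_incl : ∀ x : A.Coh, proj.linear (incl.linear x) = x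

/-- The unitally positive `A_∞`-algebra `k 1 ⊕ H^{>0}(A)`, with the `A_∞`-structure restricted from
a strictly unital minimal model of `A`. -/
def StrictlyUnitalMinimalModel.unitallyPositive {k : Type v} [Field k] {A : DGAlgebra.{v, u} k}
    (M : A.StrictlyUnitalMinimalModel) :
    AInfStructure (unitalPositiveGrading A.cohGrading A.unitClass) :=
  M.str.unitalPositive M.strictUnit

end DGAlgebra

/-! The comparison takes place between the minimal models, before restricting to the unitally
positive parts. Let `f : A → B` be a quasi-isomorphism of DG-algebras. The inclusion of a model of
`A`, followed by `f` and by the projection to a model of `B`, is a strictly unital `A_∞`-morphism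
whose linear part is a quasi-isomorphism between complexes with zero differential, hence bijective
(`isomorphic_of_isQuasiIso`). A morphism with bijective linear part has a strictly unital inverse,
constructed by recursion on the number of inputs (`exists_blockComp_inverse`). So the arrows of a
zigzag can be traversed in both directions; the algebras in between also have models, since a
quasi-isomorphism preserves and reflects that the unit is not a coboundary. The resulting
isomorphism restricts: its component with `n` inputs has degree `1 - n`, so positive degrees go to
positive degrees, and a unit among the inputs gives the unit or zero. As the linear part is a graded
bijection preserving the units, its restriction is again bijective.

Signs are handled by the bar construction. After the shift, a family of operations is one
multilinear function on lists; `coderiv` is precomposition with the coderivation having given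
components, and `blockComp` is precomposition with the coalgebra morphism having given components.
The Stasheff identities become `coderiv s b b = 0`, and the morphism equations become `coderiv s b φ
= blockComp φ b'`. The grading is encoded by an action of the scalars `kˣ` (`shiftAct`), so that
homogeneity becomes equivariance; in characteristic zero the degrees can be recovered from the
action.

Existence of models is homotopy transfer with strict units. Over a field the complex contracts onto
its cohomology by maps `i`, `p`, `h`, and `h` can be chosen to kill the unit exactly because the
unit is not a coboundary (`exists_unitalContraction`). The transferred operations and the projection
are both read off from a single function `K` on lists, a fixed point of an operator whose value on a
list only involves shorter lists; the inclusion is found in the same way. The identities are then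
proved by a simultaneous induction on length for two defects: `e`, the failure of the morphism
equation, and `J`, the failure of the Stasheff identity on cohomology. The homotopy expresses `e`
through its own differential, that differential is controlled by `J`, and the side conditions on
`i`, `p`, `h` force both to vanish (`exists_projection`, `exists_inclusion`). The two constructions
may yield different structures on cohomology. The composite of inclusion and projection has linear
part the identity, so it is invertible, and composing the inclusion with its inverse gives both maps
for one structure (`exists_minimalModel`). -/

/-! ### Sums over deconcatenations of a list -/

section Deconcatenation

variable {V W X Y : Type*} [AddCommGroup X] [AddCommGroup Y]

/-- The sum of `g x y` over all decompositions `l = x ++ y`. -/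
def deconcSum : (List V → List V → X) → List V → X
  | g, [] => g [] []
  | g, a :: l => g [] (a :: l) + deconcSum (fun x y => g (a :: x) y) l

@[simp] theorem deconcSum_nil (g : List V → List V → X) : deconcSum g [] = g [] [] := rfl

theorem deconcSum_cons (g : List V → List V → X) (a : V) (l : List V) :
    deconcSum g (a :: l) = g [] (a :: l) + deconcSum (fun x y => g (a :: x) y) l := rfl

theorem deconcSum_add (g g' : List V → List V → X) (l : List V) :
    deconcSum (fun x y => g x y + g' x y) l = deconcSum g l + deconcSum g' l := by
  induction l generalizing g g' with
  | nil => rfl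
  | cons a l ih => simp only [deconcSum_cons, ih]; abel

theorem map_deconcSum (Λ : X →+ Y) (g : List V → List V → X) (l : List V) :
    Λ (deconcSum g l) = deconcSum (fun x y => Λ (g x y)) l := by
  induction l generalizing g with
  | nil => rfl
  | cons a l ih => simp only [deconcSum_cons, map_add, ih]

theorem deconcSum_neg (g : List V → List V → X) (l : List V) :
    deconcSum (fun x y => -g x y) l = -deconcSum g l :=
  (map_deconcSum (negAddMonoidHom : X →+ X) g l).symm

theorem deconcSum_sub (g g' : List V → List V → X) (l : List V) :
    deconcSum (fun x y => g x y - g' x y) l = deconcSum g l - deconcSum g' l := by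
  simp only [sub_eq_add_neg, deconcSum_add, deconcSum_neg]

theorem deconcSum_congr {g g' : List V → List V → X} {l : List V}
    (h : ∀ x y, x ++ y = l → g x y = g' x y) : deconcSum g l = deconcSum g' l := by
  induction l generalizing g g' with
  | nil => exact h [] [] rfl
  | cons a l ih =>
    rw [deconcSum_cons, deconcSum_cons, h [] (a :: l) rfl]
    congr 1
    exact ih fun x y hxy => h (a :: x) y (by simp [hxy])

theorem deconcSum_eq_zero {g : List V → List V → X} {l : List V}
    (h : ∀ x y, x ++ y = l → g x y = 0) : deconcSum g l = 0 := by
  rw [deconcSum_congr h]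
  exact (map_deconcSum (0 : X →+ X) (fun _ _ => 0) l).symm

theorem deconcSum_eq_single {g : List V → List V → X} {l : List V} (x₀ y₀ : List V)
    (h₀ : x₀ ++ y₀ = l) (h : ∀ x y, x ++ y = l → x ≠ x₀ → g x y = 0) :
    deconcSum g l = g x₀ y₀ := by
  induction l generalizing g x₀ with
  | nil =>
    obtain ⟨rfl, rfl⟩ := List.append_eq_nil_iff.1 h₀
    rfl
  | cons a l ih =>
    rw [deconcSum_cons]
    cases x₀ with
    | nil =>
      rw [List.nil_append] at h₀
      subst h₀
      rw [deconcSum_eq_zero fun x y hxy => h (a :: x) y (by simp [hxy]) (by simp), add_zero]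
    | cons b x₀ =>
      rw [List.cons_append, List.cons_eq_cons] at h₀
      obtain ⟨rfl, h₀⟩ := h₀
      rw [h [] (b :: l) rfl (by simp), zero_add]
      exact ih x₀ h₀ fun x y hxy hx => h (b :: x) y (by simp [hxy]) (by simpa using hx)

/-- Coassociativity of deconcatenation: both sides run over the decompositions of `l` into three
pieces. -/
theorem deconcSum_assoc (g : List V → List V → List V → X) (l : List V) :
    deconcSum (fun x y => deconcSum (fun y z => g x y z) y) l =
      deconcSum (fun x z => deconcSum (fun x y => g x y z) x) l := by
  induction l generalizing g with
  | nil => rfl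
  | cons a l ih =>
    simp only [deconcSum_cons, deconcSum_nil]
    rw [deconcSum_add, ih fun x y z => g (a :: x) y z]
    abel

theorem deconcSum_map (s : W → V) (g : List V → List V → X) (l : List W) :
    deconcSum g (l.map s) = deconcSum (fun x y => g (x.map s) (y.map s)) l := by
  induction l generalizing g with
  | nil => rfl
  | cons a l ih => simp only [List.map_cons, deconcSum_cons, ih, List.map_nil]

end Deconcatenation

/-! ### Multilinear functions on lists -/

/-- A function on lists is multilinear if it is linear in each entry. -/
def ListMultilinear (k : Type v) [Field k] {V X : Type*} [AddCommGroup V] [Module k V]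
    [AddCommGroup X] [Module k X] (f : List V → X) : Prop :=
  ∀ l₁ l₂, IsLinearMap k fun x => f (l₁ ++ x :: l₂)

section ListMultilinear

variable {k : Type v} [Field k] {V X Y : Type*} [AddCommGroup V] [Module k V]
    [AddCommGroup X] [Module k X] [AddCommGroup Y] [Module k Y]

namespace ListMultilinear

variable {f : List V → X}

theorem cons (hf : ListMultilinear k f) (a : V) : ListMultilinear k fun l => f (a :: l) := fun l₁ l₂ => hf (a :: l₁) l₂

/-- A multilinear function on lists as a linear function of the first entry. -/
def head (hf : ListMultilinear k f) (l : List V) : V →ₗ[k] X := (hf [] l).mk' _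

theorem cons_add (hf : ListMultilinear k f) (x y : V) (l : List V) :
    f ((x + y) :: l) = f (x :: l) + f (y :: l) :=
  (hf [] l).map_add x y

theorem cons_neg (hf : ListMultilinear k f) (x : V) (l : List V) : f (-x :: l) = -f (x :: l) := (hf.head l).map_neg x

theorem cons_sub (hf : ListMultilinear k f) (x y : V) (l : List V) :
    f ((x - y) :: l) = f (x :: l) - f (y :: l) :=
  (hf.head l).map_sub x y

theorem cons_zero (hf : ListMultilinear k f) (l : List V) : f (0 :: l) = 0 := (hf.head l).map_zero

theorem cons_smul (hf : ListMultilinear k f) (c : k) (x : V) (l : List V) :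
    f (c • x :: l) = c • f (x :: l) :=
  (hf [] l).map_smul c x

end ListMultilinear

end ListMultilinear

/-- The function on lists that is `g` on lists of length one and zero otherwise. -/
def onSingle {V X : Type*} [Zero X] (g : V → X) : List V → X
  | [a] => g a
  | _ => 0

/-- The part of a function on lists supported on lists of length at least two. -/
def dropSingle {V X : Type*} [Zero X] (f : List V → X) (l : List V) : X :=
  if 2 ≤ l.length then f l else 0

/-! ### Linear component and higher components -/

section SupportedParts

variable {V X : Type*}

@[simp] theorem onSingle_nil [Zero X] (g : V → X) : onSingle g [] = 0 := rfl

@[simp] theorem onSingle_singleton [Zero X] (g : V → X) (a : V) : onSingle g [a] = g a := rfl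

@[simp] theorem onSingle_cons_cons [Zero X] (g : V → X) (a b : V) (l : List V) :
    onSingle g (a :: b :: l) = 0 := rfl

theorem onSingle_of_length_ne [Zero X] (g : V → X) {l : List V} (h : l.length ≠ 1) :
    onSingle g l = 0 := by
  match l with
  | [] => rfl
  | [a] => simp at h
  | a :: b :: l => rfl

@[simp] theorem dropSingle_nil [Zero X] (f : List V → X) : dropSingle f [] = 0 := rfl

@[simp] theorem dropSingle_singleton [Zero X] (f : List V → X) (a : V) :
    dropSingle f [a] = 0 := rfl

@[simp] theorem dropSingle_cons_cons [Zero X] (f : List V → X) (a b : V) (l : List V) :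
    dropSingle f (a :: b :: l) = f (a :: b :: l) := by simp [dropSingle]

theorem onSingle_add_dropSingle [AddCommGroup X] {f : List V → X} (h : f [] = 0) :
    (fun l => onSingle (fun a => f [a]) l + dropSingle f l) = f := by
  funext l
  match l with
  | [] => simp [h]
  | [a] => simp
  | a :: b :: l => simp

end SupportedParts

/-! ### Coderivations -/

section Coderivation

variable {V W X Y : Type*} [AddCommGroup X] [AddCommGroup Y]

/-- The composite of `f` with the coderivation of the tensor coalgebra with components `b`, where
moving `b` past an entry `a` replaces `a` with `s a`: the sum of `f (s x₁, …, s xₚ, b y, z₁, …)`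
over all decompositions `l = x ++ y ++ z` with `y ≠ []`. -/
def coderiv (s : V → V) (b : List V → V) : (List V → X) → List V → X
  | _, [] => 0
  | f, a :: l =>
    coderiv s b (fun x => f (s a :: x)) l + deconcSum (fun x y => f (b (a :: x) :: y)) l

variable (s : V → V) (b : List V → V)

@[simp] theorem coderiv_nil (f : List V → X) : coderiv s b f [] = 0 := rfl

theorem coderiv_cons (f : List V → X) (a : V) (l : List V) : coderiv s b f (a :: l) =
    coderiv s b (fun x => f (s a :: x)) l + deconcSum (fun x y => f (b (a :: x) :: y)) l := rfl

theorem coderiv_add (f f' : List V → X) (l : List V) :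
    coderiv s b (fun x => f x + f' x) l = coderiv s b f l + coderiv s b f' l := by
  induction l generalizing f f' with
  | nil => simp
  | cons a l ih => simp only [coderiv_cons, ih, deconcSum_add]; abel

theorem map_coderiv (Λ : X →+ Y) (f : List V → X) (l : List V) :
    Λ (coderiv s b f l) = coderiv s b (fun x => Λ (f x)) l := by
  induction l generalizing f with
  | nil => simp
  | cons a l ih => simp only [coderiv_cons, map_add, ih, map_deconcSum]

theorem coderiv_neg (f : List V → X) (l : List V) :
    coderiv s b (fun x => -f x) l = -coderiv s b f l :=
  (map_coderiv s b (negAddMonoidHom : X →+ X) f l).symm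

theorem coderiv_sub (f f' : List V → X) (l : List V) :
    coderiv s b (fun x => f x - f' x) l = coderiv s b f l - coderiv s b f' l := by
  simp only [sub_eq_add_neg, coderiv_add, coderiv_neg]

@[simp] theorem coderiv_zero (l : List V) : coderiv s b (fun _ => (0 : X)) l = 0 :=
  (map_coderiv s b (0 : X →+ X) (fun _ => 0) l).symm

/-- The value on `l` only involves nonempty lists that are at most as long as `l`. -/
theorem coderiv_congr {f f' : List V → X} {l : List V}
    (h : ∀ x, x ≠ [] → x.length ≤ l.length → f x = f' x) :
    coderiv s b f l = coderiv s b f' l := by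
  induction l generalizing f f' with
  | nil => rfl
  | cons a l ih =>
    rw [coderiv_cons, coderiv_cons]
    congr 1
    · exact ih fun x _ hx => h _ (by simp) (by simpa using hx)
    · refine deconcSum_congr fun x y hxy => h _ (by simp) ?_
      simp [← hxy]

/-- The co-Leibniz rule: the block on which `b` acts lies in the left piece, or in the right piece
after `b` has moved past the whole left piece. -/
theorem coderiv_deconcSum (g : List V → List V → X) (l : List V) :
    coderiv s b (deconcSum g) l = deconcSum (fun x y =>
      coderiv s b (fun x => g x y) x + coderiv s b (g (x.map s)) y) l := by
  induction l generalizing g with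
  | nil => simp
  | cons a l ih =>
    rw [coderiv_cons, deconcSum_cons]
    simp only [deconcSum_cons, coderiv_nil, zero_add, List.map_nil, List.map_cons]
    rw [coderiv_add, ih]
    simp only [coderiv_cons, deconcSum_add]
    rw [deconcSum_assoc fun x y z => g (b (a :: x) :: y) z]
    abel

/-- The square of an odd coderivation is the coderivation given by the square of its components. -/
theorem coderiv_coderiv {k : Type v} [Field k] [AddCommGroup V] [Module k V] [Module k X] (hs : ∀ a, s (s a) = a)
    (hb : ∀ l, b (l.map s) = -s (b l)) (f : List V → X)
    (hf : ListMultilinear k f)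
    (l : List V) :
    coderiv s b (coderiv s b f) l = coderiv id (coderiv s b b) f l := by
  induction l generalizing f with
  | nil => rfl
  | cons a l ih =>
    rw [coderiv_cons, coderiv_cons]
    simp only [coderiv_cons, hs, id]
    rw [coderiv_add, ih _ (hf.cons a), coderiv_deconcSum]
    simp only [deconcSum_add, hf.cons_add]
    have h1 : ∀ x : List V, b (s a :: x.map s) = -s (b (a :: x)) := fun x => hb (a :: x)
    -- Two insertions of `b` into disjoint blocks can be made in either order. As `b` is odd the two
    -- orders differ by a sign, and such terms cancel; only the nested insertions remain.
    have h4 : deconcSum (fun x => coderiv s b fun y => f (b (s a :: x.map s) :: y)) l =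
        -deconcSum (fun x => coderiv s b fun y => f (s (b (a :: x)) :: y)) l := by
      rw [← deconcSum_neg]
      simp only [h1, hf.cons_neg, ← coderiv_neg]
    rw [h4]
    rw [deconcSum_assoc fun x y z => f (b (b (a :: x) :: y) :: z)]
    have h2 : ∀ x y, coderiv s b (fun x => f (b (s a :: x) :: y)) x =
        f (coderiv s b (fun x => b (s a :: x)) x :: y) := fun x y =>
      (map_coderiv s b (hf.head y).toAddMonoidHom _ x).symm
    have h3 : ∀ x y, deconcSum (fun x₁ x₂ => f (b (b (a :: x₁) :: x₂) :: y)) x =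
        f (deconcSum (fun x₁ x₂ => b (b (a :: x₁) :: x₂)) x :: y) := fun x y =>
      (map_deconcSum (hf.head y).toAddMonoidHom _ x).symm
    simp only [h2, h3]
    abel

end Coderivation

/-! ### Coalgebra morphisms -/

section BlockComposition

variable {V W X Y : Type*} [AddCommGroup X] [AddCommGroup Y]

/-- Auxiliary function for `blockComp`: the block `c` has been started. -/
def blockCompAux (φ : List V → W) : (List W → X) → List V → List V → X
  | f, c, [] => f [φ c]
  | f, c, a :: l =>
    blockCompAux φ (fun z => f (φ c :: z)) [a] l + blockCompAux φ f (c ++ [a]) l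

/-- The composite of `f` with the morphism of tensor coalgebras with components `φ`: the sum of
`f (φ x₁, …, φ xₘ)` over all decompositions `l = x₁ ++ ⋯ ++ xₘ` into nonempty blocks. -/
def blockComp (φ : List V → W) (f : List W → X) : List V → X
  | [] => f []
  | a :: l => blockCompAux φ f [a] l

variable (φ : List V → W)

@[simp] theorem blockComp_nil (f : List W → X) : blockComp φ f [] = f [] := rfl

theorem blockCompAux_eq (f : List W → X) (c l : List V) : blockCompAux φ f c l =
    deconcSum (fun x y => blockComp φ (fun z => f (φ (c ++ x) :: z)) y) l := by
  induction l generalizing f c with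
  | nil => simp [blockCompAux]
  | cons a l ih =>
    rw [blockCompAux, deconcSum_cons, ih f]
    simp [blockComp]

theorem blockComp_cons (f : List W → X) (a : V) (l : List V) : blockComp φ f (a :: l) =
    deconcSum (fun x y => blockComp φ (fun z => f (φ (a :: x) :: z)) y) l :=
  blockCompAux_eq φ f [a] l

@[simp] theorem blockComp_singleton (f : List W → X) (a : V) :
    blockComp φ f [a] = f [φ [a]] := rfl

theorem blockCompAux_add (f f' : List W → X) (c l : List V) :
    blockCompAux φ (fun x => f x + f' x) c l = blockCompAux φ f c l + blockCompAux φ f' c l := by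
  induction l generalizing f f' c with
  | nil => rfl
  | cons a l ih => simp only [blockCompAux, ih]; abel

theorem map_blockCompAux (Λ : X →+ Y) (f : List W → X) (c l : List V) :
    Λ (blockCompAux φ f c l) = blockCompAux φ (fun x => Λ (f x)) c l := by
  induction l generalizing f c with
  | nil => rfl
  | cons a l ih => simp only [blockCompAux, ih, map_add]

theorem blockComp_add (f f' : List W → X) (l : List V) :
    blockComp φ (fun x => f x + f' x) l = blockComp φ f l + blockComp φ f' l := by
  cases l with
  | nil => rfl
  | cons a l => exact blockCompAux_add φ f f' [a] l

theorem map_blockComp (Λ : X →+ Y) (f : List W → X) (l : List V) :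
    Λ (blockComp φ f l) = blockComp φ (fun x => Λ (f x)) l := by
  cases l with
  | nil => rfl
  | cons a l => exact map_blockCompAux φ Λ f [a] l

theorem blockComp_neg (f : List W → X) (l : List V) :
    blockComp φ (fun x => -f x) l = -blockComp φ f l :=
  (map_blockComp φ (negAddMonoidHom : X →+ X) f l).symm

theorem blockComp_sub (f f' : List W → X) (l : List V) :
    blockComp φ (fun x => f x - f' x) l = blockComp φ f l - blockComp φ f' l := by
  simp only [sub_eq_add_neg, blockComp_add, blockComp_neg]

@[simp] theorem blockComp_zero (l : List V) : blockComp φ (fun _ => (0 : X)) l = 0 :=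
  (map_blockComp φ (0 : X →+ X) (fun _ => 0) l).symm

/-- Compatibility of the coalgebra morphism with comultiplication: cutting the sequence of blocks
amounts to cutting `l` and decomposing both pieces into blocks. -/
theorem blockComp_deconcSum (g : List W → List W → X) (l : List V) :
    blockComp φ (deconcSum g) l =
      deconcSum (fun x y => blockComp φ (fun x' => blockComp φ (g x') y) x) l := by
  induction hn : l.length using Nat.strong_induction_on generalizing g l with
  | _ n ih =>
    cases l with
    | nil => rfl
    | cons a l =>
      rw [blockComp_cons, deconcSum_cons]
      simp only [deconcSum_cons, blockComp_add, deconcSum_add, blockComp_nil]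
      rw [← blockComp_cons]
      congr 1
      simp only [blockComp_cons]
      rw [← deconcSum_assoc fun x y z =>
        blockComp φ (fun u => blockComp φ (g (φ (a :: x) :: u)) z) y]
      refine deconcSum_congr fun x y hxy => ih y.length ?_ _ y rfl
      rw [← hn, ← hxy]
      simp

/-- The value on `l` only involves lists that are at most as long as `l`. -/
theorem blockComp_congr {f f' : List W → X} {l : List V}
    (h : ∀ x, (l ≠ [] → x ≠ []) → x.length ≤ l.length → f x = f' x) :
    blockComp φ f l = blockComp φ f' l := by
  induction hn : l.length using Nat.strong_induction_on generalizing f f' l with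
  | _ n ih =>
    cases l with
    | nil => exact h [] (by simp) le_rfl
    | cons a l =>
      rw [blockComp_cons, blockComp_cons]
      refine deconcSum_congr fun x y hxy => ih y.length ?_ ?_ rfl
      · rw [← hn, ← hxy]
        simp
      · intro z _ hz
        refine h _ (by simp) ?_
        rw [← hxy]
        simp
        omega

/-- The value on `l` only involves the components on nonempty lists that are at most as long
as `l`. -/
theorem blockComp_congr_components {φ φ' : List V → W} (f : List W → X) {l : List V}
    (h : ∀ x, x ≠ [] → x.length ≤ l.length → φ x = φ' x) :
    blockComp φ f l = blockComp φ' f l := by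
  induction hn : l.length using Nat.strong_induction_on generalizing f l with
  | _ n ih =>
    cases l with
    | nil => rfl
    | cons a l =>
      rw [blockComp_cons, blockComp_cons]
      refine deconcSum_congr fun x y hxy => ?_
      have hl := congrArg List.length hxy
      simp only [List.length_append, List.length_cons] at hl hn
      rw [h (a :: x) (by simp) (by simp; omega)]
      exact ih y.length (by omega) _ (fun z hz hzl => h z hz (by simp; omega)) rfl

/-- If `f` vanishes on lists of length one, the value on `l` only involves the components on
lists that are shorter than `l`. -/
theorem blockComp_congr_components_of_singleton {φ φ' : List V → W} {f : List W → X} {l : List V}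
    (hf : ∀ x, f [x] = 0) (h : ∀ x, x ≠ [] → x.length < l.length → φ x = φ' x) :
    blockComp φ f l = blockComp φ' f l := by
  cases l with
  | nil => rfl
  | cons a l =>
    rw [blockComp_cons, blockComp_cons]
    refine deconcSum_congr fun x y hxy => ?_
    have hl := congrArg List.length hxy
    simp only [List.length_append] at hl
    cases y with
    | nil => simp [hf]
    | cons c y =>
      simp only [List.length_cons] at hl
      rw [h (a :: x) (by simp) (by simp; omega)]
      exact blockComp_congr_components _ fun z hz hzl =>
        h z hz (by simp only [List.length_cons] at hzl ⊢; omega)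

/-- If `f` vanishes on lists shorter than `l`, only the decomposition of `l` into blocks of length
one contributes. -/
theorem blockComp_eq_of_vanish {f : List W → X} {l : List V}
    (h : ∀ x, x.length < l.length → f x = 0) :
    blockComp φ f l = f (l.map fun a => φ [a]) := by
  induction l generalizing f with
  | nil => rfl
  | cons a l ih =>
    rw [blockComp_cons, deconcSum_eq_single [] l (List.nil_append l), ih]
    · rfl
    · exact fun x hx => h _ (by simpa using hx)
    · intro x y hxy hx
      have hl := congrArg List.length hxy
      have hx' := List.length_pos_iff.2 hx
      simp only [List.length_append] at hl
      rw [blockComp_congr (f' := fun _ => 0), blockComp_zero]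
      intro z _ hz
      exact h _ (by simp; omega)

end BlockComposition

/-! ### Entrywise maps and coalgebra morphisms -/

section Relabelling

variable {U V W Z : Type*} [AddCommGroup Z]

theorem blockComp_map_components (g : U → W) (f : List W → Z) (φ : List V → U) (l : List V) :
    blockComp (fun x => g (φ x)) f l = blockComp φ (fun x => f (x.map g)) l := by
  induction hn : l.length using Nat.strong_induction_on generalizing f l with
  | _ n ih =>
    cases l with
    | nil => rfl
    | cons a l =>
      rw [blockComp_cons, blockComp_cons]
      refine deconcSum_congr fun x y hxy => ?_
      rw [ih y.length _ _ y rfl]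
      · rfl
      · rw [← hn, ← hxy]
        simp

theorem blockComp_map (g : U → V) (φ : List V → W) (f : List W → Z) (l : List U) :
    blockComp φ f (l.map g) = blockComp (fun x => φ (x.map g)) f l := by
  induction hn : l.length using Nat.strong_induction_on generalizing f l with
  | _ n ih =>
    cases l with
    | nil => rfl
    | cons a l =>
      rw [List.map_cons, blockComp_cons, blockComp_cons, deconcSum_map]
      refine deconcSum_congr fun x y hxy => ?_
      rw [ih y.length _ _ y rfl]
      · rfl
      · rw [← hn, ← hxy]
        simp

end Relabelling

/-! ### Composition of coalgebra morphisms and intertwining of coderivations -/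

section Composition

variable {k : Type v} [Field k] {V W X Y : Type*} [AddCommGroup W] [Module k W]
  [AddCommGroup X] [Module k X] [AddCommGroup Y] [Module k Y]

/-- The value of a composite with a coalgebra morphism, the first entry being left alone. -/
def ListMultilinear.headComp {f : List W → X} (hf : ListMultilinear k f) (φ : List V → W)
    (y : List V) : W →+ X :=
  AddMonoidHom.mk' (fun w => blockComp φ (fun z => f (w :: z)) y) fun u v => by
    simp only [hf.cons_add, blockComp_add]

theorem ListMultilinear.headComp_apply {f : List W → X} (hf : ListMultilinear k f)
    (φ : List V → W) (y : List V) (w : W) :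
    hf.headComp φ y w = blockComp φ (fun z => f (w :: z)) y := rfl

/-- Composition of coalgebra morphisms is associative. -/
theorem blockComp_assoc {W : Type*} (φ : List V → W) (ψ : List W → X) {f : List X → Y}
    (hf : ListMultilinear k f) (l : List V) :
    blockComp φ (blockComp ψ f) l = blockComp (blockComp φ ψ) f l := by
  induction hn : l.length using Nat.strong_induction_on generalizing f l with
  | _ n ih =>
    cases l with
    | nil => rfl
    | cons a l =>
      rw [blockComp_cons, blockComp_cons]
      simp only [blockComp_cons ψ, blockComp_deconcSum]
      rw [deconcSum_assoc fun x y z => blockComp φ (fun x' =>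
        blockComp φ (blockComp ψ fun u => f (ψ (φ (a :: x) :: x') :: u)) z) y]
      refine deconcSum_congr fun x y hxy => ?_
      have hy : y.length < n := by
        rw [← hn, ← hxy]
        simp
      simp only [ih y.length hy (hf.cons _) y rfl]
      simp only [blockComp_cons φ ψ, ← hf.headComp_apply, map_deconcSum, map_blockComp]

/-- The composite of a coalgebra morphism and a coderivation, sorted by the first block. -/
theorem coderiv_blockComp_cons {s : V → V} (b : List V → V) {s' : W → W} {φ : List V → W}
    (hφ : ∀ l, φ (l.map s) = s' (φ l)) {f : List W → X} (hf : ListMultilinear k f)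
    (a : V) (l : List V) : coderiv s b (blockComp φ f) (a :: l) =
      deconcSum (fun x y => blockComp φ (fun z => f (coderiv s b φ (a :: x) :: z)) y +
        coderiv s b (blockComp φ fun z => f (s' (φ (a :: x)) :: z)) y) l := by
  rw [coderiv_cons]
  simp only [blockComp_cons]
  rw [coderiv_deconcSum, deconcSum_assoc fun x y z =>
    blockComp φ (fun z' => f (φ (b (a :: x) :: y) :: z')) z, ← deconcSum_add]
  refine deconcSum_congr fun x y _ => ?_
  have h1 : φ (s a :: x.map s) = s' (φ (a :: x)) := hφ (a :: x)
  rw [← hf.headComp_apply φ y (coderiv s b φ (a :: x)), coderiv_cons, map_add, map_deconcSum,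
    map_coderiv, h1]
  simp only [hf.headComp_apply]
  abel

/-- The composite of a coderivation and a coalgebra morphism, sorted by the first block. -/
theorem blockComp_coderiv_cons (s' : W → W) (b' : List W → W) (φ : List V → W)
    {f : List W → X} (hf : ListMultilinear k f)
    (a : V) (l : List V) : blockComp φ (coderiv s' b' f) (a :: l) =
      deconcSum (fun x y => blockComp φ (fun z => f (blockComp φ b' (a :: x) :: z)) y +
        blockComp φ (coderiv s' b' fun z => f (s' (φ (a :: x)) :: z)) y) l := by
  rw [blockComp_cons]
  simp only [coderiv_cons, blockComp_add, blockComp_deconcSum]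
  rw [deconcSum_add, deconcSum_assoc fun x y z => blockComp φ (fun x' =>
    blockComp φ (fun u => f (b' (φ (a :: x) :: x') :: u)) z) y, ← deconcSum_add]
  refine deconcSum_congr fun x y _ => ?_
  rw [← hf.headComp_apply φ y (blockComp φ b' (a :: x)), blockComp_cons, map_deconcSum]
  simp only [map_blockComp]
  simp only [hf.headComp_apply]
  abel

/-- If `φ` intertwines `b` and `b'` on short lists, so does the coalgebra morphism. -/
theorem coderiv_blockComp_of_lt {s : V → V} {b : List V → V} {s' : W → W} {b' : List W → W}
    {φ : List V → W} (hφ : ∀ l, φ (l.map s) = s' (φ l)) {n : ℕ}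
    (h : ∀ l, l.length < n → coderiv s b φ l = blockComp φ b' l)
    {f : List W → X} (hf : ListMultilinear k f) {l : List V} (hl : l.length < n) :
    coderiv s b (blockComp φ f) l = blockComp φ (coderiv s' b' f) l := by
  induction hm : l.length using Nat.strong_induction_on generalizing f l with
  | _ m ih =>
    cases l with
    | nil => simp
    | cons a l =>
      rw [coderiv_blockComp_cons b hφ hf, blockComp_coderiv_cons s' b' φ hf]
      refine deconcSum_congr fun x y hxy => ?_
      have hl' := congrArg List.length hxy
      simp only [List.length_append, List.length_cons] at hl' hm hl
      rw [h (a :: x) (by simp; omega), ih y.length (by omega) (hf.cons _) (by omega) rfl]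

/-- If `φ` intertwines `b` and `b'`, so does the coalgebra morphism. -/
theorem coderiv_blockComp {s : V → V} {b : List V → V} {s' : W → W} {b' : List W → W}
    {φ : List V → W} (hφ : ∀ l, φ (l.map s) = s' (φ l))
    (h : ∀ l, coderiv s b φ l = blockComp φ b' l)
    {f : List W → X} (hf : ListMultilinear k f) (l : List V) :
    coderiv s b (blockComp φ f) l = blockComp φ (coderiv s' b' f) l :=
  coderiv_blockComp_of_lt hφ (fun l _ => h l) hf l.length.lt_succ_self

/-- If `φ` intertwines `b` and `b'` on lists shorter than `l`, the defect of the coalgebra morphism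
on `l` comes from the whole list as a single block. -/
theorem blockComp_coderiv_sub {s : V → V} {b : List V → V} {s' : W → W} {b' : List W → W}
    {φ : List V → W} (hφ : ∀ l, φ (l.map s) = s' (φ l)) {l : List V} (hl : l ≠ [])
    (h : ∀ x, x.length < l.length → coderiv s b φ x = blockComp φ b' x)
    {f : List W → X} (hf : ListMultilinear k f) :
    blockComp φ (coderiv s' b' f) l - coderiv s b (blockComp φ f) l =
      f [blockComp φ b' l - coderiv s b φ l] := by
  cases l with
  | nil => exact absurd rfl hl
  | cons a l =>
    rw [coderiv_blockComp_cons b hφ hf, blockComp_coderiv_cons s' b' φ hf, ← deconcSum_sub,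
      deconcSum_eq_single l [] (List.append_nil l)]
    · simp [hf.cons_sub]
    · intro x y hxy hx
      have hl' := congrArg List.length hxy
      have hy : y ≠ [] := by
        rintro rfl
        exact hx (by simpa using hxy)
      have hy' := List.length_pos_iff.2 hy
      simp only [List.length_append] at hl'
      rw [h (a :: x) (by simp; omega), coderiv_blockComp_of_lt hφ h (hf.cons _) (by simp; omega),
        sub_self]

end Composition

/-! ### Multilinearity of the constructions -/

section Multilinear

variable {k : Type v} [Field k] {V W X Y : Type*} [AddCommGroup V] [Module k V] [AddCommGroup W]
  [Module k W] [AddCommGroup X] [Module k X] [AddCommGroup Y] [Module k Y]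

theorem IsLinearMap.add_apply {f g : V → X} (hf : IsLinearMap k f) (hg : IsLinearMap k g) :
    IsLinearMap k fun x => f x + g x :=
  (hf.mk' f + hg.mk' g).isLinear

theorem IsLinearMap.comp_apply {f : W → X} {g : V → W} (hf : IsLinearMap k f)
    (hg : IsLinearMap k g) : IsLinearMap k fun x => f (g x) :=
  (hf.mk' f ∘ₗ hg.mk' g).isLinear

theorem isLinearMap_deconcSum {U : Type*} {g : V → List U → List U → X}
    (hg : ∀ y z, IsLinearMap k fun x => g x y z) (l : List U) :
    IsLinearMap k fun x => deconcSum (g x) l := by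
  refine ⟨fun x y => ?_, fun c x => ?_⟩
  · rw [← deconcSum_add]
    exact deconcSum_congr fun u v _ => (hg u v).map_add x y
  · refine Eq.trans ?_ (map_deconcSum (DistribSMul.toAddMonoidHom X c) (g x) l).symm
    exact deconcSum_congr fun u v _ => (hg u v).map_smul c x

theorem isLinearMap_coderiv {U : Type*} (s : U → U) (b : List U → U) {g : V → List U → X}
    (hg : ∀ y, IsLinearMap k fun x => g x y) (l : List U) :
    IsLinearMap k fun x => coderiv s b (g x) l := by
  refine ⟨fun x y => ?_, fun c x => ?_⟩
  · rw [← coderiv_add]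
    exact coderiv_congr s b fun z _ _ => (hg z).map_add x y
  · refine Eq.trans ?_ (map_coderiv s b (DistribSMul.toAddMonoidHom X c) (g x) l).symm
    exact coderiv_congr s b fun z _ _ => (hg z).map_smul c x

theorem isLinearMap_blockCompAux {U T : Type*} (φ : List U → T) {g : V → List T → X}
    (hg : ∀ y, IsLinearMap k fun x => g x y) (c l : List U) :
    IsLinearMap k fun x => blockCompAux φ (g x) c l := by
  induction l generalizing g c with
  | nil => exact hg _
  | cons a l ih => exact (ih (fun y => hg _) _).add_apply (ih hg _)

namespace ListMultilinear

theorem zero : ListMultilinear k fun _ : List V => (0 : X) :=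
  fun _ _ => (0 : V →ₗ[k] X).isLinear

theorem add {f g : List V → X} (hf : ListMultilinear k f) (hg : ListMultilinear k g) :
    ListMultilinear k fun l => f l + g l :=
  fun l₁ l₂ => (hf l₁ l₂).add_apply (hg l₁ l₂)

theorem postcomp {f : List V → X} (hf : ListMultilinear k f) (Λ : X →ₗ[k] Y) :
    ListMultilinear k fun l => Λ (f l) :=
  fun l₁ l₂ => Λ.isLinear.comp_apply (hf l₁ l₂)

theorem neg {f : List V → X} (hf : ListMultilinear k f) : ListMultilinear k fun l => -f l :=
  hf.postcomp (-LinearMap.id)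

theorem sub {f g : List V → X} (hf : ListMultilinear k f) (hg : ListMultilinear k g) :
    ListMultilinear k fun l => f l - g l := by
  simpa only [sub_eq_add_neg] using hf.add hg.neg

theorem map {f : List W → X} (hf : ListMultilinear k f) (g : V →ₗ[k] W) :
    ListMultilinear k fun l => f (l.map g) := fun l₁ l₂ => by
  simpa only [List.map_append, List.map_cons] using (hf _ _).comp_apply g.isLinear

/-- Multilinearity is tested on lists of one length at a time, so it passes to the limit of a
stabilising iteration, as `exists_fixedPoint_of_local` requires. -/
theorem of_length {f : List V → X}
    (h : ∀ n, ∃ g : List V → X, ListMultilinear k g ∧ ∀ l, l.length ≤ n → f l = g l) :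
    ListMultilinear k f := by
  intro l₁ l₂
  obtain ⟨g, hg, hfg⟩ := h (l₁.length + l₂.length + 1)
  have : (fun x => f (l₁ ++ x :: l₂)) = fun x => g (l₁ ++ x :: l₂) := by
    funext x
    exact hfg _ (by simp; omega)
  rw [this]
  exact hg l₁ l₂

theorem ite_length {f g : List V → X} (hf : ListMultilinear k f) (hg : ListMultilinear k g)
    (P : ℕ → Prop) [DecidablePred P] :
    ListMultilinear k fun l => if P l.length then f l else g l := by
  intro l₁ l₂
  simp only [List.length_append, List.length_cons]
  split_ifs
  · exact hf l₁ l₂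
  · exact hg l₁ l₂

theorem dropSingle {f : List V → X} (hf : ListMultilinear k f) :
    ListMultilinear k (dropSingle f) :=
  hf.ite_length zero (2 ≤ ·)

theorem onSingle (g : V →ₗ[k] X) : ListMultilinear k (onSingle g) := by
  intro l₁ l₂
  match l₁, l₂ with
  | [], [] => exact g.isLinear
  | [], c :: l₂ => exact (0 : V →ₗ[k] X).isLinear
  | [c], l₂ => exact (0 : V →ₗ[k] X).isLinear
  | c :: d :: l₁, l₂ => exact (0 : V →ₗ[k] X).isLinear

theorem deconcSum {g : List V → List V → X} (h₁ : ∀ y, ListMultilinear k fun x => g x y)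
    (h₂ : ∀ x, ListMultilinear k (g x)) : ListMultilinear k (deconcSum g) := by
  intro l₁ l₂
  induction l₁ generalizing g with
  | nil =>
    exact (h₂ [] [] l₂).add_apply (isLinearMap_deconcSum (fun y z => h₁ z [] y) l₂)
  | cons a l₁ ih =>
    exact (h₂ [] (a :: l₁) l₂).add_apply (ih (fun y => (h₁ y).cons a) fun x => h₂ (a :: x))

theorem coderiv (s : V →ₗ[k] V) {b : List V → V} (hb : ListMultilinear k b) {f : List V → X}
    (hf : ListMultilinear k f) : ListMultilinear k (coderiv s b f) := by
  intro l₁ l₂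
  induction l₁ generalizing f with
  | nil =>
    refine (isLinearMap_coderiv s b (fun y => ?_) l₂).add_apply
      (isLinearMap_deconcSum (fun y z => ?_) l₂)
    · exact (hf [] y).comp_apply s.isLinear
    · exact (hf [] z).comp_apply (hb [] y)
  | cons a l₁ ih =>
    refine (ih (hf.cons (s a))).add_apply (deconcSum (fun y => ?_) (fun x => hf.cons _) l₁ l₂)
    exact fun m₁ m₂ => (hf [] y).comp_apply (hb (a :: m₁) m₂)

theorem blockComp {φ : List V → W} (hφ : ListMultilinear k φ) {f : List W → X}
    (hf : ListMultilinear k f) : ListMultilinear k (blockComp φ f) := by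
  have block : ∀ {f : List W → X}, ListMultilinear k f → ∀ c₁ c₂ l,
      IsLinearMap k fun x => blockCompAux φ f (c₁ ++ x :: c₂) l := by
    intro f hf c₁ c₂ l
    induction l generalizing f c₂ with
    | nil => exact (hf [] []).comp_apply (hφ c₁ c₂)
    | cons a l ih =>
      refine IsLinearMap.add_apply ?_ ?_
      · exact isLinearMap_blockCompAux φ (fun y => (hf [] y).comp_apply (hφ c₁ c₂)) [a] l
      · simpa using ih hf (c₂ ++ [a])
  have aux : ∀ {f : List W → X}, ListMultilinear k f → ∀ c l₁ l₂,
      IsLinearMap k fun x => blockCompAux φ f c (l₁ ++ x :: l₂) := by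
    intro f hf c l₁ l₂
    induction l₁ generalizing f c with
    | nil => exact (block (hf.cons _) [] [] l₂).add_apply (block hf c [] l₂)
    | cons a l₁ ih => exact (ih (hf.cons _) [a]).add_apply (ih hf (c ++ [a]))
  intro l₁ l₂
  cases l₁ with
  | nil => exact block hf [] [] l₂
  | cons a l₁ => exact aux hf [a] l₁ l₂

end ListMultilinear

end Multilinear

/-! ### Equivariance -/

/-- The function on lists `f` satisfies `t (f l) = c • f (s l)`. -/
def ListEquivariant {k : Type v} [Field k] {V X : Type*} [AddCommGroup X] [Module k X]
    (s : V → V) (t : X → X) (c : k) (f : List V → X) : Prop :=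
  ∀ l, t (f l) = c • f (l.map s)

section Equivariant

variable {k : Type v} [Field k] {V W X Y : Type*} [AddCommGroup V] [Module k V] [AddCommGroup W]
  [Module k W] [AddCommGroup X] [Module k X] [AddCommGroup Y] [Module k Y]

namespace ListEquivariant

variable {s : V →ₗ[k] V} {r : W →ₗ[k] W} {t : X →ₗ[k] X} {t' : Y →ₗ[k] Y} {c c' : k}

theorem zero : ListEquivariant s t c fun _ => 0 := fun l => by simp

theorem add {f g : List V → X} (hf : ListEquivariant s t c f) (hg : ListEquivariant s t c g) :
    ListEquivariant s t c fun l => f l + g l := fun l => by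
  simp only [map_add, smul_add, hf l, hg l]

theorem postcomp {f : List V → X} (hf : ListEquivariant s t c f) {Λ : X →ₗ[k] Y}
    (hΛ : ∀ x, t' (Λ x) = c' • Λ (t x)) : ListEquivariant s t' (c' * c) fun l => Λ (f l) :=
  fun l => by rw [hΛ, hf l, map_smul, smul_smul]

theorem neg {f : List V → X} (hf : ListEquivariant s t c f) :
    ListEquivariant s t c fun l => -f l := fun l => by rw [map_neg, hf l, smul_neg]

theorem sub {f g : List V → X} (hf : ListEquivariant s t c f) (hg : ListEquivariant s t c g) :
    ListEquivariant s t c fun l => f l - g l := by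
  simpa only [sub_eq_add_neg] using hf.add hg.neg

theorem map {f : List W → X} (hf : ListEquivariant r t c f) {g : V →ₗ[k] W}
    (hg : ∀ x, r (g x) = g (s x)) : ListEquivariant s t c fun l => f (l.map g) := fun l => by
  have h : (r ∘ g : V → W) = g ∘ s := funext hg
  change t (f (l.map g)) = c • f ((l.map s).map g)
  rw [hf, List.map_map, List.map_map, h]

theorem of_length {f : List V → X}
    (h : ∀ n, ∃ g : List V → X, ListEquivariant s t c g ∧ ∀ l, l.length ≤ n → f l = g l) :
    ListEquivariant s t c f := by
  intro l
  obtain ⟨g, hg, hfg⟩ := h l.length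
  rw [hfg l le_rfl, hfg (l.map s) (by simp), hg l]

theorem ite_length {f g : List V → X} (hf : ListEquivariant s t c f)
    (hg : ListEquivariant s t c g) (P : ℕ → Prop) [DecidablePred P] :
    ListEquivariant s t c fun l => if P l.length then f l else g l := by
  intro l
  simp only [List.length_map]
  split_ifs
  · exact hf l
  · exact hg l

theorem dropSingle {f : List V → X} (hf : ListEquivariant s t c f) :
    ListEquivariant s t c (dropSingle f) :=
  hf.ite_length zero (2 ≤ ·)

theorem onSingle {g : V →ₗ[k] X} (hg : ∀ x, t (g x) = c • g (s x)) :
    ListEquivariant s t c (onSingle g) := by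
  intro l
  match l with
  | [] => simp
  | [a] => exact hg a
  | a :: b :: l => simp

theorem deconcSum_apply {g g' : List V → List V → X}
    (h : ∀ x y, t (g x y) = c • g' (x.map s) (y.map s)) (l : List V) :
    t (deconcSum g l) = c • deconcSum g' (l.map s) := by
  rw [deconcSum_map, ← DistribSMul.toAddMonoidHom_apply X c, ← LinearMap.toAddMonoidHom_coe,
    map_deconcSum, map_deconcSum]
  exact deconcSum_congr fun x y _ => h x y

theorem coderiv {s' : V →ₗ[k] V} {b : List V → V} (hs : ∀ x, s (s' x) = s' (s x))
    (hb : ListEquivariant s s c' b) {f : List V → X} (hf : ListMultilinear k f)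
    (h : ListEquivariant s t c f) : ListEquivariant s t (c * c') (coderiv s' b f) := by
  -- Removing the head replaces `f` by `f (s' a :: ·)`, which is equivariant only relative to the
  -- different function `f (s' (s a) :: ·)`. The induction therefore runs over pairs.
  have key : ∀ {f f' : List V → X}, ListMultilinear k f' → (∀ l, t (f l) = c • f' (l.map s)) →
      ∀ l, t (_root_.coderiv s' b f l) = (c * c') • _root_.coderiv s' b f' (l.map s) := by
    intro f f' hf' h l
    induction l generalizing f f' with
    | nil => simp
    | cons a l ih =>
      rw [coderiv_cons, List.map_cons, coderiv_cons, map_add, smul_add,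
        ih (hf'.cons (s' (s a))) fun z => by rw [h, List.map_cons, hs]]
      congr 1
      refine deconcSum_apply (fun x y => ?_) l
      rw [h, List.map_cons, hb, hf'.cons_smul, smul_smul, List.map_cons]
  exact key hf h

theorem blockComp {φ : List V → W} {f : List W → X} (hφ : ListEquivariant s r (1 : k) φ)
    (hf : ListEquivariant r t c f) : ListEquivariant s t c (blockComp φ f) := by
  intro l
  have h : (fun x : List V => φ (x.map s)) = fun x => r (φ x) :=
    funext fun x => ((hφ x).trans (one_smul k _)).symm
  rw [blockComp_map, h, blockComp_map_components r f φ, ← DistribSMul.toAddMonoidHom_apply X c,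
    ← LinearMap.toAddMonoidHom_coe, map_blockComp, map_blockComp]
  exact congrArg (fun g => _root_.blockComp φ g l) (funext hf)

end ListEquivariant

end Equivariant

/-! ### Maps concentrated on lists of length one -/

section OnSingle

variable {k : Type v} [Field k] {V W X Y : Type*} [AddCommGroup V] [Module k V] [AddCommGroup W]
  [Module k W] [AddCommGroup X] [Module k X] [AddCommGroup Y] [Module k Y]

/-- The outer function only sees lists of length one, so the decomposition into a single block is
the only one that counts. -/
theorem blockComp_onSingle {U T : Type*} (φ : List U → T) (g : T → X) {l : List U} (hl : l ≠ []) :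
    blockComp φ (onSingle g) l = g (φ l) := by
  cases l with
  | nil => exact absurd rfl hl
  | cons a l =>
    rw [blockComp_cons, deconcSum_eq_single l [] (List.append_nil l)]
    · rfl
    · intro x y hxy hx
      rw [blockComp_congr (f' := fun _ => 0), blockComp_zero]
      intro z hz _
      refine onSingle_of_length_ne _ ?_
      have hz' := List.length_pos_iff.2 (hz fun hy => hx (by simpa [hy] using hxy))
      simp only [List.length_cons]
      omega

/-- Blocks with more than one entry are sent to zero, and multilinearity kills their terms. -/
theorem onSingle_blockComp {U : Type*} (g : U → V) {f : List V → X} (hf : ListMultilinear k f)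
    (l : List U) : blockComp (onSingle g) f l = f (l.map g) := by
  induction l generalizing f with
  | nil => rfl
  | cons a l ih =>
    rw [blockComp_cons, deconcSum_eq_single [] l (List.nil_append l)]
    · exact ih (hf.cons _)
    · intro x y _ hx
      obtain ⟨c, x, rfl⟩ := List.exists_cons_of_ne_nil hx
      simp only [onSingle_cons_cons, hf.cons_zero, blockComp_zero]

theorem coderiv_onSingle {U : Type*} (s : U → U) (b : List U → U) (g : U → X) {l : List U}
    (hl : l ≠ []) : coderiv s b (onSingle g) l = g (b l) := by
  cases l with
  | nil => exact absurd rfl hl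
  | cons a l =>
    rw [coderiv_cons, coderiv_congr (f' := fun _ => 0), coderiv_zero, zero_add,
      deconcSum_eq_single l [] (List.append_nil l)]
    · rfl
    · intro x y hxy hx
      refine onSingle_of_length_ne _ ?_
      have : y ≠ [] := fun hy => hx (by simpa [hy] using hxy)
      simpa using this
    · intro x hx _
      exact onSingle_of_length_ne _ (by simpa using hx)

theorem coderiv_onSingle_cons (s g : V → V) {f : List V → X} (hf : ListMultilinear k f)
    (a : V) (l : List V) : coderiv s (onSingle g) f (a :: l) =
      coderiv s (onSingle g) (fun x => f (s a :: x)) l + f (g a :: l) := by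
  rw [coderiv_cons, deconcSum_eq_single [] l (List.nil_append l)]
  · rfl
  · intro x y _ hx
    obtain ⟨c, x, rfl⟩ := List.exists_cons_of_ne_nil hx
    rw [onSingle_cons_cons, hf.cons_zero]

theorem coderiv_add_components (s : V → V) (b b' : List V → V) {f : List V → X}
    (hf : ListMultilinear k f) (l : List V) :
    coderiv s (fun x => b x + b' x) f l = coderiv s b f l + coderiv s b' f l := by
  induction l generalizing f with
  | nil => simp
  | cons a l ih =>
    simp only [coderiv_cons, ih (hf.cons _), hf.cons_add, deconcSum_add]
    abel

/-- A coderivation whose components vanish on lists of length one shortens lists. -/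
theorem coderiv_congr_of_singleton {s : V → V} {b : List V → V} (hb : ∀ a, b [a] = 0)
    {f f' : List V → X} (hf : ListMultilinear k f) (hf' : ListMultilinear k f') {l : List V}
    (h : ∀ x, x.length < l.length → f x = f' x) : coderiv s b f l = coderiv s b f' l := by
  induction l generalizing f f' with
  | nil => rfl
  | cons a l ih =>
    rw [coderiv_cons, coderiv_cons]
    congr 1
    · exact ih (hf.cons _) (hf'.cons _) fun x hx => h _ (by simpa using hx)
    · refine deconcSum_congr fun x y hxy => ?_
      cases x with
      | nil => rw [hb, hf.cons_zero, hf'.cons_zero]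
      | cons c x =>
        refine h _ ?_
        simp [← hxy]

theorem coderiv_zero_components (s : V → V) {f : List V → X}
    (hf : ListMultilinear k f) (l : List V) : coderiv s (fun _ => 0) f l = 0 := by
  induction l generalizing f with
  | nil => rfl
  | cons a l ih =>
    rw [coderiv_cons, ih (hf.cons _), zero_add]
    exact deconcSum_eq_zero fun x y _ => hf.cons_zero y

/-- If the components `b` vanish on lists shorter than `l`, only the whole list contributes. -/
theorem coderiv_eq_of_vanish (s : V → V) {b : List V → V} {f : List V → X}
    (hf : ListMultilinear k f) {l : List V} (hl : l ≠ [])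
    (hb : ∀ x, x.length < l.length → b x = 0) : coderiv s b f l = f [b l] := by
  have h0 : ∀ (f : List V → X) (l : List V), ListMultilinear k f →
      (∀ x, x.length ≤ l.length → b x = 0) → coderiv s b f l = 0 := by
    intro f l hf h
    induction l generalizing f with
    | nil => rfl
    | cons a l ih =>
      rw [coderiv_cons, ih _ (hf.cons _) fun x hx => h x (by simp; omega), zero_add]
      refine deconcSum_eq_zero fun x y hxy => ?_
      rw [h (a :: x) (by simp [← hxy]), hf.cons_zero]
  cases l with
  | nil => exact absurd rfl hl
  | cons a l =>
    rw [coderiv_cons, h0 _ _ (hf.cons _) fun x hx => hb x (by simp; omega), zero_add,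
      deconcSum_eq_single l [] (List.append_nil l)]
    intro x y hxy hx
    have hy := List.length_pos_iff.2 fun hy : y = [] => hx (by simpa [hy] using hxy)
    rw [hb (a :: x) (by simp [← hxy]; omega), hf.cons_zero]

/-- Each term has an entry in the image of `p ∘ g = 0`. -/
theorem coderiv_onSingle_comp_map (s : V → V) {g : V → V} {p : V →ₗ[k] W} (hp : ∀ a, p (g a) = 0)
    {f : List W → X} (hf : ListMultilinear k f) (l : List V) :
    coderiv s (onSingle g) (fun x => f (x.map p)) l = 0 := by
  induction l generalizing f with
  | nil => rfl
  | cons a l ih =>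
    rw [coderiv_cons]
    simp only [List.map_cons]
    rw [ih (hf.cons _), zero_add]
    refine deconcSum_eq_zero fun x y _ => ?_
    cases x with
    | nil => rw [onSingle_singleton, hp, hf.cons_zero]
    | cons c x => rw [onSingle_cons_cons, map_zero, hf.cons_zero]

/-- The tensor trick: `h` and its associated homotopy on lists. -/
theorem coderiv_onSingle_homotopy {s d h π : V →ₗ[k] V} (hss : ∀ a, s (s a) = a)
    (hsd : ∀ a, d (s a) = -s (d a)) (hsh : ∀ a, h (s a) = -s (h a))
    (hsπ : ∀ a, π (s a) = s (π a)) (hdπ : ∀ a, d (π a) = 0) (hπd : ∀ a, π (d a) = 0)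
    (hdh : ∀ a, d (h a) + h (d a) = a - π a) {f : List V → X} (hf : ListMultilinear k f)
    (l : List V) :
    coderiv s (onSingle d) (coderiv (s ∘ₗ π) (onSingle h) f) l +
      coderiv (s ∘ₗ π) (onSingle h) (coderiv s (onSingle d) f) l = f l - f (l.map π) := by
  induction l generalizing f with
  | nil => simp
  | cons a l ih =>
    have h₁ : ListMultilinear k (coderiv (s ∘ₗ π) (onSingle h) f) :=
      ListMultilinear.coderiv (s ∘ₗ π) (ListMultilinear.onSingle h) hf
    have h₂ : ListMultilinear k (coderiv s (onSingle d) f) :=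
      ListMultilinear.coderiv s (ListMultilinear.onSingle d) hf
    rw [coderiv_onSingle_cons _ _ h₁, coderiv_onSingle_cons _ _ h₂]
    -- The two terms with `h` on the head and `d` further right cancel because `h` anticommutes with
    -- `s`. With `h` further right the head has passed through `π`, and `d` on it gives zero by `dπ
    -- = πd = 0`. What is left is `dh + hd` on the head, and the induction hypothesis with head `π
    -- a`; their sum telescopes.
    simp only [coderiv_onSingle_cons _ _ hf, coderiv_add, LinearMap.comp_apply, hss, hsπ, hsd,
      hsh, hπd, hdπ, map_zero, neg_zero, hf.cons_zero, coderiv_zero, hf.cons_neg, coderiv_neg]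
    have key := ih (hf.cons (π a))
    have h₃ : f (d (h a) :: l) + f (h (d a) :: l) = f (a :: l) - f (π a :: l) := by
      rw [← hf.cons_add, hdh, hf.cons_sub]
    simp only [List.map_cons]
    rw [← sub_add_sub_cancel (f (a :: l)) (f (π a :: l)), ← h₃, ← key]
    abel

end OnSingle

/-! ### Strict units -/

/-- Strict unitality of shifted operations: `s` is the Koszul sign of shifted elements. -/
structure IsUnitalOp {V : Type*} [AddCommGroup V] (s : V → V) (η : V) (b : List V → V) : Prop where
  left : ∀ a, b [η, a] = a
  right : ∀ a, b [a, η] = -s a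
  vanish : ∀ l, η ∈ l → l.length ≠ 2 → b l = 0

/-- Strict unitality of the components of a morphism. -/
structure IsUnitalMap {V W : Type*} [Zero W] (η : V) (θ : W) (φ : List V → W) : Prop where
  map_unit : φ [η] = θ
  vanish : ∀ l, η ∈ l → l.length ≠ 1 → φ l = 0

section Unital

variable {k : Type v} [Field k] {V W X Y : Type*} [AddCommGroup V] [Module k V] [AddCommGroup W]
  [Module k W] [AddCommGroup X] [Module k X] [AddCommGroup Y] [Module k Y]

theorem IsUnitalOp.dropSingle {s : V → V} {η : V} {b : List V → V} (hb : IsUnitalOp s η b) :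
    IsUnitalOp s η (dropSingle b) where
  left a := hb.left a
  right a := hb.right a
  vanish l hl h := by
    unfold _root_.dropSingle
    split_ifs
    · exact hb.vanish l hl h
    · rfl

namespace IsUnitalMap

variable {U : Type*} {η : U} {θ : W} {φ : List U → W}

/-- A block containing `η` is killed by `φ` unless it is `[η]`, and then it becomes an entry `θ`,
which kills `f`. -/
theorem blockComp_eq_zero (hφ : IsUnitalMap η θ φ) {f : List W → X} (hf : ListMultilinear k f)
    (h : ∀ l, θ ∈ l → f l = 0) {l : List U} (hl : η ∈ l) : blockComp φ f l = 0 := by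
  induction hn : l.length using Nat.strong_induction_on generalizing f l with
  | _ n ih =>
    cases l with
    | nil => simp at hl
    | cons a l =>
      rw [blockComp_cons]
      refine deconcSum_eq_zero fun x y hxy => ?_
      by_cases hx : η ∈ a :: x
      · by_cases hx' : x = []
        · subst hx'
          obtain rfl : η = a := by simpa using hx
          simp only [hφ.map_unit, h _ List.mem_cons_self, blockComp_zero]
        · rw [hφ.vanish _ hx (by simpa using hx')]
          simp only [hf.cons_zero, blockComp_zero]
      · refine ih y.length ?_ (hf.cons _) (fun z hz => h _ (List.mem_cons_of_mem _ hz)) ?_ rfl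
        · rw [← hn, ← hxy]
          simp
        · rw [← hxy, ← List.cons_append, List.mem_append] at hl
          exact hl.resolve_left hx

/-- The variant for functions that need not vanish on `[θ]`, such as the components of a unital map.
A list with at least two entries reaches `[θ]` only through a block of length at least two
containing `η`, which `φ` kills. -/
theorem blockComp_eq_zero_of_two_le (hφ : IsUnitalMap η θ φ) {f : List W → X}
    (hf : ListMultilinear k f) (h : ∀ l, θ ∈ l → 2 ≤ l.length → f l = 0) {l : List U}
    (hl : η ∈ l) (hl' : 2 ≤ l.length) : blockComp φ f l = 0 := by
  cases l with
  | nil => simp at hl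
  | cons a l =>
    rw [blockComp_cons]
    refine deconcSum_eq_zero fun x y hxy => ?_
    by_cases hx : η ∈ a :: x ∧ x ≠ []
    · rw [hφ.vanish _ hx.1 (by simpa using hx.2)]
      simp only [hf.cons_zero, blockComp_zero]
    · by_cases hy : η ∈ y
      · refine hφ.blockComp_eq_zero (hf.cons _) (fun z hz => h _ (List.mem_cons_of_mem _ hz) ?_) hy
        have := List.length_pos_of_mem hz
        simp only [List.length_cons]
        omega
      · rw [← hxy, ← List.cons_append, List.mem_append] at hl
        have hx₁ := hl.resolve_right hy
        obtain rfl : x = [] := by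
          by_contra hne
          exact hx ⟨hx₁, hne⟩
        obtain rfl : η = a := by simpa using hx₁
        obtain rfl : y = l := hxy
        rw [blockComp_congr (f' := fun _ => 0), blockComp_zero]
        intro z hz _
        rw [hφ.map_unit]
        refine h _ List.mem_cons_self ?_
        have := List.length_pos_iff.2 (hz fun h => by simp [h] at hl')
        simp only [List.length_cons]
        omega

theorem comp {ζ : X} {ψ : List W → X} (hφ : IsUnitalMap η θ φ) (hψ : IsUnitalMap θ ζ ψ)
    (hψl : ListMultilinear k ψ) : IsUnitalMap η ζ (blockComp φ ψ) where
  map_unit := by rw [blockComp_singleton, hφ.map_unit, hψ.map_unit]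
  vanish l hl h := by
    refine hφ.blockComp_eq_zero_of_two_le hψl (fun l hl h => hψ.vanish l hl (by omega)) hl ?_
    have := List.length_pos_of_mem hl
    omega

/-- The entry `η` must form its own block, and then `b` is nonzero only on two blocks. So `η` lies
at an end of the list and the rest is a single block. -/
theorem blockComp_unitalOp (hφ : IsUnitalMap η θ φ) {s : W → W} {b : List W → W}
    (hb : IsUnitalOp s θ b) (hbl : ListMultilinear k b) (l₁ l₂ : List U)
    (h : l₁ ≠ [] ∨ l₂ ≠ []) : blockComp φ b (l₁ ++ η :: l₂) =
      (if l₁ = [] then φ l₂ else 0) + if l₂ = [] then -s (φ l₁) else 0 := by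
  have hb' : ∀ w z, θ ∈ z → 2 ≤ z.length → b (w :: z) = 0 := fun w z hz hz' =>
    hb.vanish _ (List.mem_cons_of_mem _ hz) (by simp only [List.length_cons]; omega)
  cases l₁ with
  | nil =>
    have hl₂ : l₂ ≠ [] := by simpa using h
    have hs : (fun z => b (θ :: z)) = onSingle fun w => w := by
      funext z
      match z with
      | [] => exact hb.vanish _ (by simp) (by simp)
      | [w] => exact hb.left w
      | w :: w' :: z => exact hb.vanish _ (by simp) (by simp)
    rw [List.nil_append, blockComp_cons, deconcSum_eq_single [] l₂ (List.nil_append _),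
      hφ.map_unit, hs, blockComp_onSingle _ _ hl₂]
    · simp [hl₂]
    · intro x y _ hx
      rw [hφ.vanish _ List.mem_cons_self (by simpa using hx)]
      simp only [hbl.cons_zero, blockComp_zero]
  | cons a l₁ =>
    rw [List.cons_append, blockComp_cons]
    have hzero : ∀ x y, x ++ y = l₁ ++ η :: l₂ → ¬(x = l₁ ∧ l₂ = []) →
        blockComp φ (fun z => b (φ (a :: x) :: z)) y = 0 := by
      intro x y hxy hne
      by_cases hx : η ∈ x
      · rw [hφ.vanish _ (List.mem_cons_of_mem _ hx) (by
          have := List.length_pos_of_mem hx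
          simp only [List.length_cons]
          omega)]
        simp only [hbl.cons_zero, blockComp_zero]
      · have hy : η ∈ y := by
          have : η ∈ x ++ y := by simp [hxy]
          exact (List.mem_append.1 this).resolve_left hx
        refine hφ.blockComp_eq_zero_of_two_le (hbl.cons _) (hb' _) hy ?_
        by_contra hy'
        obtain ⟨c, rfl⟩ : ∃ c, y = [c] := List.length_eq_one_iff.1 (by
          have := List.length_pos_of_mem hy
          omega)
        obtain rfl : η = c := by simpa using hy
        rcases List.eq_nil_or_concat l₂ with rfl | ⟨l', c, rfl⟩
        · exact hne ⟨by simpa using hxy, rfl⟩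
        · refine hx ?_
          rw [List.concat_eq_append, ← List.cons_append, ← List.append_assoc] at hxy
          rw [List.append_inj_left' hxy rfl]
          simp
    by_cases hl₂ : l₂ = []
    · subst hl₂
      rw [deconcSum_eq_single l₁ [η] rfl fun x y hxy hx => hzero x y hxy (by simp [hx])]
      simp [hφ.map_unit, hb.right]
    · rw [deconcSum_eq_zero fun x y hxy => hzero x y hxy (by simp [hl₂])]
      simp [hl₂]

end IsUnitalMap

/-- Only the products of `η` with its neighbours survive. For an interior `η` the products with the
left and the right neighbour cancel by the sign in `IsUnitalOp.right`; at an end one of them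
remains. The result has the same shape as in `IsUnitalMap.blockComp_unitalOp`, and their agreement
is what makes the recursive constructions preserve units. -/
theorem IsUnitalOp.coderiv_apply {s : V →ₗ[k] V} {η : V} {b : List V → V} (hb : IsUnitalOp s η b)
    (hs : s η = -η) {f : List V → X} (hf : ListMultilinear k f)
    (h : ∀ l, η ∈ l → 2 ≤ l.length → f l = 0) (l₁ l₂ : List V) (hl : l₁ ≠ [] ∨ l₂ ≠ []) :
    coderiv s b f (l₁ ++ η :: l₂) =
      (if l₁ = [] then f l₂ else 0) + if l₂ = [] then -f (l₁.map s) else 0 := by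
  induction l₁ generalizing f with
  | nil =>
    obtain ⟨c, l₂, rfl⟩ := List.exists_cons_of_ne_nil (by simpa using hl)
    rw [List.nil_append, coderiv_cons, deconcSum_eq_single (l := c :: l₂) [c] l₂ rfl]
    · rw [coderiv_congr (f' := fun _ => 0)]
      · simp [hb.left]
      · intro x hx _
        have := List.length_pos_iff.2 hx
        rw [hs, hf.cons_neg, h _ List.mem_cons_self (by simp only [List.length_cons]; omega),
          neg_zero]
    · intro x y hxy hx
      rw [hb.vanish _ List.mem_cons_self, hf.cons_zero]
      intro hlen
      obtain ⟨e, rfl⟩ : ∃ e, x = [e] := List.length_eq_one_iff.1 (by simpa using hlen)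
      exact hx (by simp at hxy; simp [hxy])
  | cons a l₁ ih =>
    have hzero : ∀ x y, x ++ y = l₁ ++ η :: l₂ → ¬(x = [η] ∧ l₁ = []) → f (b (a :: x) :: y) = 0 := by
      intro x y hxy hne
      by_cases hy : η ∈ y
      · have := List.length_pos_of_mem hy
        exact h _ (List.mem_cons_of_mem _ hy) (by simp only [List.length_cons]; omega)
      · have hx : η ∈ x := by
          have : η ∈ x ++ y := by simp [hxy]
          exact (List.mem_append.1 this).resolve_right hy
        rw [hb.vanish _ (List.mem_cons_of_mem _ hx), hf.cons_zero]
        intro hlen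
        obtain ⟨e, rfl⟩ : ∃ e, x = [e] := List.length_eq_one_iff.1 (by simpa using hlen)
        obtain rfl : η = e := by simpa using hx
        cases l₁ with
        | nil => exact hne ⟨rfl, rfl⟩
        | cons c l₁ =>
          obtain ⟨rfl, rfl⟩ := List.cons_eq_cons.1 hxy
          simp at hy
    rw [List.cons_append, coderiv_cons]
    by_cases hl₁ : l₁ = []
    · subst hl₁
      rw [List.nil_append, deconcSum_eq_single (l := η :: l₂) [η] l₂ rfl
        fun x y hxy hx => hzero x y hxy (by simp [hx]), hb.right, hf.cons_neg]
      by_cases hl₂ : l₂ = []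
      · subst hl₂
        have : f [s a, 0] = 0 := (hf.cons (s a)).cons_zero []
        simp [coderiv_cons, hb.vanish [η] (by simp) (by simp), this]
      · rw [← List.nil_append (η :: l₂), ih (hf.cons _) (fun l hl hl' =>
          h _ (List.mem_cons_of_mem _ hl) (by simp only [List.length_cons]; omega)) (Or.inr hl₂)]
        simp [hl₂]
    · rw [deconcSum_eq_zero fun x y hxy => hzero x y hxy (by simp [hl₁]), ih (hf.cons _)
        (fun l hl hl' => h _ (List.mem_cons_of_mem _ hl) (by simp only [List.length_cons]; omega))
        (Or.inl hl₁)]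
      simp [hl₁]

/-- The two sides of the equation of a morphism agree on lists containing the unit. -/
theorem IsUnitalMap.blockComp_eq_coderiv {s : V →ₗ[k] V} {s' : W → W} {η : V} {θ : W}
    {φ : List V → W} (hφ : IsUnitalMap η θ φ) (hφl : ListMultilinear k φ)
    (hφs : ∀ l, φ (l.map s) = s' (φ l)) (hs : s η = -η) {b : List V → V} (hb : IsUnitalOp s η b)
    {b' : List W → W} (hb' : IsUnitalOp s' θ b') (hbl' : ListMultilinear k b') {l : List V}
    (hl : η ∈ l) (hl' : 2 ≤ l.length) : blockComp φ b' l = coderiv s b φ l := by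
  obtain ⟨l₁, l₂, rfl⟩ := List.append_of_mem hl
  have h : l₁ ≠ [] ∨ l₂ ≠ [] := by
    by_contra! h
    simp [h.1, h.2] at hl'
  rw [hφ.blockComp_unitalOp hb' hbl' l₁ l₂ h, hb.coderiv_apply hs hφl
    (fun l hl hl' => hφ.vanish l hl (by omega)) l₁ l₂ h, hφs]

end Unital

/-! ### Fixed points of local operators on functions on lists -/

section FixedPoint

variable {α X : Type*}

/-- An operator on functions on lists for which the value of `F f` on `l` only involves the values
of `f` on lists shorter than `l` has a fixed point. -/
theorem exists_fixedPoint_of_local {F : (List α → X) → List α → X} {Q : (List α → X) → Prop}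
    {f₀ : List α → X} (h₀ : Q f₀) (hQ : ∀ f, Q f → Q (F f))
    (hlim : ∀ f, (∀ n, ∃ g, Q g ∧ ∀ l : List α, l.length ≤ n → f l = g l) → Q f)
    (hF : ∀ f g, Q f → Q g → ∀ l : List α, (∀ x, x.length < l.length → f x = g x) →
      F f l = F g l) : ∃ f, Q f ∧ ∀ l, f l = F f l := by
  have hiter : ∀ n, Q (F^[n] f₀) := fun n => by
    induction n with
    | zero => exact h₀
    | succ n ih =>
      rw [Function.iterate_succ_apply']
      exact hQ _ ih
  have stab : ∀ n (l : List α), l.length < n → F^[n + 1] f₀ l = F^[n] f₀ l := by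
    intro n
    induction n with
    | zero => simp
    | succ n ih =>
      intro l hl
      rw [Function.iterate_succ_apply' F (n + 1), Function.iterate_succ_apply' F n]
      refine hF _ _ (hQ _ (hiter n)) (hiter n) _ fun x hx => ?_
      rw [← Function.iterate_succ_apply' F n]
      exact ih x (by omega)
  have stab' : ∀ (l : List α) n, F^[l.length + 1 + n] f₀ l = F^[l.length + 1] f₀ l := by
    intro l n
    induction n with
    | zero => rfl
    | succ n ih => rw [← Nat.add_assoc, stab _ _ (by omega), ih]
  -- The limit takes on `l` the value of the iterate number `l.length + 1`, from which on the values
  -- at `l` no longer change.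
  have hQf : Q fun l => F^[l.length + 1] f₀ l := by
    refine hlim _ fun n => ⟨_, hiter (n + 1), fun l hl => ?_⟩
    obtain ⟨m, rfl⟩ := Nat.exists_eq_add_of_le hl
    rw [← stab' l m, Nat.add_right_comm]
  refine ⟨_, hQf, fun l => ?_⟩
  rw [Function.iterate_succ_apply']
  refine hF _ _ (hiter _) hQf _ fun x hx => ?_
  obtain ⟨m, hm⟩ := Nat.exists_eq_add_of_le (Nat.succ_le_of_lt hx)
  rw [hm]
  exact stab' x m

end FixedPoint

/-! ### Inverses of coalgebra morphisms -/

section Inverse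

variable {k : Type v} [Field k] {V : Type u} {W : Type w} [AddCommGroup V] [Module k V]
  [AddCommGroup W] [Module k W]

/-- The equation is solved by recursion on length. After relabelling by `e.symm`, the decomposition
into blocks of length one contributes `ψ l` itself, and every other one only involves `ψ` on shorter
lists. Subtracting `ψ l` makes the operator `F` local, and its fixed point is the left inverse. All
equivariances and units of `φ` are treated at once, since they are properties of the same `ψ`. -/
theorem exists_blockComp_left_inverse {φ : List V → W} (hφ : ListMultilinear k φ) (e : V ≃ₗ[k] W)
    (he : ∀ a, φ [a] = e a) : ∃ ψ : List W → V, ListMultilinear k ψ ∧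
      (∀ l, blockComp φ ψ l = onSingle id l) ∧
      (∀ (s : V →ₗ[k] V) (r : W →ₗ[k] W), ListEquivariant s r (1 : k) φ →
        ListEquivariant r s (1 : k) ψ) ∧
      ∀ η θ, IsUnitalMap η θ φ → IsUnitalMap θ η ψ := by
  let F : (List W → V) → List W → V := fun ψ l =>
    onSingle e.symm l - (blockComp φ ψ (l.map e.symm) - ψ l)
  have hmap : ∀ l : List W, (l.map e.symm).map (fun a => φ [a]) = l := fun l => by
    simp [Function.comp_def, he]
  have h0l := ListMultilinear.onSingle (e.symm : W →ₗ[k] V)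
  have hmul : ∀ f, ListMultilinear k f → ListMultilinear k (F f) := fun f hf =>
    h0l.sub (((hφ.blockComp hf).map (e.symm : W →ₗ[k] V)).sub hf)
  have her : ∀ (s : V →ₗ[k] V) (r : W →ₗ[k] W), ListEquivariant s r (1 : k) φ →
      ∀ w, s (e.symm w) = e.symm (r w) := fun s r hsr w => by
    have := hsr [e.symm w]
    rw [List.map_singleton, he, he, one_smul, e.apply_symm_apply] at this
    rw [this, e.symm_apply_apply]
  have h0e : ∀ (s : V →ₗ[k] V) (r : W →ₗ[k] W), ListEquivariant s r (1 : k) φ →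
      ListEquivariant r s (1 : k) (onSingle (e.symm : W →ₗ[k] V)) := fun s r hsr =>
    ListEquivariant.onSingle fun w => by simp [her s r hsr]
  have hθ : ∀ η θ, IsUnitalMap η θ φ → e.symm θ = η ∧ e η = θ := fun η θ hη => by
    rw [← hη.map_unit, he, e.symm_apply_apply]
    exact ⟨rfl, rfl⟩
  obtain ⟨ψ, ⟨h1, h2, h3⟩, h4⟩ := exists_fixedPoint_of_local (F := F)
    (Q := fun ψ => ListMultilinear k ψ ∧
      (∀ (s : V →ₗ[k] V) (r : W →ₗ[k] W), ListEquivariant s r (1 : k) φ →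
        ListEquivariant r s (1 : k) ψ) ∧ ∀ η θ, IsUnitalMap η θ φ → IsUnitalMap θ η ψ)
    (f₀ := onSingle e.symm)
    ⟨h0l, h0e, fun η θ hη => ⟨(hθ η θ hη).1, fun l _ hl => onSingle_of_length_ne _ hl⟩⟩
    (by
      rintro f ⟨hf, hfe, hfu⟩
      refine ⟨hmul f hf, fun s r hsr => ?_, fun η θ hη => ⟨?_, fun l hl hl' => ?_⟩⟩
      · exact (h0e s r hsr).sub (((hsr.blockComp (hfe s r hsr)).map
          (g := (e.symm : W →ₗ[k] V)) (her s r hsr)).sub (hfe s r hsr))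
      · simp [F, he, hθ η θ hη]
      · have hmem : η ∈ l.map e.symm := List.mem_map.2 ⟨θ, hl, (hθ η θ hη).1⟩
        simp only [F]
        rw [onSingle_of_length_ne _ hl', (hfu η θ hη).vanish l hl hl',
          (hη.comp (hfu η θ hη) hf).vanish _ hmem (by simpa using hl')]
        simp)
    (by
      intro f hf
      refine ⟨ListMultilinear.of_length fun n => ?_, fun s r hsr =>
        ListEquivariant.of_length fun n => ?_, fun η θ hη => ⟨?_, fun l hl hl' => ?_⟩⟩
      · obtain ⟨g, hg, hfg⟩ := hf n
        exact ⟨g, hg.1, hfg⟩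
      · obtain ⟨g, hg, hfg⟩ := hf n
        exact ⟨g, hg.2.1 s r hsr, hfg⟩
      · obtain ⟨g, hg, hfg⟩ := hf 1
        rw [hfg [θ] le_rfl, (hg.2.2 η θ hη).map_unit]
      · obtain ⟨g, hg, hfg⟩ := hf l.length
        rw [hfg l le_rfl, (hg.2.2 η θ hη).vanish l hl hl'])
    (by
      intro f g _ _ l h
      have h1 := blockComp_eq_of_vanish φ (f := fun x => f x - g x) (l := l.map e.symm)
        fun x hx => sub_eq_zero.2 (h x (by simpa using hx))
      rw [blockComp_sub, hmap] at h1
      simp only [F]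
      rw [sub_right_inj, sub_eq_sub_iff_sub_eq_sub, h1])
  refine ⟨ψ, h1, fun l => ?_, h2, h3⟩
  have h5 := h4 (l.map e)
  have h6 : (l.map e).map e.symm = l := by simp [Function.comp_def]
  simp only [F, h6] at h5
  have h7 : onSingle e.symm (l.map e) = onSingle id l := by
    match l with
    | [] => rfl
    | [a] => simp
    | a :: b :: l => rfl
  rw [h7, sub_sub_eq_add_sub, eq_sub_iff_add_eq, add_comm, add_left_inj] at h5
  exact h5

/-- A morphism whose linear component is bijective is invertible. -/
theorem exists_blockComp_inverse {φ : List V → W} (hφ : ListMultilinear k φ) (hφ₀ : φ [] = 0)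
    (e : V ≃ₗ[k] W) (he : ∀ a, φ [a] = e a) : ∃ ψ : List W → V, ListMultilinear k ψ ∧
      (∀ l, blockComp φ ψ l = onSingle id l) ∧ (∀ l, blockComp ψ φ l = onSingle id l) ∧
      (∀ (s : V →ₗ[k] V) (r : W →ₗ[k] W), ListEquivariant s r (1 : k) φ →
        ListEquivariant r s (1 : k) ψ) ∧
      ∀ η θ, IsUnitalMap η θ φ → IsUnitalMap θ η ψ := by
  obtain ⟨ψ, hψ, h1, h2, h3⟩ := exists_blockComp_left_inverse hφ e he
  refine ⟨ψ, hψ, h1, ?_, h2, h3⟩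
  have hψe : ∀ w, ψ [w] = e.symm w := fun w => by
    have := h1 [e.symm w]
    rwa [blockComp_singleton, he, e.apply_symm_apply] at this
  -- The left inverse `ψ` has in turn a left inverse `χ`. Associativity identifies `χ` with `φ`, so
  -- `ψ` is two-sided.
  obtain ⟨χ, hχ, h4, -⟩ := exists_blockComp_left_inverse hψ e.symm hψe
  have h5 : ∀ l, χ l = φ l := by
    intro l
    have := blockComp_assoc φ ψ hχ l
    rw [funext h4, funext h1, onSingle_blockComp _ hχ, List.map_id] at this
    rw [← this]
    cases l with
    | nil => exact hφ₀.symm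
    | cons a l => exact blockComp_onSingle φ id (by simp)
  intro l
  rw [← h4, funext h5]

/-- The inverse of a morphism is a morphism. -/
theorem coderiv_eq_blockComp_of_inverse {s : V → V} {r : W →ₗ[k] W} {b : List V → V}
    {b' : List W → W} {φ : List V → W} {ψ : List W → V} (hψ : ListMultilinear k ψ)
    (hb₀ : b [] = 0) (hb' : ListMultilinear k b')
    (hφψ : ∀ l, blockComp φ ψ l = onSingle id l) (hψφ : ∀ l, blockComp ψ φ l = onSingle id l)
    (hφs : ∀ l, φ (l.map s) = r (φ l)) (h : ∀ l, coderiv s b φ l = blockComp φ b' l)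
    (l : List W) : coderiv r b' ψ l = blockComp ψ b l := by
  have h1 : blockComp φ (coderiv r b' ψ) = b := by
    funext x
    rw [← coderiv_blockComp hφs h hψ, funext hφψ]
    by_cases hx : x = []
    · rw [hx, hb₀, coderiv_nil]
    · exact coderiv_onSingle s b id hx
  have h2 : ListMultilinear k (coderiv r b' ψ) := ListMultilinear.coderiv r hb' hψ
  rw [← h1, blockComp_assoc ψ φ h2, funext hψφ, onSingle_blockComp _ h2, List.map_id]

end Inverse

/-! ### Shifted `A_∞`-structures on graded vector spaces

The shifted grading is encoded by an action of `kˣ`, where `u` acts on shifted degree `i` as `u ^ i`;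
in particular `-1` acts by the Koszul sign. -/

section Bar

section

variable {k : Type v} [Field k] {W : Type*} [AddCommGroup W] [Module k W]

theorem ListEquivariant.apply_one {U : Type*} {s : U → U} {t : W → W} {φ : List U → W}
    (h : ListEquivariant s t (1 : k) φ) (l : List U) : φ (l.map s) = t (φ l) :=
  ((h l).trans (one_smul k _)).symm

theorem ListEquivariant.apply_neg_one {U : Type*} {s : U → U} {t : W → W} {b : List U → W}
    (h : ListEquivariant s t ((-1 : kˣ) : k) b) (l : List U) : b (l.map s) = -t (b l) := by
  rw [h l]
  simp

end

variable {k : Type v} [Field k] {V W X : Type*} [AddCommGroup V] [Module k V]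
  [AddCommGroup W] [Module k W] [AddCommGroup X] [Module k X]

/-- The components of a codifferential of degree one. -/
structure IsBarOp (S : kˣ →* Module.End k V) (b : List V → V) : Prop where
  multilinear : ListMultilinear k b
  nil : b [] = 0
  equivariant : ∀ u : kˣ, ListEquivariant (S u) (S u) (u : k) b
  square : ∀ l, coderiv (S (-1)) b b l = 0

/-- The components of a morphism between codifferentials. -/
structure IsBarMap (S : kˣ →* Module.End k V) (T : kˣ →* Module.End k W) (b : List V → V)
    (b' : List W → W) (φ : List V → W) : Prop where
  multilinear : ListMultilinear k φ
  nil : φ [] = 0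
  equivariant : ∀ u : kˣ, ListEquivariant (S u) (T u) (1 : k) φ
  rel : ∀ l, coderiv (S (-1)) b φ l = blockComp φ b' l

variable {S : kˣ →* Module.End k V} {T : kˣ →* Module.End k W} {R : kˣ →* Module.End k X}

theorem neg_one_neg_one_apply (S : kˣ →* Module.End k V) (a : V) : S (-1) (S (-1) a) = a := by
  rw [← Module.End.mul_apply, ← map_mul]
  simp

theorem commute_apply (S : kˣ →* Module.End k V) (u u' : kˣ) (a : V) :
    S u (S u' a) = S u' (S u a) := by
  rw [← Module.End.mul_apply, ← Module.End.mul_apply, ← map_mul, ← map_mul, mul_comm]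

theorem IsBarOp.apply_neg_one {b : List V → V} (hb : IsBarOp S b) (l : List V) :
    b (l.map (S (-1))) = -S (-1) (b l) :=
  (hb.equivariant (-1)).apply_neg_one l

namespace IsBarMap

variable {b : List V → V} {b' : List W → W} {b'' : List X → X} {φ : List V → W} {ψ : List W → X}

theorem comp (hφ : IsBarMap S T b b' φ) (hψ : IsBarMap T R b' b'' ψ) (hb : ListMultilinear k b'') :
    IsBarMap S R b b'' (blockComp φ ψ) where
  multilinear := hφ.multilinear.blockComp hψ.multilinear
  nil := hψ.nil
  equivariant u := (hφ.equivariant u).blockComp (hψ.equivariant u)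
  rel l := by
    rw [coderiv_blockComp (hφ.equivariant (-1)).apply_one hφ.rel hψ.multilinear, funext hψ.rel,
      blockComp_assoc φ ψ hb]

theorem exists_inverse (hφ : IsBarMap S T b b' φ) (hb : b [] = 0) (hb' : ListMultilinear k b')
    (e : V ≃ₗ[k] W) (he : ∀ a, φ [a] = e a) : ∃ ψ, IsBarMap T S b' b ψ ∧
      (∀ a, ψ [a] = e.symm a) ∧ ∀ η θ, IsUnitalMap η θ φ → IsUnitalMap θ η ψ := by
  obtain ⟨ψ, h1, h2, h3, h4, h5⟩ := exists_blockComp_inverse hφ.multilinear hφ.nil e he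
  refine ⟨ψ, ⟨h1, ?_, fun u => h4 _ _ (hφ.equivariant u), ?_⟩, fun a => ?_, h5⟩
  · simpa using h2 []
  · exact coderiv_eq_blockComp_of_inverse h1 hb hb' h2 h3
      (hφ.equivariant (-1)).apply_one hφ.rel
  · have := h2 [e.symm a]
    rwa [blockComp_singleton, he, e.apply_symm_apply] at this

end IsBarMap

end Bar

/-! ### Contractions of a complex onto its cohomology -/

/-- A contraction of the complex `(V, d)` onto `H`, homogeneous and compatible with the units. -/
structure UnitalContraction {k : Type v} [Field k] {V : Type u} [AddCommGroup V] [Module k V]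
    {H : Type w} [AddCommGroup H] [Module k H] (S : kˣ →* Module.End k V)
    (T : kˣ →* Module.End k H) (d : V →ₗ[k] V) (η : V) (θ : H) where
  i : H →ₗ[k] V
  p : V →ₗ[k] H
  h : V →ₗ[k] V
  d_i : ∀ x, d (i x) = 0
  p_d : ∀ a, p (d a) = 0
  p_i : ∀ x, p (i x) = x
  p_h : ∀ a, p (h a) = 0
  h_i : ∀ x, h (i x) = 0
  homotopy : ∀ a, d (h a) + h (d a) = a - i (p a)
  i_unit : i θ = η
  S_i : ∀ u x, S u (i x) = i (T u x)
  T_p : ∀ u a, T u (p a) = p (S u a)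
  S_h : ∀ u a, S u (h a) = (u : k)⁻¹ • h (S u a)
  S_d : ∀ u a, S u (d a) = (u : k) • d (S u a)
  S_unit : S (-1) η = -η

namespace UnitalContraction

variable {k : Type v} [Field k] {V : Type u} [AddCommGroup V] [Module k V]
  {H : Type w} [AddCommGroup H] [Module k H] {S : kˣ →* Module.End k V}
  {T : kˣ →* Module.End k H} {d : V →ₗ[k] V} {η : V} {θ : H}
  (C : UnitalContraction S T d η θ)

theorem p_unit : C.p η = θ := (congrArg C.p C.i_unit).symm.trans (C.p_i θ)

theorem h_unit : C.h η = 0 := (congrArg C.h C.i_unit).symm.trans (C.h_i θ)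

theorem T_unit (C : UnitalContraction S T d η θ) : T (-1) θ = -θ := by
  have h := C.T_p (-1) η
  rwa [C.S_unit, map_neg, C.p_unit] at h

/-- The homotopy on functions on lists. -/
def listHomotopy (f : List V → H) : List V → H :=
  coderiv (S (-1) ∘ₗ C.i ∘ₗ C.p) (onSingle C.h) f

theorem listHomotopy_multilinear {f : List V → H} (hf : ListMultilinear k f) :
    ListMultilinear k (C.listHomotopy f) :=
  ListMultilinear.coderiv (S (-1) ∘ₗ C.i ∘ₗ C.p) (ListMultilinear.onSingle C.h) hf

theorem listHomotopy_equivariant {f : List V → H} (hf : ListMultilinear k f) (u : kˣ)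
    (hu : ListEquivariant (S u) (T u) (u : k) f) :
    ListEquivariant (S u) (T u) (1 : k) (C.listHomotopy f) := by
  have h1 : ListEquivariant (S u) (S u) ((u : k)⁻¹) (onSingle C.h) :=
    ListEquivariant.onSingle (C.S_h u)
  have := ListEquivariant.coderiv (s' := S (-1) ∘ₗ C.i ∘ₗ C.p) (fun x => by
    simp only [LinearMap.comp_apply]
    rw [commute_apply, C.S_i, C.T_p]) h1 hf hu
  rwa [mul_inv_cancel₀ u.ne_zero] at this

theorem coderiv_listHomotopy {f : List V → H} (hf : ListMultilinear k f) (l : List V) :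
    coderiv (S (-1)) (onSingle d) (C.listHomotopy f) l +
      C.listHomotopy (coderiv (S (-1)) (onSingle d) f) l = f l - f ((l.map C.p).map C.i) := by
  have := coderiv_onSingle_homotopy (s := S (-1)) (d := d) (h := C.h) (π := C.i ∘ₗ C.p)
    (neg_one_neg_one_apply S) (fun a => by rw [C.S_d]; simp) (fun a => by
      rw [C.S_h, Units.val_neg, Units.val_one, inv_neg, inv_one, neg_one_smul, neg_neg])
    (fun a => by simp [C.S_i, C.T_p]) (fun a => C.d_i _) (fun a => by simp [C.p_d])
    C.homotopy hf l
  simpa [listHomotopy] using this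

theorem listHomotopy_comp_map {f : List H → H} (hf : ListMultilinear k f) (l : List V) :
    C.listHomotopy (fun x => f (x.map C.p)) l = 0 :=
  coderiv_onSingle_comp_map _ C.p_h hf l

theorem listHomotopy_cons {f : List V → H} (hf : ListMultilinear k f) (a : V) (l : List V) :
    C.listHomotopy f (a :: l) =
      C.listHomotopy (fun x => f (S (-1) (C.i (C.p a)) :: x)) l + f (C.h a :: l) :=
  coderiv_onSingle_cons _ _ hf a l

/-- The homotopy annihilates lists containing the unit if `f` factors through `p` on those. -/
theorem listHomotopy_eq_zero {f : List V → H} (hf : ListMultilinear k f) {g : List H → H}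
    (hg : ListMultilinear k g) (h : ∀ l, η ∈ l → f l = g (l.map C.p)) {l : List V} (hl : η ∈ l) :
    C.listHomotopy f l = 0 := by
  induction l generalizing f g with
  | nil => simp at hl
  | cons a l ih =>
    rw [C.listHomotopy_cons hf]
    by_cases ha : a = η
    · subst ha
      -- Once the unit has been passed, the remaining function factors through `p` on all lists, and
      -- every later term contains `p ∘ h = 0`.
      have h1 : (fun x => f (S (-1) (C.i (C.p a)) :: x)) = fun x => -g (θ :: x.map C.p) := by
        funext x
        rw [C.p_unit, C.i_unit, C.S_unit, hf.cons_neg, h _ List.mem_cons_self, List.map_cons,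
          C.p_unit]
      rw [h1, C.h_unit, hf.cons_zero, add_zero]
      exact C.listHomotopy_comp_map (hg.cons θ).neg l
    · have hl' : η ∈ l := (List.mem_cons.1 hl).resolve_left fun h => ha h.symm
      rw [ih (hf.cons _) (hg.cons (C.p (S (-1) (C.i (C.p a))))) (fun x hx => by
          rw [h _ (List.mem_cons_of_mem _ hx), List.map_cons]) hl',
        h _ (List.mem_cons_of_mem _ hl'), List.map_cons, C.p_h, hg.cons_zero, add_zero]

end UnitalContraction

namespace UnitalContraction

variable {k : Type v} [Field k] {V : Type u} [AddCommGroup V] [Module k V]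
  {H : Type w} [AddCommGroup H] [Module k H] {S : kˣ →* Module.End k V}
  {T : kˣ →* Module.End k H} {d : V →ₗ[k] V} {η : V} {θ : H}
  (C : UnitalContraction S T d η θ)

theorem map_p_map_i (l : List H) : (l.map C.i).map C.p = l := by
  simp [Function.comp_def, C.p_i]

/-! ### The projection onto the minimal model

The operations on `H` and the projection are both expressed by one function `K : List V → H`. -/

/-- The operations on `H` determined by `K`. -/
def projOp (K : List V → H) : List H → H := dropSingle fun x => -K (x.map C.i)

/-- The components of the projection determined by `K`. -/
def projMap (K : List V → H) : List V → H := fun l =>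
  onSingle C.p l + dropSingle (C.listHomotopy K) l

/-- The operator whose fixed point yields the projection. -/
def projStep (b : List V → V) (K : List V → H) : List V → H := fun l =>
  blockComp (C.projMap K) (C.projOp K) l - C.projOp K (l.map C.p) -
    coderiv (S (-1)) (dropSingle b) (C.projMap K) l

/-- The properties of `K` that are preserved by `projStep`. -/
structure ProjInvariant (K : List V → H) : Prop where
  multilinear : ListMultilinear k K
  equivariant : ∀ u : kˣ, ListEquivariant (S u) (T u) (u : k) K
  left : ∀ a, K [η, a] = -C.p a
  right : ∀ a, K [a, η] = C.p (S (-1) a)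
  vanish : ∀ l, η ∈ l → l.length ≠ 2 → K l = 0

variable {C} {K : List V → H} {b : List V → V}

namespace ProjInvariant

variable (hK : C.ProjInvariant K)
include hK

theorem projOp_multilinear : ListMultilinear k (C.projOp K) :=
  (hK.multilinear.map C.i).neg.dropSingle

theorem projMap_multilinear : ListMultilinear k (C.projMap K) :=
  (ListMultilinear.onSingle C.p).add (C.listHomotopy_multilinear hK.multilinear).dropSingle

theorem projOp_equivariant (u : kˣ) : ListEquivariant (T u) (T u) (u : k) (C.projOp K) :=
  ((hK.equivariant u).map (C.S_i u)).neg.dropSingle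

theorem projMap_equivariant (u : kˣ) : ListEquivariant (S u) (T u) (1 : k) (C.projMap K) :=
  (ListEquivariant.onSingle fun a => by rw [C.T_p, one_smul]).add
    (C.listHomotopy_equivariant hK.multilinear u (hK.equivariant u)).dropSingle

theorem projOp_unital : IsUnitalOp (T (-1)) θ (C.projOp K) where
  left x := by simp [projOp, C.i_unit, hK.left, C.p_i]
  right x := by simp [projOp, C.i_unit, hK.right, C.p_i, C.S_i]
  vanish l hl h := by
    have hl' : η ∈ l.map C.i := List.mem_map.2 ⟨θ, hl, C.i_unit⟩
    simp [projOp, dropSingle, hK.vanish _ hl' (by simpa using h)]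

/-- On lists containing the unit `K` factors through `p`. The list homotopy vanishes on such lists,
which gives strict unitality of the projection. -/
theorem eq_neg_projOp {l : List V} (hl : η ∈ l) (hl' : 2 ≤ l.length) :
    K l = -C.projOp K (l.map C.p) := by
  have hθ : θ ∈ l.map C.p := List.mem_map.2 ⟨η, hl, C.p_unit⟩
  by_cases h2 : l.length = 2
  · obtain ⟨a, c, rfl⟩ := List.length_eq_two.1 h2
    rcases List.mem_pair.1 hl with rfl | rfl
    · simp [hK.left, C.p_unit, hK.projOp_unital.left]
    · simp [hK.right, C.p_unit, hK.projOp_unital.right, C.T_p]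
  · rw [hK.vanish l hl h2, hK.projOp_unital.vanish _ hθ (by simpa using h2), neg_zero]

theorem projMap_unital : IsUnitalMap η θ (C.projMap K) where
  map_unit := by simp [projMap, C.p_unit]
  vanish l hl h := by
    have h2 : 2 ≤ l.length := by
      have := List.length_pos_of_mem hl
      omega
    have h3 : C.listHomotopy K l = 0 := by
      refine C.listHomotopy_eq_zero hK.multilinear hK.projOp_multilinear.neg (fun x hx => ?_) hl
      by_cases hx' : 2 ≤ x.length
      · exact hK.eq_neg_projOp hx hx'
      · rw [hK.vanish x hx (by omega), projOp, dropSingle, if_neg (by simpa using hx'), neg_zero]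
    simp [projMap, onSingle_of_length_ne _ h, dropSingle, h3]

/-- On lists of length at least two containing `η`, the two sides of the morphism equation agree by
`IsUnitalMap.blockComp_eq_coderiv`. Then `projStep` returns `-C.projOp K (l.map C.p)`, which is the
old value of `K`. -/
theorem step (hb : ListMultilinear k b) (hbe : ∀ u : kˣ, ListEquivariant (S u) (S u) (u : k) b)
    (hbu : IsUnitalOp (S (-1)) η b) : C.ProjInvariant (C.projStep b K) := by
  have hmem : ∀ l, η ∈ l → 2 ≤ l.length → C.projStep b K l = -C.projOp K (l.map C.p) := by
    intro l hl hl'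
    rw [projStep, hK.projMap_unital.blockComp_eq_coderiv hK.projMap_multilinear
      (hK.projMap_equivariant (-1)).apply_one C.S_unit hbu.dropSingle hK.projOp_unital
      hK.projOp_multilinear hl hl']
    abel
  refine ⟨?_, fun u => ?_, fun a => ?_, fun a => ?_, fun l hl h => ?_⟩
  · exact ((hK.projMap_multilinear.blockComp hK.projOp_multilinear).sub
      (hK.projOp_multilinear.map C.p)).sub
        (ListMultilinear.coderiv (S (-1)) hb.dropSingle hK.projMap_multilinear)
  · refine (((hK.projMap_equivariant u).blockComp (hK.projOp_equivariant u)).sub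
      ((hK.projOp_equivariant u).map (C.T_p u))).sub ?_
    have := ListEquivariant.coderiv (commute_apply S u (-1)) (hbe u).dropSingle
      hK.projMap_multilinear (hK.projMap_equivariant u)
    rwa [one_mul] at this
  · rw [hmem _ (by simp) (by simp), ← hK.eq_neg_projOp (by simp) (by simp), hK.left]
  · rw [hmem _ (by simp) (by simp), ← hK.eq_neg_projOp (by simp) (by simp), hK.right]
  · by_cases h2 : 2 ≤ l.length
    · rw [hmem l hl h2, ← hK.eq_neg_projOp hl h2, hK.vanish l hl h]
    · obtain ⟨c, rfl⟩ : ∃ c, l = [c] := List.length_eq_one_iff.1 (by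
        have := List.length_pos_of_mem hl
        omega)
      simp [projStep, coderiv_cons, projOp, hK.projMap_multilinear.cons_zero]

end ProjInvariant

/-- Locality of `projStep` has three sources. The operation on the full list occurs only with all
blocks of length one, and this term is subtracted. The projection on the full list would be fed to
the unary operation, which is zero. The coderivation of `dropSingle b` shortens lists. -/
theorem exists_projInvariant_fixedPoint (C : UnitalContraction S T d η θ)
    (hb : ListMultilinear k b) (hbe : ∀ u : kˣ, ListEquivariant (S u) (S u) (u : k) b)
    (hbu : IsUnitalOp (S (-1)) η b) : ∃ K, C.ProjInvariant K ∧ ∀ l, K l = C.projStep b K l := by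
  -- The iteration starts from the binary part of `-C.p ∘ b`, which already has the prescribed
  -- values on pairs containing the unit.
  refine exists_fixedPoint_of_local
    (f₀ := fun l => if l.length = 2 then -C.p (b l) else 0) ?_
    (fun K hK => hK.step hb hbe hbu) ?_ ?_
  · refine ⟨(hb.postcomp C.p).neg.ite_length ListMultilinear.zero (· = 2), fun u => ?_, fun a => ?_,
      fun a => ?_, fun l _ hl => if_neg hl⟩
    · refine ListEquivariant.ite_length (ListEquivariant.neg ?_) ListEquivariant.zero (· = 2)
      have := (hbe u).postcomp (Λ := C.p) (t' := T u) (c' := 1) fun x => by rw [C.T_p, one_smul]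
      rwa [one_mul] at this
    · simp [hbu.left]
    · simp [hbu.right]
  · intro f hf
    refine ⟨ListMultilinear.of_length fun n => ?_, fun u => ListEquivariant.of_length fun n => ?_,
      fun a => ?_, fun a => ?_, fun l hl h => ?_⟩
    · obtain ⟨g, hg, hfg⟩ := hf n
      exact ⟨g, hg.multilinear, hfg⟩
    · obtain ⟨g, hg, hfg⟩ := hf n
      exact ⟨g, hg.equivariant u, hfg⟩
    · obtain ⟨g, hg, hfg⟩ := hf 2
      rw [hfg _ (by simp), hg.left]
    · obtain ⟨g, hg, hfg⟩ := hf 2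
      rw [hfg _ (by simp), hg.right]
    · obtain ⟨g, hg, hfg⟩ := hf l.length
      rw [hfg l le_rfl, hg.vanish l hl h]
  · intro f g hf hg l h
    have h1 : ∀ x : List V, x.length < l.length → C.projMap f x = C.projMap g x := by
      intro x hx
      simp only [projMap, dropSingle]
      congr 2
      exact coderiv_congr _ _ fun y _ hy => h y (by omega)
    have h2 : ∀ x : List H, x.length < l.length → C.projOp f x = C.projOp g x := by
      intro x hx
      simp only [projOp, dropSingle]
      rw [h _ (by simpa using hx)]
    have h3 := blockComp_eq_of_vanish (C.projMap g) (f := fun x => C.projOp f x - C.projOp g x)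
      (l := l) fun x hx => sub_eq_zero.2 (h2 x hx)
    have h4 : (fun a => C.projMap g [a]) = C.p := by
      funext a
      simp [projMap]
    rw [blockComp_sub, h4] at h3
    simp only [projStep]
    rw [blockComp_congr_components_of_singleton (f := C.projOp f) (fun x => by simp [projOp])
        fun x _ hx => h1 x hx,
      coderiv_congr_of_singleton (by simp) hf.projMap_multilinear hg.projMap_multilinear h1,
      sub_left_inj, sub_eq_sub_iff_sub_eq_sub, h3]

/-- The minimal model of a unital structure together with the projection onto it. -/
theorem exists_projection (C : UnitalContraction S T d η θ) (hb : IsBarOp S b)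
    (hbd : ∀ a, b [a] = d a) (hbu : IsUnitalOp (S (-1)) η b) :
    ∃ (b' : List H → H) (φ : List V → H), IsBarOp T b' ∧ (∀ x, b' [x] = 0) ∧
      IsUnitalOp (T (-1)) θ b' ∧ IsBarMap S T b b' φ ∧ (∀ a, φ [a] = C.p a) ∧
      IsUnitalMap η θ φ := by
  obtain ⟨K, hK, hfix⟩ := C.exists_projInvariant_fixedPoint hb.multilinear hb.equivariant hbu
  set b' := C.projOp K with hb'_def
  set φ := C.projMap K with hφ_def
  have hb'1 : ∀ x, b' [x] = 0 := fun x => by simp [b', projOp]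
  have hb'0 : b' [] = 0 := rfl
  have hφ1 : ∀ a, φ [a] = C.p a := fun a => by simp [φ, projMap]
  have hφ0 : φ [] = 0 := by simp [φ, projMap]
  have hφl : ListMultilinear k φ := hK.projMap_multilinear
  have hb'l : ListMultilinear k b' := hK.projOp_multilinear
  have hφs : ∀ l, φ (l.map (S (-1))) = T (-1) (φ l) := (hK.projMap_equivariant (-1)).apply_one
  have hfix' : ∀ l, K l = blockComp φ b' l - b' (l.map C.p) -
      coderiv (S (-1)) (dropSingle b) φ l := hfix
  have hK0 : K [] = 0 := by
    rw [hfix]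
    simp [projStep, projOp]
  have hK1 : ∀ a, K [a] = 0 := fun a => by
    rw [hfix]
    simp [projStep, projOp, coderiv_cons, hK.projMap_multilinear.cons_zero]
  -- Since `K` vanishes on lists of length at most one, the truncations in `projMap` and `projOp`
  -- discard nothing.
  have hφN : ∀ l, φ l = onSingle C.p l + C.listHomotopy K l := by
    intro l
    match l with
    | [] => simp [φ, projMap, listHomotopy]
    | [a] =>
      have : C.listHomotopy K [a] = 0 := by
        rw [C.listHomotopy_cons hK.multilinear, hK1, add_zero]
        rfl
      simp [φ, projMap, this]
    | a :: c :: l => simp [φ, projMap]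
  have hb'K : ∀ x : List H, b' x = -K (x.map C.i) := by
    intro x
    match x with
    | [] => simp [b', projOp, hK0]
    | [a] => simp [b', projOp, hK1]
    | a :: c :: l => simp [b', projOp]
  have hbsplit : b = fun l => onSingle d l + dropSingle b l := by
    conv_lhs => rw [← onSingle_add_dropSingle hb.nil]
    simp only [hbd]
  have hcod : ∀ {f : List V → H}, ListMultilinear k f → ∀ l, coderiv (S (-1)) b f l =
      coderiv (S (-1)) (onSingle d) f l + coderiv (S (-1)) (dropSingle b) f l := by
    intro f hf l
    conv_lhs => rw [hbsplit]
    exact coderiv_add_components _ _ _ hf l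
  have hdd : ∀ a, d (d a) = 0 := fun a => by
    have := hb.square [a]
    simpa [coderiv_cons, hbd] using this
  set e : List V → H := fun l => blockComp φ b' l - coderiv (S (-1)) b φ l with he_def
  have hel : ListMultilinear k e :=
    (hφl.blockComp hb'l).sub (ListMultilinear.coderiv (S (-1)) hb.multilinear hφl)
  set J := coderiv (T (-1)) b' b' with hJ_def
  have hJl : ListMultilinear k J := ListMultilinear.coderiv (T (-1)) hb'l hb'l
  -- `K` in terms of the defect `e`
  have hKe : K = fun l => e l - b' (l.map C.p) + coderiv (S (-1)) (onSingle d) φ l := by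
    funext l
    rw [hfix']
    simp only [he_def, hcod hφl]
    abel
  -- Write `D` for the coderivation of `d`. The other two terms of `K` are annihilated: `D` of `b' ∘
  -- p` vanishes as `p d = 0`, and `D` squares to zero.
  have hKd : ∀ l, coderiv (S (-1)) (onSingle d) K l = coderiv (S (-1)) (onSingle d) e l := by
    intro l
    conv_lhs => rw [hKe]
    rw [coderiv_add, coderiv_sub, coderiv_onSingle_comp_map _ C.p_d hb'l,
      coderiv_coderiv _ _ (neg_one_neg_one_apply S) _ _ hφl]
    · have : coderiv (S (-1)) (onSingle d) (onSingle d) = fun _ => 0 := by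
        funext x
        by_cases hx : x = []
        · simp [hx]
        · rw [coderiv_onSingle _ _ _ hx]
          match x with
          | [] => simp
          | [a] => exact hdd a
          | a :: c :: x => simp
      rw [this, coderiv_zero_components _ hφl]
      abel
    · exact (ListEquivariant.onSingle fun a => C.S_d (-1) a).apply_neg_one
  -- With `N` the list homotopy, `φ = p + N K` and `b' = -K ∘ i` turn the formula for `K` into `e =
  -- K - K ∘ (i p) - D (N K)`. By the tensor trick this is `N (D K)`, that is `N (D e)`.
  have heN : ∀ l, e l = C.listHomotopy (coderiv (S (-1)) (onSingle d) e) l := by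
    intro l
    have h1 := C.coderiv_listHomotopy hK.multilinear l
    have h2 : coderiv (S (-1)) (onSingle d) φ l =
        coderiv (S (-1)) (onSingle d) (C.listHomotopy K) l := by
      rw [funext hφN, coderiv_add]
      by_cases hl : l = []
      · simp [hl]
      · rw [coderiv_onSingle _ _ _ hl]
        match l with
        | [] => simp
        | [a] => simp [C.p_d]
        | a :: c :: l => simp
    have h3 : K l = e l - -K ((l.map C.p).map C.i) +
        coderiv (S (-1)) (onSingle d) (C.listHomotopy K) l := by
      rw [← hb'K, ← h2]
      exact congrFun hKe l
    have h4 : e l = K l - K ((l.map C.p).map C.i) -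
        coderiv (S (-1)) (onSingle d) (C.listHomotopy K) l := by
      rw [h3]
      abel
    rw [h4, ← h1, ← funext hKd]
    abel
  have main : ∀ n, (∀ l : List V, l.length < n → e l = 0) ∧
      ∀ x : List H, x.length < n → J x = 0 := by
    intro n
    induction n with
    | zero => simp
    | succ n ih =>
      -- On lists of length `n`, the higher part of `b` contributes nothing to the coderivation of
      -- `e`, as it only sees shorter lists. So `D e` is the full coderivation of `e`, and as `b`
      -- squares to zero this is the coderivation of `blockComp φ b'`. By `blockComp_coderiv_sub`
      -- and `b' [x] = 0` it equals `blockComp φ J`, where only the linear part `p` of `φ` matters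
      -- because `J` vanishes on shorter lists.
      have hed : ∀ l : List V, l.length ≤ n →
          coderiv (S (-1)) (onSingle d) e l = J (l.map C.p) := by
        intro l hl
        rcases hl.lt_or_eq with hl | hl
        · rw [ih.2 _ (by simpa using hl), coderiv_congr (f' := fun _ => 0), coderiv_zero]
          exact fun x _ hx => ih.1 x (by omega)
        · by_cases hl0 : l = []
          · simp [hl0, hJ_def]
          have h1 := hcod hel l
          rw [coderiv_congr_of_singleton (b := dropSingle b) (by simp) hel ListMultilinear.zero
            (fun x hx => ih.1 x (by omega)), coderiv_zero, add_zero] at h1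
          have h2 := blockComp_coderiv_sub (b' := b') (b := b)
            hφs hl0
            (fun x hx => (sub_eq_zero.1 (ih.1 x (by omega))).symm) hb'l
          rw [hb'1, blockComp_eq_of_vanish (f := J) φ (fun x hx => ih.2 x (by omega)),
            sub_eq_zero] at h2
          have h3 : coderiv (S (-1)) b (coderiv (S (-1)) b φ) l = 0 := by
            rw [coderiv_coderiv _ _ (neg_one_neg_one_apply S) hb.apply_neg_one _ hφl,
              funext hb.square, coderiv_zero_components _ hφl]
          rw [← h1, he_def, coderiv_sub, h3, sub_zero, ← h2, funext hφ1]
      -- Now `e` is the list homotopy applied to `J ∘ p`, which is zero because `p h = 0`.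
      have he0 : ∀ l : List V, l.length ≤ n → e l = 0 := by
        intro l hl
        rw [heN, ← C.listHomotopy_comp_map hJl l]
        exact coderiv_congr _ _ fun x _ hx => hed x (by omega)
      refine ⟨fun l hl => he0 l (by omega), fun x hx => ?_⟩
      -- Every list in `H` is the image under `p` of its image under `i`, so the vanishing of `e`
      -- forces that of `J`.
      have h1 := hed (x.map C.i) (by simp; omega)
      rw [C.map_p_map_i] at h1
      rw [← h1, coderiv_congr (f' := fun _ => 0), coderiv_zero]
      intro y _ hy
      exact he0 y (by simp at hy; omega)
  refine ⟨b', φ, ⟨hb'l, hb'0, hK.projOp_equivariant, fun x => (main _).2 x x.length.lt_succ_self⟩,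
    hb'1, hK.projOp_unital, ⟨hφl, hφ0, hK.projMap_equivariant, fun l => ?_⟩, hφ1,
    hK.projMap_unital⟩
  exact (sub_eq_zero.1 ((main _).1 l l.length.lt_succ_self)).symm

end UnitalContraction

namespace UnitalContraction

variable {k : Type v} [Field k] {V : Type u} [AddCommGroup V] [Module k V]
  {H : Type w} [AddCommGroup H] [Module k H] {S : kˣ →* Module.End k V}
  {T : kˣ →* Module.End k H} {d : V →ₗ[k] V} {η : V} {θ : H}
  (C : UnitalContraction S T d η θ)

/-! ### The inclusion of the minimal model

The operations on `H` and the inclusion are both expressed by one function `K : List H → V`. -/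

/-- The operations on `H` determined by `K`. -/
def inclOp (K : List H → V) : List H → H := dropSingle fun x => C.p (K x)

/-- The components of the inclusion determined by `K`. -/
def inclMap (K : List H → V) : List H → V := fun x =>
  onSingle C.i x - dropSingle (fun x => C.h (K x)) x

/-- The operator whose fixed point yields the inclusion. -/
def inclStep (b : List V → V) (K : List H → V) : List H → V := fun x =>
  blockComp (C.inclMap K) (dropSingle b) x -
    (coderiv (T (-1)) (C.inclOp K) (C.inclMap K) x - C.i (C.inclOp K x))

/-- The properties of `K` that are preserved by `inclStep`. -/
structure InclInvariant (K : List H → V) : Prop where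
  multilinear : ListMultilinear k K
  equivariant : ∀ u : kˣ, ListEquivariant (T u) (S u) (u : k) K
  left : ∀ x, K [θ, x] = C.i x
  right : ∀ x, K [x, θ] = -C.i (T (-1) x)
  vanish : ∀ l, θ ∈ l → l.length ≠ 2 → K l = 0

variable {C} {K : List H → V} {b : List V → V}

namespace InclInvariant

variable (hK : C.InclInvariant K)
include hK

theorem inclOp_multilinear : ListMultilinear k (C.inclOp K) :=
  (hK.multilinear.postcomp C.p).dropSingle

theorem inclMap_multilinear : ListMultilinear k (C.inclMap K) :=
  (ListMultilinear.onSingle C.i).sub (hK.multilinear.postcomp C.h).dropSingle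

theorem inclOp_equivariant (u : kˣ) : ListEquivariant (T u) (T u) (u : k) (C.inclOp K) := by
  have := (hK.equivariant u).postcomp (Λ := C.p) (t' := T u) (c' := 1) fun x => by
    rw [C.T_p, one_smul]
  rw [one_mul] at this
  exact this.dropSingle

theorem inclMap_equivariant (u : kˣ) : ListEquivariant (T u) (S u) (1 : k) (C.inclMap K) := by
  have := (hK.equivariant u).postcomp (Λ := C.h) (t' := S u) (C.S_h u)
  rw [inv_mul_cancel₀ u.ne_zero] at this
  exact (ListEquivariant.onSingle fun a => by rw [C.S_i, one_smul]).sub this.dropSingle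

theorem inclOp_unital : IsUnitalOp (T (-1)) θ (C.inclOp K) where
  left x := by simp [inclOp, hK.left, C.p_i]
  right x := by simp [inclOp, hK.right, C.p_i]
  vanish l hl h := by simp [inclOp, dropSingle, hK.vanish _ hl h]

/-- On lists containing the unit `K` takes values in the image of `i`, which `h` annihilates. This
makes the inclusion strictly unital. -/
theorem eq_i_inclOp {l : List H} (hl : θ ∈ l) (hl' : 2 ≤ l.length) :
    K l = C.i (C.inclOp K l) := by
  by_cases h2 : l.length = 2
  · obtain ⟨a, c, rfl⟩ := List.length_eq_two.1 h2
    rcases List.mem_pair.1 hl with rfl | rfl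
    · simp [hK.left, hK.inclOp_unital.left]
    · simp [hK.right, hK.inclOp_unital.right]
  · rw [hK.vanish l hl h2, hK.inclOp_unital.vanish _ hl h2, map_zero]

theorem inclMap_unital : IsUnitalMap θ η (C.inclMap K) where
  map_unit := by simp [inclMap, C.i_unit]
  vanish l hl h := by
    have h2 : 2 ≤ l.length := by
      have := List.length_pos_of_mem hl
      omega
    simp [inclMap, onSingle_of_length_ne _ h, dropSingle, hK.eq_i_inclOp hl h2, C.h_i]

/-- On lists of length at least two containing `θ`, the two sides of the morphism equation cancel.
The remaining `C.i (C.inclOp K l)` is the old value of `K`. -/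
theorem step (hb : ListMultilinear k b) (hbe : ∀ u : kˣ, ListEquivariant (S u) (S u) (u : k) b)
    (hbu : IsUnitalOp (S (-1)) η b) : C.InclInvariant (C.inclStep b K) := by
  have hmem : ∀ l, θ ∈ l → 2 ≤ l.length → C.inclStep b K l = K l := by
    intro l hl hl'
    rw [inclStep, hK.inclMap_unital.blockComp_eq_coderiv hK.inclMap_multilinear
      (hK.inclMap_equivariant (-1)).apply_one C.T_unit hK.inclOp_unital hbu.dropSingle
      hb.dropSingle hl hl', sub_sub_cancel, hK.eq_i_inclOp hl hl']
  refine ⟨?_, fun u => ?_, fun a => ?_, fun a => ?_, fun l hl h => ?_⟩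
  · exact (hK.inclMap_multilinear.blockComp hb.dropSingle).sub
      ((ListMultilinear.coderiv (T (-1)) hK.inclOp_multilinear hK.inclMap_multilinear).sub
        (hK.inclOp_multilinear.postcomp C.i))
  · have h1 := ListEquivariant.coderiv (commute_apply T u (-1)) (hK.inclOp_equivariant u)
      hK.inclMap_multilinear (hK.inclMap_equivariant u)
    have h2 := (hK.inclOp_equivariant u).postcomp (Λ := C.i) (t' := S u) (c' := 1) fun x => by
      rw [C.S_i, one_smul]
    rw [one_mul] at h1 h2
    exact ((hK.inclMap_equivariant u).blockComp (hbe u).dropSingle).sub (h1.sub h2)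
  · rw [hmem _ (by simp) (by simp), hK.left]
  · rw [hmem _ (by simp) (by simp), hK.right]
  · by_cases h2 : 2 ≤ l.length
    · rw [hmem l hl h2, hK.vanish l hl h]
    · obtain ⟨c, rfl⟩ : ∃ c, l = [c] := List.length_eq_one_iff.1 (by
        have := List.length_pos_of_mem hl
        omega)
      simp [inclStep, coderiv_cons, inclOp, hK.inclMap_multilinear.cons_zero]

end InclInvariant

theorem exists_inclInvariant_fixedPoint (C : UnitalContraction S T d η θ)
    (hb : ListMultilinear k b) (hbe : ∀ u : kˣ, ListEquivariant (S u) (S u) (u : k) b)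
    (hbu : IsUnitalOp (S (-1)) η b) : ∃ K, C.InclInvariant K ∧ ∀ l, K l = C.inclStep b K l := by
  refine exists_fixedPoint_of_local
    (f₀ := fun l => if l.length = 2 then b (l.map C.i) else 0) ?_
    (fun K hK => hK.step hb hbe hbu) ?_ ?_
  · refine ⟨(hb.map C.i).ite_length ListMultilinear.zero (· = 2), fun u => ?_, fun a => ?_,
      fun a => ?_, fun l _ hl => if_neg hl⟩
    · exact ((hbe u).map (C.S_i u)).ite_length ListEquivariant.zero (· = 2)
    · simp [C.i_unit, hbu.left]
    · simp [C.i_unit, hbu.right, C.S_i]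
  · intro f hf
    refine ⟨ListMultilinear.of_length fun n => ?_, fun u => ListEquivariant.of_length fun n => ?_,
      fun a => ?_, fun a => ?_, fun l hl h => ?_⟩
    · obtain ⟨g, hg, hfg⟩ := hf n
      exact ⟨g, hg.multilinear, hfg⟩
    · obtain ⟨g, hg, hfg⟩ := hf n
      exact ⟨g, hg.equivariant u, hfg⟩
    · obtain ⟨g, hg, hfg⟩ := hf 2
      rw [hfg _ (by simp), hg.left]
    · obtain ⟨g, hg, hfg⟩ := hf 2
      rw [hfg _ (by simp), hg.right]
    · obtain ⟨g, hg, hfg⟩ := hf l.length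
      rw [hfg l le_rfl, hg.vanish l hl h]
  · intro f g hf hg l h
    have h1 : ∀ x : List H, x.length < l.length → C.inclMap f x = C.inclMap g x := by
      intro x hx
      simp only [inclMap, dropSingle, h x hx]
    have h2 : ∀ x : List H, x.length < l.length → C.inclOp f x = C.inclOp g x := by
      intro x hx
      simp only [inclOp, dropSingle, h x hx]
    -- The operation on the full list enters the coderivation only as the single entry of `inclMap`,
    -- where it contributes `i` of itself; this is the term subtracted in `inclStep`.
    have h3 : coderiv (T (-1)) (C.inclOp f) (C.inclMap f) l - C.i (C.inclOp f l) =
        coderiv (T (-1)) (C.inclOp g) (C.inclMap g) l - C.i (C.inclOp g l) := by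
      by_cases hl : l = []
      · simp [hl, inclOp]
      have h4 := coderiv_eq_of_vanish (T (-1)) (b := fun x => C.inclOp f x + -C.inclOp g x)
        hg.inclMap_multilinear hl fun x hx => by rw [h2 x hx, add_neg_cancel]
      have h5 : coderiv (T (-1)) (fun x => -C.inclOp g x) (C.inclMap g) l =
          -coderiv (T (-1)) (C.inclOp g) (C.inclMap g) l := by
        have := coderiv_add_components (T (-1)) (C.inclOp g) (fun x => -C.inclOp g x)
          hg.inclMap_multilinear l
        simp only [add_neg_cancel, coderiv_zero_components _ hg.inclMap_multilinear] at this
        exact (neg_eq_of_add_eq_zero_right this.symm).symm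
      have h6 : ∀ x, C.inclMap g [x] = C.i x := fun x => by simp [inclMap]
      rw [coderiv_add_components _ _ _ hg.inclMap_multilinear, h5, h6, map_add, map_neg] at h4
      rw [coderiv_congr_of_singleton (by simp [inclOp]) hf.inclMap_multilinear
        hg.inclMap_multilinear h1, sub_eq_sub_iff_sub_eq_sub]
      simpa only [sub_eq_add_neg] using h4
    simp only [inclStep]
    rw [h3, blockComp_congr_components_of_singleton (by simp) fun x _ hx => h1 x hx]

/-- The minimal model of a unital structure together with its inclusion. -/
theorem exists_inclusion (C : UnitalContraction S T d η θ) (hb : IsBarOp S b)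
    (hbd : ∀ a, b [a] = d a) (hbu : IsUnitalOp (S (-1)) η b) :
    ∃ (b' : List H → H) (φ : List H → V), IsBarOp T b' ∧ (∀ x, b' [x] = 0) ∧
      IsBarMap T S b' b φ ∧ (∀ x, φ [x] = C.i x) ∧ IsUnitalMap θ η φ := by
  obtain ⟨K, hK, hfix⟩ := C.exists_inclInvariant_fixedPoint hb.multilinear hb.equivariant hbu
  set b' := C.inclOp K with hb'_def
  set φ := C.inclMap K with hφ_def
  have hb'1 : ∀ x, b' [x] = 0 := fun x => by simp [b', inclOp]
  have hb'0 : b' [] = 0 := rfl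
  have hφ1 : ∀ x, φ [x] = C.i x := fun x => by simp [φ, inclMap]
  have hφ0 : φ [] = 0 := by simp [φ, inclMap]
  have hφl : ListMultilinear k φ := hK.inclMap_multilinear
  have hb'l : ListMultilinear k b' := hK.inclOp_multilinear
  have hφs : ∀ l, φ (l.map (T (-1))) = S (-1) (φ l) := (hK.inclMap_equivariant (-1)).apply_one
  have hfix' : ∀ l, K l = blockComp φ (dropSingle b) l -
    (coderiv (T (-1)) b' φ l - C.i (b' l)) := hfix
  have hb's : ∀ l, b' (l.map (T (-1))) = -T (-1) (b' l) :=
    (hK.inclOp_equivariant (-1)).apply_neg_one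
  have hdd : ∀ a, d (d a) = 0 := fun a => by
    have := hb.square [a]
    simpa [coderiv_cons, hbd] using this
  set e : List H → V := fun l => blockComp φ b l - coderiv (T (-1)) b' φ l with he_def
  have hel : ListMultilinear k e :=
    (hφl.blockComp hb.multilinear).sub (ListMultilinear.coderiv (T (-1)) hb'l hφl)
  have he : ∀ l, l ≠ [] → e l = d (φ l) + K l - C.i (b' l) := by
    intro l hl
    have h1 : blockComp φ b l = d (φ l) + blockComp φ (dropSingle b) l := by
      conv_lhs => rw [← onSingle_add_dropSingle hb.nil]
      rw [blockComp_add, blockComp_onSingle _ _ hl, hbd]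
    rw [hfix']
    simp only [he_def, h1]
    abel
  -- For length at least two, `φ = -h K` and `b' = p K` give `e = K - d h K - i p K = h d K`, while
  -- `d e = d K`.
  have hhde : ∀ l, e l = C.h (d (e l)) := by
    intro l
    match l with
    | [] => simp [he_def, hb.nil]
    | [x] => simp [he_def, hφ1, hbd, C.d_i, coderiv_cons, hb'1]
    | x :: y :: l =>
      have h1 := C.homotopy (K (x :: y :: l))
      have h2 : e (x :: y :: l) = C.h (d (K (x :: y :: l))) := by
        rw [he _ (by simp)]
        simp only [φ, b', inclMap, inclOp, onSingle_cons_cons, dropSingle_cons_cons, zero_sub,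
          map_neg]
        rw [neg_add_eq_sub, sub_right_comm, ← h1, add_sub_cancel_left]
      have h3 : d (e (x :: y :: l)) = d (K (x :: y :: l)) := by
        rw [he _ (by simp), map_sub, map_add, hdd, C.d_i, zero_add, sub_zero]
      rw [h3, h2]
  set J := coderiv (T (-1)) b' b' with hJ_def
  have main : ∀ n, (∀ l : List H, l.length < n → e l = 0) ∧
      ∀ x : List H, x.length < n → J x = 0 := by
    intro n
    induction n with
    | zero => simp
    | succ n ih =>
      have key : ∀ l : List H, l.length = n → e l = 0 ∧ J l = 0 := by
        intro l hl
        by_cases hl0 : l = []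
        · simp [hl0, he_def, hJ_def, hb.nil]
        -- Since `b` squares to zero, this reduces to `-i (J l) = d (e l)` when both defects vanish
        -- on shorter lists. Applying `p` gives `J l = 0`; then `d (e l) = 0`, and `hhde` gives `e l
        -- = 0`.
        have h1 := blockComp_coderiv_sub (b' := b) (b := b') (s' := S (-1)) hφs hl0
            (fun x hx => (sub_eq_zero.1 (ih.1 x (by omega))).symm) hb.multilinear
        have h2 : coderiv (T (-1)) b' (blockComp φ b) l = C.i (J l) := by
          have h3 : blockComp φ b = fun l => e l + coderiv (T (-1)) b' φ l := by
            funext l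
            simp [he_def]
          rw [h3, coderiv_add, coderiv_congr_of_singleton hb'1 hel ListMultilinear.zero
            (fun x hx => ih.1 x (by omega)), coderiv_zero, zero_add,
            coderiv_coderiv _ _ (neg_one_neg_one_apply T) hb's _ hφl,
            coderiv_eq_of_vanish _ hφl hl0 fun x hx => ih.2 x (by omega), hφ1]
        rw [h2, funext hb.square, blockComp_zero, zero_sub, hbd] at h1
        have h4 : J l = 0 := by
          have := congrArg C.p h1
          change _ = C.p (d (e l)) at this
          rw [map_neg, C.p_i, C.p_d, neg_eq_zero] at this
          exact this
        rw [h4, map_zero, neg_zero] at h1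
        refine ⟨?_, h4⟩
        rw [hhde l]
        exact (congrArg C.h h1.symm).trans (map_zero _)
      refine ⟨fun l hl => ?_, fun l hl => ?_⟩
      · rcases (Nat.le_of_lt_succ hl).lt_or_eq with h | h
        · exact ih.1 l h
        · exact (key l h).1
      · rcases (Nat.le_of_lt_succ hl).lt_or_eq with h | h
        · exact ih.2 l h
        · exact (key l h).2
  refine ⟨b', φ, ⟨hb'l, hb'0, hK.inclOp_equivariant, fun x => (main _).2 x x.length.lt_succ_self⟩,
    hb'1, ⟨hφl, hφ0, hK.inclMap_equivariant, fun l => ?_⟩, hφ1, hK.inclMap_unital⟩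
  exact (sub_eq_zero.1 ((main _).1 l l.length.lt_succ_self)).symm

/-- A unital structure has a minimal model, with an inclusion and a projection whose linear
components are those of a given contraction. -/
theorem exists_minimalModel (C : UnitalContraction S T d η θ) (hb : IsBarOp S b)
    (hbd : ∀ a, b [a] = d a) (hbu : IsUnitalOp (S (-1)) η b) :
    ∃ (b' : List H → H) (φ : List V → H) (ψ : List H → V), IsBarOp T b' ∧ (∀ x, b' [x] = 0) ∧
      IsUnitalOp (T (-1)) θ b' ∧
      IsBarMap S T b b' φ ∧ (∀ a, φ [a] = C.p a) ∧ IsUnitalMap η θ φ ∧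
      IsBarMap T S b' b ψ ∧ (∀ x, ψ [x] = C.i x) ∧ IsUnitalMap θ η ψ := by
  obtain ⟨b', φ, h1, h2, h3, h4, h5, h6⟩ := C.exists_projection hb hbd hbu
  obtain ⟨b'', ψ, h7, h8, h9, h10, h11⟩ := C.exists_inclusion hb hbd hbu
  -- The structures `b'` and `b''` need not coincide. The composite from `b''` to `b'` has linear
  -- part `p i = id`; composing its inverse `χ` with `ψ` gives an inclusion of `b'`, with linear
  -- part still `i`.
  obtain ⟨χ, h12, h13, h14⟩ := (h9.comp h4 h1.multilinear).exists_inverse h7.nil h1.multilinear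
    (LinearEquiv.refl k H) fun x => by simp [h10, h5, C.p_i]
  refine ⟨b', φ, blockComp χ ψ, h1, h2, h3, h4, h5, h6, h12.comp h9 hb.multilinear, fun x => ?_,
    (h14 _ _ (h11.comp h6 h4.multilinear)).comp h11 h9.multilinear⟩
  simp [h13, h10]

end UnitalContraction

/-! ### The action of scalars encoding the shifted grading -/

section Grading

variable {k : Type v} [Field k] {V : Type u} [AddCommGroup V] [Module k V]
  {W : Type w} [AddCommGroup W] [Module k W] {𝒱 : ℤ → Submodule k V} {𝒲 : ℤ → Submodule k W}

theorem DirectSum.IsInternal.linearMap_ext (h𝒱 : DirectSum.IsInternal 𝒱) {f g : V →ₗ[k] W}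
    (h : ∀ i, ∀ a ∈ 𝒱 i, f a = g a) : f = g := by
  ext a
  have ha : a ∈ ⨆ i, 𝒱 i := by simp [h𝒱.submodule_iSup_eq_top]
  induction ha using Submodule.iSup_induction' with
  | mem i x hx => exact h i x hx
  | zero => simp
  | add x y _ _ hx hy => rw [map_add, map_add, hx, hy]

theorem ListMultilinear.ext_of_homogeneous (h𝒱 : DirectSum.IsInternal 𝒱) {f g : List V → W}
    (hf : ListMultilinear k f) (hg : ListMultilinear k g)
    (h : ∀ l ds, List.Forall₂ (fun a i => a ∈ 𝒱 i) l ds → f l = g l) (l : List V) : f l = g l := by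
  induction l generalizing f g with
  | nil => exact h [] [] .nil
  | cons a l ih =>
    refine LinearMap.congr_fun (h𝒱.linearMap_ext (f := hf.head l) (g := hg.head l) ?_) a
    exact fun i a ha => ih (hf.cons a) (hg.cons a) fun l ds hl => h _ _ (.cons ha hl)

/-- The scalar `u` acts on degree `i` as `u ^ (i - 1)`. -/
noncomputable def shiftActLin (h𝒱 : DirectSum.IsInternal 𝒱) (u : kˣ) : V →ₗ[k] V :=
  DirectSum.toModule k ℤ V (fun i => ((u ^ (i - 1) : kˣ) : k) • (𝒱 i).subtype) ∘ₗ
    (LinearEquiv.ofBijective (DirectSum.coeLinearMap 𝒱) h𝒱).symm.toLinearMap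

theorem shiftActLin_apply (h𝒱 : DirectSum.IsInternal 𝒱) (u : kˣ) {i : ℤ} {a : V} (ha : a ∈ 𝒱 i) :
    shiftActLin h𝒱 u a = ((u ^ (i - 1) : kˣ) : k) • a := by
  have h : (LinearEquiv.ofBijective (DirectSum.coeLinearMap 𝒱) h𝒱).symm a =
      DirectSum.lof k ℤ (fun i => 𝒱 i) i ⟨a, ha⟩ := by
    rw [LinearEquiv.symm_apply_eq]
    exact (DirectSum.coeLinearMap_lof 𝒱 i ⟨a, ha⟩).symm
  simp [shiftActLin, h]

/-- The action of scalars encoding the shifted grading. -/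
noncomputable def shiftAct (h𝒱 : DirectSum.IsInternal 𝒱) : kˣ →* Module.End k V where
  toFun := shiftActLin h𝒱
  map_one' := h𝒱.linearMap_ext fun i a ha => by simp [shiftActLin_apply h𝒱 _ ha]
  map_mul' u v := h𝒱.linearMap_ext fun i a ha => by
    rw [Module.End.mul_apply, shiftActLin_apply h𝒱 _ ha, shiftActLin_apply h𝒱 _ ha, map_smul,
      shiftActLin_apply h𝒱 _ ha, smul_smul, mul_zpow, Units.val_mul, mul_comm]

theorem shiftAct_apply (h𝒱 : DirectSum.IsInternal 𝒱) (u : kˣ) {i : ℤ} {a : V} (ha : a ∈ 𝒱 i) :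
    shiftAct h𝒱 u a = ((u ^ (i - 1) : kˣ) : k) • a :=
  shiftActLin_apply h𝒱 u ha

theorem negOnePow_smul_eq (i : ℤ) (x : V) : i.negOnePow • x = (((-1) ^ i : kˣ) : k) • x := by
  rcases i.even_or_odd with h | h
  · rw [Int.negOnePow_even i h, h.neg_one_zpow]
    simp
  · rw [Int.negOnePow_odd i h, h.neg_one_zpow]
    simp

theorem shiftAct_neg_one (h𝒱 : DirectSum.IsInternal 𝒱) {i : ℤ} {a : V} (ha : a ∈ 𝒱 i) :
    shiftAct h𝒱 (-1) a = (i - 1).negOnePow • a := by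
  rw [shiftAct_apply h𝒱 _ ha, negOnePow_smul_eq (k := k)]

/-- The scalar `2` detects degrees. -/
theorem mem_of_shiftAct_eq [CharZero k] (h𝒱 : DirectSum.IsInternal 𝒱) {i : ℤ} {a : V}
    (h : ∀ u : kˣ, shiftAct h𝒱 u a = ((u ^ (i - 1) : kˣ) : k) • a) : a ∈ 𝒱 i := by
  classical
  let := h𝒱.chooseDecomposition
  let π : ℤ → V →ₗ[k] V := fun j =>
    (𝒱 j).subtype ∘ₗ DirectSum.component k ℤ (fun j => 𝒱 j) j ∘ₗ
      (DirectSum.decomposeLinearEquiv 𝒱).toLinearMap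
  have hπ : ∀ j a, π j a = DirectSum.decompose 𝒱 a j := fun j a => rfl
  have h2 : ∀ j (u : kˣ), π j ∘ₗ shiftAct h𝒱 u = ((u ^ (j - 1) : kˣ) : k) • π j := fun j u => by
    refine h𝒱.linearMap_ext fun m x hx => ?_
    rw [LinearMap.comp_apply, shiftAct_apply h𝒱 u hx, map_smul, LinearMap.smul_apply, hπ]
    by_cases hm : m = j
    · rw [hm]
    · rw [DirectSum.decompose_of_mem_ne 𝒱 hx hm, smul_zero, smul_zero]
  have h3 : ∀ j, j ≠ i → π j a = 0 := by
    intro j hj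
    have h4 := LinearMap.congr_fun (h2 j (Units.mk0 2 two_ne_zero)) a
    rw [LinearMap.comp_apply, h, map_smul, LinearMap.smul_apply, ← sub_eq_zero, ← sub_smul,
      smul_eq_zero, sub_eq_zero] at h4
    refine h4.resolve_left fun h5 => hj ?_
    have h6 : ((2 : ℚ) : k) ^ (i - 1) = ((2 : ℚ) : k) ^ (j - 1) := by simpa using h5
    have h7 : (2 : ℚ) ^ (i - 1) = 2 ^ (j - 1) := by exact_mod_cast h6
    have := zpow_right_injective₀ (by norm_num) (by norm_num) h7
    omega
  rw [← DirectSum.sum_support_decompose 𝒱 a]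
  refine Submodule.sum_mem _ fun j _ => ?_
  by_cases hj : j = i
  · exact hj ▸ (DirectSum.decompose 𝒱 a j).2
  · rw [← hπ, h3 j hj]
    exact zero_mem _

theorem shiftAct_comm_of_degree (h𝒱 : DirectSum.IsInternal 𝒱) (h𝒲 : DirectSum.IsInternal 𝒲)
    {g : V →ₗ[k] W} {c : ℤ} (hg : ∀ i, ∀ a ∈ 𝒱 i, g a ∈ 𝒲 (i + c)) (u : kˣ) (a : V) :
    shiftAct h𝒲 u (g a) = ((u ^ c : kˣ) : k) • g (shiftAct h𝒱 u a) := by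
  refine LinearMap.congr_fun (h𝒱.linearMap_ext (f := shiftAct h𝒲 u ∘ₗ g)
    (g := ((u ^ c : kˣ) : k) • g ∘ₗ shiftAct h𝒱 u) fun i a ha => ?_) a
  rw [LinearMap.comp_apply, shiftAct_apply h𝒲 u (hg i a ha), LinearMap.smul_apply,
    LinearMap.comp_apply, shiftAct_apply h𝒱 u ha, map_smul, smul_smul, ← Units.val_mul,
    ← zpow_add]
  congr 3
  ring

end Grading

/-! ### Segments of sequences -/

section Segments

variable {V W X Y : Type*}

/-- The list `a_r, …, a_{r+n-1}`. -/
def seg (a : ℕ → V) (r n : ℕ) : List V := (List.range' r n).map a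

@[simp] theorem length_seg (a : ℕ → V) (r n : ℕ) : (seg a r n).length = n := by simp [seg]

@[simp] theorem seg_zero (a : ℕ → V) (r : ℕ) : seg a r 0 = [] := rfl

theorem seg_succ (a : ℕ → V) (r n : ℕ) : seg a r (n + 1) = a r :: seg a (r + 1) n := by
  simp [seg, List.range'_succ]

theorem seg_add (a : ℕ → V) (r m n : ℕ) : seg a r (m + n) = seg a r m ++ seg a (r + m) n := by
  rw [seg, seg, seg, ← List.map_append, List.range'_append_1]

theorem seg_congr {a b : ℕ → V} {r r' n : ℕ} (h : ∀ i < n, a (r + i) = b (r' + i)) :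
    seg a r n = seg b r' n := by
  induction n generalizing r r' with
  | zero => rfl
  | succ n ih =>
    rw [seg_succ, seg_succ, ih fun i hi => ?_]
    · rw [show a r = b r' from h 0 n.succ_pos]
    · rw [Nat.add_assoc, Nat.add_assoc, Nat.add_comm 1 i]
      exact h (i + 1) (by omega)

theorem seg_replaceBlock (a : ℕ → V) (r s t : ℕ) (hs : 1 ≤ s) (x : V) :
    seg (replaceBlock a r s x) 0 (r + (1 + t)) = seg a 0 r ++ x :: seg a (r + s) t := by
  rw [seg_add, Nat.add_comm 1 t, seg_succ]
  congr 1
  · exact seg_congr fun i hi => by simp [replaceBlock, hi]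
  · congr 1
    · simp [replaceBlock]
    · refine seg_congr fun i _ => ?_
      have h1 : ¬0 + r + 1 + i < r := by omega
      have h2 : ¬0 + r + 1 + i = r := by omega
      simp only [replaceBlock, h1, h2, if_false]
      congr 1
      omega

theorem forall₂_seg {P : V → W → Prop} {a : ℕ → V} {d : ℕ → W} (h : ∀ i, P (a i) (d i))
    (r n : ℕ) : List.Forall₂ P (seg a r n) (seg d r n) := by
  induction n generalizing r with
  | zero => exact .nil
  | succ n ih =>
    rw [seg_succ, seg_succ]
    exact .cons (h r) (ih _)

theorem sum_seg (d : ℕ → ℤ) (r n : ℕ) : (seg d r n).sum = ∑ j ∈ Finset.range n, d (r + j) := by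
  induction n generalizing r with
  | zero => rfl
  | succ n ih =>
    rw [seg_succ, List.sum_cons, ih, Finset.sum_range_succ', add_comm]
    congr 1
    exact Finset.sum_congr rfl fun i _ => by congr 1; omega

/-- The defining identities are stated for infinite sequences of homogeneous elements; a homogeneous
list is padded by the default entry `x₀` of degree `d₀`. -/
theorem exists_seg_eq {P : V → W → Prop} {l : List V} {ds : List W} (h : List.Forall₂ P l ds)
    {x₀ : V} {d₀ : W} (h₀ : P x₀ d₀) :
    ∃ (a : ℕ → V) (d : ℕ → W), (∀ i, P (a i) (d i)) ∧ seg a 0 l.length = l := by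
  refine ⟨fun i => l.getD i x₀, fun i => ds.getD i d₀, fun i => ?_,
    List.ext_getElem (by simp) fun i h1 h2 => ?_⟩
  · induction h generalizing i with
    | nil => simpa using h₀
    | cons h _ ih =>
      cases i with
      | zero => simpa using h
      | succ i => simpa using ih i
  · simp [seg, List.getD_eq_getElem?_getD, List.getElem?_eq_getElem h2]

variable [AddCommGroup X]

theorem deconcSum_seg (g : List V → List V → X) (a : ℕ → V) (r n : ℕ) :
    deconcSum g (seg a r n) =
      ∑ t ∈ Finset.range (n + 1), g (seg a r t) (seg a (r + t) (n - t)) := by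
  induction n generalizing r g with
  | zero => simp
  | succ n ih =>
    rw [seg_succ, deconcSum_cons, ih, Finset.sum_range_succ' _ (n + 1), add_comm]
    congr 1
    refine Finset.sum_congr rfl fun t _ => ?_
    rw [← seg_succ, Nat.add_sub_add_right, Nat.add_assoc, Nat.add_comm 1 t]

theorem coderiv_seg (σ : V → V) (b : List V → V) (f : List V → X) (a : ℕ → V) (m n : ℕ) :
    coderiv σ b f (seg a m n) = ∑ r ∈ Finset.range n, ∑ s ∈ Finset.Icc 1 (n - r),
      f ((seg a m r).map σ ++ b (seg a (m + r) s) :: seg a (m + r + s) (n - r - s)) := by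
  induction n generalizing m f with
  | zero => simp
  | succ n ih =>
    rw [seg_succ, coderiv_cons, ih, Finset.sum_range_succ', deconcSum_seg]
    congr 1
    · refine Finset.sum_congr rfl fun r _ => ?_
      rw [Nat.add_sub_add_right]
      refine Finset.sum_congr rfl fun s _ => ?_
      rw [seg_succ, List.map_cons, List.cons_append]
      rw [show m + (r + 1) = m + 1 + r by omega]
    · refine Finset.sum_nbij' (· + 1) (· - 1) ?_ ?_ ?_ ?_ ?_
      · intro t ht
        simp at ht ⊢
        omega
      · intro t ht
        simp at ht ⊢
        omega
      · intro t _
        rfl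
      · intro t ht
        simp at ht ⊢
        omega
      · intro t _
        rw [← seg_succ]
        simp only [seg_zero, List.map_nil, List.nil_append, Nat.add_zero]
        congr 2
        congr 1 <;> omega

theorem coderiv_seg' (σ : V → V) (b : List V → V) (f : List V → X) (a : ℕ → V) (n : ℕ) :
    coderiv σ b f (seg a 0 n) = ∑ s ∈ Finset.Icc 1 n, ∑ r ∈ Finset.range (n - s + 1),
      f ((seg a 0 r).map σ ++ b (seg a r s) :: seg a (r + s) (n - r - s)) := by
  rw [coderiv_seg]
  simp only [Nat.zero_add]
  refine Finset.sum_comm' fun r s => ?_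
  simp only [Finset.mem_range, Finset.mem_Icc]
  omega

end Segments

/-! ### Sums over compositions -/

section Compositions

variable {V W X : Type*} [AddCommGroup X]

/-- The first block is split off. Its length is `t + 1` because blocks are nonempty, which matches
the recursion in `blockComp_cons`. -/
theorem Composition.sum_blocks_succ (n : ℕ) (G : List ℕ → X) :
    ∑ c : Composition (n + 1), G c.blocks =
      ∑ t ∈ Finset.range (n + 1), ∑ c : Composition (n - t), G ((t + 1) :: c.blocks) := by
  rw [Finset.sum_sigma']
  symm
  refine Finset.sum_bij (fun p hp => ⟨(p.1 + 1) :: p.2.blocks, ?_, ?_⟩) ?_ ?_ ?_ ?_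
  · intro i hi
    rcases List.mem_cons.1 hi with rfl | hi
    · omega
    · exact p.2.blocks_pos hi
  · have := p.2.blocks_sum
    simp at hp
    simp [this]
    omega
  · simp
  · rintro ⟨t, c⟩ ht ⟨t', c'⟩ ht' h
    have h1 := congrArg Composition.blocks h
    simp only [List.cons.injEq, Nat.add_right_cancel_iff] at h1
    obtain ⟨rfl, h2⟩ := h1
    rw [Composition.ext h2]
  · intro c _
    obtain ⟨i, ns, hc⟩ : ∃ i ns, c.blocks = i :: ns := by
      match h : c.blocks with
      | [] => simp [Composition.blocks_eq_nil] at h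
      | i :: ns => exact ⟨i, ns, rfl⟩
    have hi : 0 < i := c.blocks_pos (by simp [hc])
    have hsum := c.blocks_sum
    rw [hc, List.sum_cons] at hsum
    refine ⟨⟨i - 1, ⟨ns, fun {j} hj => c.blocks_pos (by simp [hc, hj]), by omega⟩⟩, ?_, ?_⟩
    · simp
      omega
    · refine Composition.ext ?_
      simp only [hc]
      congr 1
      omega
  · intro p _
    rfl

/-- The consecutive blocks of lengths `ns` of the sequence `a`, starting at `a_r`. -/
def segs (a : ℕ → V) : ℕ → List ℕ → List (List V)
  | _, [] => []
  | r, n :: ns => seg a r n :: segs a (r + n) ns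

theorem blockComp_seg (φ : List V → W) (f : List W → X) (a : ℕ → V) (r n : ℕ) :
    blockComp φ f (seg a r n) = ∑ c : Composition n, f ((segs a r c.blocks).map φ) := by
  induction n using Nat.strong_induction_on generalizing f r with
  | _ n ih =>
    cases n with
    | zero =>
      have : ∀ c : Composition 0, c.blocks = [] := fun c => by simp [Composition.blocks_eq_nil]
      simp [this, segs, composition_card]
    | succ n =>
      rw [Composition.sum_blocks_succ n fun ns => f ((segs a r ns).map φ), seg_succ,
        blockComp_cons, deconcSum_seg]
      refine Finset.sum_congr rfl fun t ht => ?_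
      rw [ih (n - t) (by omega)]
      refine Finset.sum_congr rfl fun c _ => ?_
      rw [segs, List.map_cons, ← seg_succ]
      congr 4
      omega

theorem segs_getElem (a : ℕ → V) (r : ℕ) (ns : List ℕ) (p : ℕ) (hp : p < ns.length)
    (hp' : p < (segs a r ns).length) :
    (segs a r ns)[p] = seg a (r + (ns.take p).sum) ns[p] := by
  induction ns generalizing r p with
  | nil => simp at hp
  | cons n ns ih =>
    cases p with
    | zero => simp [segs]
    | succ p =>
      simp only [segs, List.getElem_cons_succ, List.take_succ_cons, List.sum_cons]
      rw [ih (r + n) p (by simpa using hp), Nat.add_assoc]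

@[simp] theorem length_segs (a : ℕ → V) (r : ℕ) (ns : List ℕ) :
    (segs a r ns).length = ns.length := by
  induction ns generalizing r with
  | nil => rfl
  | cons n ns ih => simp [segs, ih]

end Compositions

/-! ### Multilinear maps as functions on lists -/

section EvalList

variable {k : Type v} [Field k] {V X : Type*} [AddCommGroup V] [Module k V]
  [AddCommGroup X] [Module k X]

/-- A family of multilinear maps as a function on lists. -/
def evalList (m : ∀ n : ℕ, MultilinearMap k (fun _ : Fin n => V) X) (l : List V) : X :=
  m l.length l.get

variable (m : ∀ n : ℕ, MultilinearMap k (fun _ : Fin n => V) X)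

theorem evalList_eq {l : List V} {n : ℕ} (hn : l.length = n) (x : Fin n → V)
    (h : ∀ (i : ℕ) (hi : i < n), l[i] = x ⟨i, hi⟩) : evalList m l = m n x := by
  subst hn
  exact congrArg (m l.length) (funext fun i => h i i.2)

theorem evalList_seg (a : ℕ → V) (r n : ℕ) :
    evalList m (seg a r n) = m n fun j => a (r + j) :=
  evalList_eq m (by simp) _ fun i hi => by simp [seg]

theorem evalList_multilinear : ListMultilinear k (evalList m) := by
  intro l₁ l₂
  let i : Fin (l₁.length + (l₂.length + 1)) := ⟨l₁.length, by omega⟩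
  let x₀ : Fin (l₁.length + (l₂.length + 1)) → V := fun j =>
    (l₁ ++ 0 :: l₂)[j.1]'(by simp)
  have h : (fun x => evalList m (l₁ ++ x :: l₂)) = (m _).toLinearMap x₀ i := by
    funext x
    refine evalList_eq m (by simp) _ fun j hj => ?_
    by_cases hji : j = l₁.length
    · subst hji
      simp [i]
    · have : (⟨j, hj⟩ : Fin (l₁.length + (l₂.length + 1))) ≠ i := fun h => hji (congrArg Fin.val h)
      rw [Function.update_of_ne this]
      simp only [x₀, List.getElem_append, List.getElem_cons]
      split_ifs
      · rfl
      · omega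
      · rfl
  rw [h]
  exact LinearMap.isLinear _

/-- A multilinear function on lists as a family of multilinear maps. -/
def ListMultilinear.toMultilinearMap {f : List V → X} (hf : ListMultilinear k f) (n : ℕ) :
    MultilinearMap k (fun _ : Fin n => V) X :=
  have key : ∀ [DecidableEq (Fin n)] (a : Fin n → V) (i : Fin n) (x : V),
      List.ofFn (Function.update a i x) =
        (List.ofFn a).take i ++ x :: (List.ofFn a).drop (i + 1) := by
    intro _ a i x
    rw [← List.set_eq_take_append_cons_drop.trans (if_pos (by simp))]
    refine List.ext_getElem (by simp) fun j h1 h2 => ?_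
    simp only [List.getElem_ofFn, List.getElem_set, Function.update_apply, Fin.ext_iff]
    simp only [eq_comm]
  { toFun := fun a => f (List.ofFn a)
    map_update_add' := fun a i x y => by
      simp only [key]
      exact (hf _ _).map_add x y
    map_update_smul' := fun a i c x => by
      simp only [key]
      exact (hf _ _).map_smul c x }

theorem ListMultilinear.toMultilinearMap_apply {f : List V → X} (hf : ListMultilinear k f) {n : ℕ}
    (a : Fin n → V) : hf.toMultilinearMap n a = f (List.ofFn a) := rfl

theorem ListMultilinear.evalList_toMultilinearMap {f : List V → X} (hf : ListMultilinear k f)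
    (l : List V) : evalList hf.toMultilinearMap l = f l := by
  rw [evalList, hf.toMultilinearMap_apply, List.ofFn_get]

theorem ListMultilinear.apply_units_smul {f : List V → X} (hf : ListMultilinear k f)
    (l₁ l₂ : List V) (e : ℤˣ) (x : V) : f (l₁ ++ (e • x) :: l₂) = e • f (l₁ ++ x :: l₂) := by
  rcases Int.units_eq_one_or e with rfl | rfl
  · simp
  · simpa using (hf l₁ l₂).mk' _ |>.map_neg x

end EvalList

/-! ### The sign twist -/

section Twist

variable {k : Type v} [Field k] {V : Type u} [AddCommGroup V] [Module k V]
  {X : Type w} [AddCommGroup X] [Module k X] {𝒱 : ℤ → Submodule k V}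

/-- The list `τⁿ⁻¹ a₁, …, τ aₙ₋₁, aₙ`. -/
def twist (τ : V →ₗ[k] V) : List V → List V
  | [] => []
  | a :: l => (τ ^ l.length) a :: twist τ l

@[simp] theorem length_twist (τ : V →ₗ[k] V) (l : List V) : (twist τ l).length = l.length := by
  induction l with
  | nil => rfl
  | cons a l ih => simp [twist, ih]

theorem twist_twist {τ : V →ₗ[k] V} (hτ : τ * τ = 1) (l : List V) : twist τ (twist τ l) = l := by
  induction l with
  | nil => rfl
  | cons a l ih =>
    rw [twist, twist, ih, length_twist, ← Module.End.mul_apply, ← (Commute.refl τ).mul_pow, hτ,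
      one_pow, Module.End.one_apply]

theorem ListMultilinear.comp_twist {f : List V → X} (hf : ListMultilinear k f) (τ : V →ₗ[k] V) :
    ListMultilinear k fun l => f (twist τ l) := by
  intro l₁ l₂
  induction l₁ generalizing f with
  | nil => exact (hf [] _).comp_apply (τ ^ l₂.length).isLinear
  | cons a l₁ ih =>
    have := ih (hf.cons ((τ ^ (l₁.length + (l₂.length + 1))) a))
    simpa [twist] using this

theorem mem_twist {τ : V →ₗ[k] V} {η : V} (hη : τ η = η) {l : List V} (h : η ∈ l) :
    η ∈ twist τ l := by
  have hpow : ∀ n : ℕ, (τ ^ n) η = η := fun n => by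
    induction n with
    | zero => rfl
    | succ n ih => rw [pow_succ', Module.End.mul_apply, ih, hη]
  induction l with
  | nil => simp at h
  | cons a l ih =>
    rcases List.mem_cons.1 h with rfl | h
    · simp [twist, hpow]
    · exact List.mem_cons_of_mem _ (ih h)

/-- The sign exponent relating an operation and its shift. -/
def twistSign : List ℤ → ℤ
  | [] => 0
  | d :: ds => ds.length * d + twistSign ds

theorem twistSign_append (x y : List ℤ) :
    twistSign (x ++ y) = twistSign x + y.length * x.sum + twistSign y := by
  induction x with
  | nil => simp [twistSign]
  | cons d x ih =>
    simp only [List.cons_append, twistSign, ih, List.length_append, List.sum_cons]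
    push_cast
    ring

/-- The sign `(-1)^i` on degree `i`. -/
noncomputable def gradingSign (h𝒱 : DirectSum.IsInternal 𝒱) : V →ₗ[k] V := -shiftAct h𝒱 (-1)

theorem gradingSign_mul_self (h𝒱 : DirectSum.IsInternal 𝒱) :
    gradingSign h𝒱 * gradingSign h𝒱 = 1 := by
  rw [gradingSign, neg_mul_neg, ← map_mul]
  simp

theorem gradingSign_apply (h𝒱 : DirectSum.IsInternal 𝒱) {i : ℤ} {a : V} (ha : a ∈ 𝒱 i) :
    gradingSign h𝒱 a = i.negOnePow • a := by
  rw [gradingSign, LinearMap.neg_apply, shiftAct_neg_one h𝒱 ha, Int.negOnePow_sub,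
    Int.negOnePow_one]
  simp

theorem units_smul_mem (e : ℤˣ) {i : ℤ} {a : V} (ha : a ∈ 𝒱 i) : e • a ∈ 𝒱 i := by
  rcases Int.units_eq_one_or e with rfl | rfl
  · simpa using ha
  · simpa using ha

theorem gradingSign_pow_apply (h𝒱 : DirectSum.IsInternal 𝒱) {i : ℤ} {a : V} (ha : a ∈ 𝒱 i)
    (n : ℕ) : (gradingSign h𝒱 ^ n) a = (n * i).negOnePow • a := by
  induction n with
  | zero => simp
  | succ n ih =>
    rw [pow_succ', Module.End.mul_apply, ih, gradingSign_apply h𝒱 (units_smul_mem _ ha), smul_smul,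
      ← Int.negOnePow_add]
    congr 2
    push_cast
    ring

variable {l : List V} {ds : List ℤ} {f : List V → X}

theorem apply_twist_of_homogeneous (h𝒱 : DirectSum.IsInternal 𝒱) (hf : ListMultilinear k f)
    (hl : List.Forall₂ (fun a i => a ∈ 𝒱 i) l ds) :
    f (twist (gradingSign h𝒱) l) = (twistSign ds).negOnePow • f l := by
  induction hl generalizing f with
  | nil => simp [twist, twistSign]
  | @cons a i l ds ha hl ih =>
    rw [twist, ih (hf.cons _), gradingSign_pow_apply h𝒱 ha,
      ← List.nil_append ((_ • a) :: l), hf.apply_units_smul, smul_smul, ← Int.negOnePow_add,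
      hl.length_eq, add_comm]
    rfl

theorem apply_map_shiftAct (h𝒱 : DirectSum.IsInternal 𝒱) (hf : ListMultilinear k f) (u : kˣ)
    (hl : List.Forall₂ (fun a i => a ∈ 𝒱 i) l ds) (z : List V) :
    f (l.map (shiftAct h𝒱 u) ++ z) = ((u ^ (ds.sum - ds.length) : kˣ) : k) • f (l ++ z) := by
  induction hl generalizing f with
  | nil => simp
  | @cons a i l ds ha hl ih =>
    rw [List.map_cons, List.cons_append, shiftAct_apply h𝒱 u ha, hf.cons_smul, ih (hf.cons _),
      smul_smul, ← Units.val_mul, ← zpow_add]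
    simp only [List.sum_cons, List.length_cons, List.cons_append]
    congr 3
    push_cast
    ring

theorem apply_map_koszul (h𝒱 : DirectSum.IsInternal 𝒱) (hf : ListMultilinear k f)
    (hl : List.Forall₂ (fun a i => a ∈ 𝒱 i) l ds) (z : List V) :
    f (l.map (shiftAct h𝒱 (-1)) ++ z) = (ds.sum - ds.length).negOnePow • f (l ++ z) := by
  rw [apply_map_shiftAct h𝒱 hf _ hl, negOnePow_smul_eq (k := k)]

variable {𝒳 : ℤ → Submodule k X}

/-- Homogeneous functions on lists are equivariant. -/
theorem equivariant_of_degree (h𝒱 : DirectSum.IsInternal 𝒱) (h𝒳 : DirectSum.IsInternal 𝒳)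
    (hf : ListMultilinear k f) {c : ℤ} (h : ∀ l ds, List.Forall₂ (fun a i => a ∈ 𝒱 i) l ds →
      f l ∈ 𝒳 (ds.sum + c + 1 - ds.length)) (u : kˣ) :
    ListEquivariant (shiftAct h𝒱 u) (shiftAct h𝒳 u) ((u ^ c : kˣ) : k) f := by
  refine ListMultilinear.ext_of_homogeneous h𝒱 (hf.postcomp _)
    ((hf.map (shiftAct h𝒱 u)).postcomp (((u ^ c : kˣ) : k) • LinearMap.id)) fun l ds hl => ?_
  have h1 := apply_map_shiftAct h𝒱 hf u hl []
  rw [List.append_nil, List.append_nil] at h1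
  rw [h1, shiftAct_apply h𝒳 u (h l ds hl), smul_smul, ← Units.val_mul, ← zpow_add]
  congr 3
  ring

/-- Equivariant functions on lists are homogeneous. -/
theorem degree_of_equivariant [CharZero k] (h𝒱 : DirectSum.IsInternal 𝒱)
    (h𝒳 : DirectSum.IsInternal 𝒳) (hf : ListMultilinear k f) {c : ℤ}
    (h : ∀ u : kˣ, ListEquivariant (shiftAct h𝒱 u) (shiftAct h𝒳 u) ((u ^ c : kˣ) : k) f)
    (hl : List.Forall₂ (fun a i => a ∈ 𝒱 i) l ds) : f l ∈ 𝒳 (ds.sum + c + 1 - ds.length) := by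
  refine mem_of_shiftAct_eq h𝒳 fun u => ?_
  have h1 := apply_map_shiftAct h𝒱 hf u hl []
  rw [List.append_nil, List.append_nil] at h1
  rw [h u l, h1, smul_smul, ← Units.val_mul, ← zpow_add]
  congr 3
  ring

end Twist

/-! ### Signs in the defining identities -/

section Signs

variable {k : Type v} [Field k] {V : Type u} [AddCommGroup V] [Module k V]
  {X : Type w} [AddCommGroup X] [Module k X] {𝒱 : ℤ → Submodule k V}

/-- The sign of each term is a product of the twist of the inner operation, the twist of the outer
one at the degree of the inserted value, and the Koszul sign of moving past the first `r` entries.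
Modulo two it differs from the Stasheff sign by `twistSign` of the whole list, which does not depend
on `r` and `s` and so factors out. -/
theorem sum_replaceBlock_eq_coderiv (h𝒱 : DirectSum.IsInternal 𝒱)
    (m : ∀ n : ℕ, MultilinearMap k (fun _ : Fin n => V) V)
    (hm : ∀ (n : ℕ) (a : Fin n → V) (d : Fin n → ℤ), (∀ i, a i ∈ 𝒱 (d i)) →
      m n a ∈ 𝒱 ((∑ i, d i) + 2 - n))
    (f : ∀ n : ℕ, MultilinearMap k (fun _ : Fin n => V) X) {a : ℕ → V} {d : ℕ → ℤ}
    (h : ∀ i, a i ∈ 𝒱 (d i)) (n : ℕ) :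
    ∑ s ∈ Finset.Icc 1 n, ∑ r ∈ Finset.range (n - s + 1),
      ((r : ℤ) + s * (n - r - s) + (2 - s) * ∑ j ∈ Finset.range r, d j).negOnePow •
        f (n - s + 1) (fun i => replaceBlock a r s (m s (fun j => a (r + j))) i) =
    (twistSign (seg d 0 n)).negOnePow • coderiv (shiftAct h𝒱 (-1))
      (fun l => evalList m (twist (gradingSign h𝒱) l))
      (fun l => evalList f (twist (gradingSign h𝒱) l)) (seg a 0 n) := by
  rw [coderiv_seg', Finset.smul_sum]
  refine Finset.sum_congr rfl fun s hs => ?_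
  rw [Finset.smul_sum]
  refine Finset.sum_congr rfl fun r hr => ?_
  rw [Finset.mem_Icc] at hs
  rw [Finset.mem_range] at hr
  obtain ⟨t, rfl⟩ : ∃ t, n = r + (s + t) := ⟨n - r - s, by omega⟩
  have hn : r + (s + t) - s + 1 = r + (1 + t) := by omega
  have ht : r + (s + t) - r - s = t := by omega
  rw [hn, ht]
  have hf := evalList_multilinear f
  have hseg := fun r n => forall₂_seg (P := fun a i => a ∈ 𝒱 i) h r n
  have hx : m s (fun j => a (r + j)) ∈ 𝒱 ((seg d r s).sum + 2 - s) := by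
    have := hm s (fun j => a (r + j)) (fun j => d (r + j)) fun j => h _
    rwa [Fin.sum_univ_eq_sum_range (fun j => d (r + j)), ← sum_seg] at this
  have h1 := evalList_seg f (replaceBlock a r s (m s (fun j => a (r + j)))) 0 (r + (1 + t))
  simp only [Nat.zero_add] at h1
  rw [← h1, seg_replaceBlock a r s t hs.1, apply_map_koszul h𝒱 (hf.comp_twist _) (hseg 0 r),
    apply_twist_of_homogeneous h𝒱 (evalList_multilinear m) (hseg r s), evalList_seg,
    hf.comp_twist _ |>.apply_units_smul,
    apply_twist_of_homogeneous h𝒱 hf (List.rel_append (hseg 0 r) (.cons hx (hseg (r + s) t))),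
    smul_smul, smul_smul, smul_smul, ← Int.negOnePow_add, ← Int.negOnePow_add,
    ← Int.negOnePow_add]
  congr 1
  rw [Int.negOnePow_eq_iff, seg_add, seg_add, Nat.zero_add]
  have h2 : ∑ j ∈ Finset.range r, d j = (seg d 0 r).sum := by simp [sum_seg]
  simp only [twistSign_append, twistSign, length_seg, List.length_append, List.length_cons, h2]
  -- The witness is half the difference of the two exponents.
  refine ⟨r + s * t - s * (seg d 0 r).sum - t * (seg d 0 r).sum - twistSign (seg d 0 r) -
    twistSign (seg d r s) - t * (seg d r s).sum - twistSign (seg d (r + s) t) - t, ?_⟩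
  push_cast
  ring

/-- The sign exponent of a composition with block lengths `ns`, starting at position `r` with
total degree `P` to the left. -/
def blocksSign (d : ℕ → ℤ) : ℤ → ℕ → List ℕ → ℤ
  | _, _, [] => 0
  | P, r, n :: ns => ns.length * (n - 1) + (1 - n) * P +
      blocksSign d (P + (seg d r n).sum) (r + n) ns

/-- The degrees of the values of a morphism on the blocks of lengths `ns`. -/
def blocksDegree (d : ℕ → ℤ) : ℕ → List ℕ → List ℤ
  | _, [] => []
  | r, n :: ns => ((seg d r n).sum + 1 - n) :: blocksDegree d (r + n) ns

theorem length_blocksDegree (d : ℕ → ℤ) (r : ℕ) (ns : List ℕ) :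
    (blocksDegree d r ns).length = ns.length := by
  induction ns generalizing r with
  | nil => rfl
  | cons n ns ih => simp [blocksDegree, ih]

/-- Modulo two, the twist of the whole list and the sign of the composition add up to the twist on
the block values and the twists inside the blocks. The last summand corrects for the degree `P` to
the left of the starting position, which the induction over blocks needs; it is absent for `P = 0`.
-/
theorem even_blocksSign (d : ℕ → ℤ) (P : ℤ) (r : ℕ) (ns : List ℕ) :
    Even (twistSign (seg d r ns.sum) + blocksSign d P r ns +
      (twistSign (blocksDegree d r ns) + ((segs d r ns).map twistSign).sum) +
      (ns.length - ns.sum) * P) := by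
  induction ns generalizing P r with
  | nil => simp [twistSign, blocksSign, blocksDegree, segs]
  | cons n ns ih =>
    obtain ⟨c, hc⟩ := ih (P + (seg d r n).sum) (r + n)
    simp only [List.sum_cons, seg_add, twistSign_append, twistSign, blocksSign, blocksDegree, segs,
      List.map_cons, length_blocksDegree, List.length_cons, length_seg] at hc ⊢
    refine ⟨c + twistSign (seg d r n) + ns.sum * (seg d r n).sum + (1 - n) * P, ?_⟩
    simp only [Nat.cast_add, Nat.cast_one]
    linear_combination hc

theorem sum_fin_eq_blocksSign (d : ℕ → ℤ) (P : ℤ) (r : ℕ) (ns : List ℕ) :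
    ∑ p : Fin ns.length, (((ns.length : ℤ) - 1 - p) * (ns.get p - 1) +
      (1 - ns.get p) * (P + (seg d r (ns.take p).sum).sum)) = blocksSign d P r ns := by
  induction ns generalizing P r with
  | nil => rfl
  | cons n ns ih =>
    simp only [List.length_cons]
    rw [Fin.sum_univ_succ, blocksSign, ← ih]
    congr 1
    · simp
    · refine Finset.sum_congr rfl fun p _ => ?_
      simp [seg_add]
      ring

theorem composition_sign (d : ℕ → ℤ) {n : ℕ} (c : Composition n) :
    ∑ p : Fin c.length, (((c.length : ℤ) - 1 - p) * (c.blocksFun p - 1) +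
      (1 - c.blocksFun p) * ∑ j ∈ Finset.range (c.sizeUpTo p), d j) =
    blocksSign d 0 0 c.blocks := by
  rw [← sum_fin_eq_blocksSign]
  refine Finset.sum_congr rfl fun p _ => ?_
  simp only [sum_seg, zero_add]
  rfl

variable {W : Type*} [AddCommGroup W] [Module k W] {𝒲 : ℤ → Submodule k W}

theorem forall₂_blocksDegree {Z : Type*} (φ : List Z → W) {a : ℕ → Z} {d : ℕ → ℤ}
    (h : ∀ r n, φ (seg a r n) ∈ 𝒲 ((seg d r n).sum + 1 - n)) (r : ℕ) (ns : List ℕ) :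
    List.Forall₂ (fun a i => a ∈ 𝒲 i) ((segs a r ns).map φ) (blocksDegree d r ns) := by
  induction ns generalizing r with
  | nil => exact .nil
  | cons n ns ih => exact .cons (h r n) (ih _)

theorem apply_map_twist (h𝒱 : DirectSum.IsInternal 𝒱) {φ : List V → W} (hφ : ListMultilinear k φ)
    {f : List W → X} (hf : ListMultilinear k f) {a : ℕ → V} {d : ℕ → ℤ}
    (h : ∀ i, a i ∈ 𝒱 (d i)) (r : ℕ) (ns : List ℕ) :
    f ((segs a r ns).map fun l => φ (twist (gradingSign h𝒱) l)) =
      ((segs d r ns).map twistSign).sum.negOnePow • f ((segs a r ns).map φ) := by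
  induction ns generalizing r f with
  | nil => simp [segs]
  | cons n ns ih =>
    simp only [segs, List.map_cons, List.sum_cons]
    rw [ih (hf.cons _), apply_twist_of_homogeneous h𝒱 hφ
      (forall₂_seg (P := fun a i => a ∈ 𝒱 i) h r n),
      ← List.nil_append ((_ • φ _) :: _), hf.apply_units_smul, smul_smul, ← Int.negOnePow_add,
      add_comm]
    rfl

/-- The counterpart of `sum_replaceBlock_eq_coderiv` for the other side of the morphism equation.
The same global sign is extracted, so it cancels between the sides. -/
theorem sum_composition_eq_blockComp (h𝒱 : DirectSum.IsInternal 𝒱) (h𝒲 : DirectSum.IsInternal 𝒲)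
    (f : ∀ n : ℕ, MultilinearMap k (fun _ : Fin n => V) W)
    (hf : ∀ (n : ℕ) (a : Fin n → V) (d : Fin n → ℤ), (∀ i, a i ∈ 𝒱 (d i)) →
      f n a ∈ 𝒲 ((∑ i, d i) + 1 - n))
    (m : ∀ n : ℕ, MultilinearMap k (fun _ : Fin n => W) X) {a : ℕ → V} {d : ℕ → ℤ}
    (h : ∀ i, a i ∈ 𝒱 (d i)) (n : ℕ) :
    ∑ c : Composition n,
      (∑ p : Fin c.length, (((c.length : ℤ) - 1 - p) * (c.blocksFun p - 1) +
          (1 - c.blocksFun p) * ∑ j ∈ Finset.range (c.sizeUpTo p), d j)).negOnePow •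
        m c.length (fun p => f (c.blocksFun p) (fun j => a (c.sizeUpTo p + j))) =
    (twistSign (seg d 0 n)).negOnePow • blockComp
      (fun l => evalList f (twist (gradingSign h𝒱) l))
      (fun l => evalList m (twist (gradingSign h𝒲) l)) (seg a 0 n) := by
  rw [blockComp_seg, Finset.smul_sum]
  refine Finset.sum_congr rfl fun c _ => ?_
  have hm := evalList_multilinear m
  have hdeg : ∀ r n, evalList f (seg a r n) ∈ 𝒲 ((seg d r n).sum + 1 - n) := fun r n => by
    have := hf n (fun j => a (r + j)) (fun j => d (r + j)) fun j => h _
    rwa [Fin.sum_univ_eq_sum_range (fun j => d (r + j)), ← sum_seg, ← evalList_seg] at this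
  have h1 : evalList m ((segs a 0 c.blocks).map (evalList f)) =
      m c.length (fun p => f (c.blocksFun p) (fun j => a (c.sizeUpTo p + j))) := by
    refine evalList_eq m (by simp) _ fun p hp => ?_
    rw [List.getElem_map, segs_getElem a 0 c.blocks p hp, evalList_seg, Nat.zero_add]
    rfl
  rw [composition_sign, ← h1,
    apply_map_twist h𝒱 (evalList_multilinear f) (hm.comp_twist (gradingSign h𝒲)) h,
    apply_twist_of_homogeneous h𝒲 hm (forall₂_blocksDegree _ hdeg 0 c.blocks),
    smul_smul, smul_smul, ← Int.negOnePow_add, ← Int.negOnePow_add]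
  congr 1
  rw [Int.negOnePow_eq_iff]
  obtain ⟨e, he⟩ := even_blocksSign d 0 0 c.blocks
  rw [c.blocks_sum] at he
  refine ⟨blocksSign d 0 0 c.blocks - e, ?_⟩
  linarith

end Signs

/-! ### `A_∞`-structures as codifferentials -/

section Degrees

variable {k : Type v} [Field k] {V : Type u} [AddCommGroup V] [Module k V]
  {X : Type w} [AddCommGroup X] [Module k X] {𝒱 : ℤ → Submodule k V} {𝒳 : ℤ → Submodule k X}

theorem evalList_mem {m : ∀ n : ℕ, MultilinearMap k (fun _ : Fin n => V) X} {c : ℤ}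
    (hm : ∀ (n : ℕ) (a : Fin n → V) (d : Fin n → ℤ), (∀ i, a i ∈ 𝒱 (d i)) →
      m n a ∈ 𝒳 ((∑ i, d i) + c - n)) {l : List V} {ds : List ℤ}
    (hl : List.Forall₂ (fun a i => a ∈ 𝒱 i) l ds) : evalList m l ∈ 𝒳 (ds.sum + c - ds.length) := by
  have h := hm l.length l.get (fun i => ds.get (Fin.cast hl.length_eq i)) fun i => hl.get i.2 _
  have h1 : ∑ i, ds.get (Fin.cast hl.length_eq i) = ds.sum := by
    rw [← Fin.sum_univ_getElem ds]
    exact Equiv.sum_comp (finCongr hl.length_eq) ds.get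
  rw [h1] at h
  rwa [← hl.length_eq]

theorem forall₂_ofFn {n : ℕ} {a : Fin n → V} {d : Fin n → ℤ} (h : ∀ i, a i ∈ 𝒱 (d i)) :
    List.Forall₂ (fun a i => a ∈ 𝒱 i) (List.ofFn a) (List.ofFn d) := by
  rw [List.forall₂_iff_get]
  simp [h]

theorem evalList_twist_mem (h𝒱 : DirectSum.IsInternal 𝒱)
    {m : ∀ n : ℕ, MultilinearMap k (fun _ : Fin n => V) X} {c : ℤ}
    (hm : ∀ (n : ℕ) (a : Fin n → V) (d : Fin n → ℤ), (∀ i, a i ∈ 𝒱 (d i)) →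
      m n a ∈ 𝒳 ((∑ i, d i) + c - n)) {l : List V} {ds : List ℤ}
    (hl : List.Forall₂ (fun a i => a ∈ 𝒱 i) l ds) :
    evalList m (twist (gradingSign h𝒱) l) ∈ 𝒳 (ds.sum + c - ds.length) := by
  rw [apply_twist_of_homogeneous h𝒱 (evalList_multilinear m) hl]
  exact units_smul_mem _ (evalList_mem hm hl)

theorem toMultilinearMap_comp_twist_mem [CharZero k] (h𝒱 : DirectSum.IsInternal 𝒱)
    (h𝒳 : DirectSum.IsInternal 𝒳) {f : List V → X} (hf : ListMultilinear k f) {c : ℤ}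
    (h : ∀ u : kˣ, ListEquivariant (shiftAct h𝒱 u) (shiftAct h𝒳 u) ((u ^ c : kˣ) : k) f)
    {n : ℕ} {a : Fin n → V} {d : Fin n → ℤ} (ha : ∀ i, a i ∈ 𝒱 (d i)) :
    (hf.comp_twist (gradingSign h𝒱)).toMultilinearMap n a ∈ 𝒳 ((∑ i, d i) + c + 1 - n) := by
  rw [ListMultilinear.toMultilinearMap_apply,
    apply_twist_of_homogeneous h𝒱 hf (forall₂_ofFn ha)]
  refine units_smul_mem _ ?_
  simpa [List.sum_ofFn] using degree_of_equivariant h𝒱 h𝒳 hf h (forall₂_ofFn ha)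

theorem evalList_toMultilinearMap_comp_twist (h𝒱 : DirectSum.IsInternal 𝒱) {f : List V → X}
    (hf : ListMultilinear k f) : (fun l => evalList
      (hf.comp_twist (gradingSign h𝒱)).toMultilinearMap (twist (gradingSign h𝒱) l)) = f := by
  funext l
  rw [ListMultilinear.evalList_toMultilinearMap, twist_twist (gradingSign_mul_self h𝒱)]

theorem toMultilinearMap_zero {f : List V → X} (hf : ListMultilinear k f) (h : f [] = 0) :
    hf.toMultilinearMap 0 = 0 := by
  ext a
  rw [ListMultilinear.toMultilinearMap_apply]
  simpa using h

theorem ListMultilinear.ext_of_seg (h𝒱 : DirectSum.IsInternal 𝒱) {f g : List V → X}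
    (hf : ListMultilinear k f) (hg : ListMultilinear k g)
    (h : ∀ (a : ℕ → V) (d : ℕ → ℤ), (∀ i, a i ∈ 𝒱 (d i)) → ∀ n, f (seg a 0 n) = g (seg a 0 n))
    (l : List V) : f l = g l := by
  refine hf.ext_of_homogeneous h𝒱 hg (fun l ds hl => ?_) l
  obtain ⟨a, d, had, h'⟩ := exists_seg_eq hl (x₀ := 0) (d₀ := 0) (zero_mem _)
  rw [← h']
  exact h a d had _

end Degrees

namespace AInfStructure

variable {k : Type v} [Field k] {V : Type u} [AddCommGroup V] [Module k V]
  {𝒱 : ℤ → Submodule k V}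

/-- The operations on the shifted space, as a function on lists. -/
noncomputable def bar (S : AInfStructure 𝒱) (l : List V) : V :=
  evalList S.m (twist (gradingSign S.isInternal) l)

variable (S : AInfStructure 𝒱)

theorem bar_nil : S.bar [] = 0 := by
  rw [bar, evalList]
  change S.m 0 _ = 0
  rw [S.m_zero]
  rfl

theorem bar_singleton (a : V) : S.bar [a] = S.differential a :=
  evalList_eq S.m (n := 1) rfl _ fun i hi => by
    obtain rfl : i = 0 := by omega
    simp [twist]

theorem bar_pair (a b : V) : S.bar [a, b] = S.m 2 ![gradingSign S.isInternal a, b] :=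
  evalList_eq S.m rfl _ fun i hi => by
    match i, hi with
    | 0, _ => simp [twist]
    | 1, _ => simp [twist]

/-- Degree `2 - n` becomes degree one after the shift, and the Stasheff identities become the
vanishing of the square, because the sign relating them is invertible. -/
theorem isBarOp_bar : IsBarOp (shiftAct S.isInternal) S.bar where
  multilinear := (evalList_multilinear S.m).comp_twist _
  nil := S.bar_nil
  equivariant u := by
    have := equivariant_of_degree S.isInternal S.isInternal
      ((evalList_multilinear S.m).comp_twist (gradingSign S.isInternal)) (c := 1)
      (fun l ds hl => by
        have := evalList_twist_mem S.isInternal S.m_mem hl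
        rwa [show ds.sum + 1 + 1 = ds.sum + 2 by ring]) u
    rwa [zpow_one] at this
  square := by
    have hm := (evalList_multilinear S.m).comp_twist (gradingSign S.isInternal)
    refine (hm.coderiv (shiftAct S.isInternal (-1)) hm).ext_of_seg S.isInternal .zero
      fun a d h n => ?_
    have := S.stasheff n a d h
    rwa [sum_replaceBlock_eq_coderiv S.isInternal S.m S.m_mem S.m h, smul_eq_zero_iff_eq] at this

theorem isUnitalOp_bar {S : AInfStructure 𝒱} {η : V} (hη : S.IsStrictUnit η) :
    IsUnitalOp (shiftAct S.isInternal (-1)) η S.bar where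
  left a := by
    rw [bar_pair, gradingSign_apply S.isInternal hη.mem, Int.negOnePow_zero, one_smul, hη.left]
  right a := by
    rw [bar_pair, hη.right]
    rfl
  vanish l hl h := by
    have : gradingSign S.isInternal η = η := by
      rw [gradingSign_apply S.isInternal hη.mem, Int.negOnePow_zero, one_smul]
    obtain ⟨j, hj⟩ := List.mem_iff_get.1 (mem_twist this hl)
    exact hη.vanish _ (by simpa using h) _ ⟨j, hj⟩

section OfBar

variable [CharZero k] (h𝒱 : DirectSum.IsInternal 𝒱) {b : List V → V}
  (hb : IsBarOp (shiftAct h𝒱) b)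

/-- The `A_∞`-structure with given operations on the shifted space. -/
noncomputable def ofBar : AInfStructure 𝒱 where
  isInternal := h𝒱
  m := (hb.multilinear.comp_twist (gradingSign h𝒱)).toMultilinearMap
  m_zero := toMultilinearMap_zero _ hb.nil
  m_mem n a d h := by
    have := toMultilinearMap_comp_twist_mem h𝒱 h𝒱 hb.multilinear (c := 1)
      (fun u => by rw [zpow_one]; exact hb.equivariant u) h
    rwa [add_assoc] at this
  stasheff n a d h := by
    rw [sum_replaceBlock_eq_coderiv h𝒱 _ (fun n a d h => by
        have := toMultilinearMap_comp_twist_mem h𝒱 h𝒱 hb.multilinear (c := 1)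
          (fun u => by rw [zpow_one]; exact hb.equivariant u) h
        rwa [add_assoc] at this) _ h,
      evalList_toMultilinearMap_comp_twist h𝒱 hb.multilinear, hb.square, smul_zero]

theorem bar_ofBar : (ofBar h𝒱 hb).bar = b :=
  evalList_toMultilinearMap_comp_twist h𝒱 hb.multilinear

end OfBar

theorem isStrictUnit_of_bar {S : AInfStructure 𝒱} {η : V} (hη : η ∈ 𝒱 0)
    (h : IsUnitalOp (shiftAct S.isInternal (-1)) η S.bar) : S.IsStrictUnit η where
  mem := hη
  right a := by
    have h1 := h.right (gradingSign S.isInternal a)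
    rw [bar_pair, ← LinearMap.neg_apply, ← gradingSign, ← Module.End.mul_apply,
      gradingSign_mul_self] at h1
    exact h1
  left a := by
    have h1 := h.left a
    rwa [bar_pair, gradingSign_apply S.isInternal hη, Int.negOnePow_zero, one_smul] at h1
  vanish n hn a ha := by
    have h1 : gradingSign S.isInternal η = η := by
      rw [gradingSign_apply S.isInternal hη, Int.negOnePow_zero, one_smul]
    have h2 : S.bar (twist (gradingSign S.isInternal) (List.ofFn a)) = S.m n a := by
      rw [bar, twist_twist (gradingSign_mul_self _)]
      exact evalList_eq _ (by simp) _ (by simp)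
    rw [← h2]
    refine h.vanish _ (mem_twist h1 ?_) (by simpa using hn)
    rw [List.mem_ofFn]
    exact ha

end AInfStructure

namespace AInfHom

variable {k : Type v} [Field k] {V : Type u} [AddCommGroup V] [Module k V]
  {W : Type w} [AddCommGroup W] [Module k W] {𝒱 : ℤ → Submodule k V} {𝒲 : ℤ → Submodule k W}
  {S : AInfStructure 𝒱} {T : AInfStructure 𝒲}

/-- The components on the shifted spaces, as a function on lists. -/
noncomputable def bar (F : AInfHom S T) (l : List V) : W :=
  evalList F.f (twist (gradingSign S.isInternal) l)

variable (F : AInfHom S T)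

theorem bar_singleton (a : V) : F.bar [a] = F.linear a :=
  evalList_eq F.f (n := 1) rfl _ fun i hi => by
    obtain rfl : i = 0 := by omega
    simp [twist]

theorem isBarMap_bar :
    IsBarMap (shiftAct S.isInternal) (shiftAct T.isInternal) S.bar T.bar F.bar where
  multilinear := (evalList_multilinear F.f).comp_twist _
  nil := by
    rw [bar, evalList]
    change F.f 0 _ = 0
    rw [F.f_zero]
    rfl
  equivariant u := by
    have := equivariant_of_degree S.isInternal T.isInternal
      ((evalList_multilinear F.f).comp_twist (gradingSign S.isInternal)) (c := 0)
      (fun l ds hl => by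
        have := evalList_twist_mem S.isInternal F.f_mem hl
        rwa [show ds.sum + 0 + 1 = ds.sum + 1 by ring]) u
    rwa [zpow_zero, Units.val_one] at this
  rel := by
    have hm := (evalList_multilinear S.m).comp_twist (gradingSign S.isInternal)
    have hn := (evalList_multilinear T.m).comp_twist (gradingSign T.isInternal)
    have hf := (evalList_multilinear F.f).comp_twist (gradingSign S.isInternal)
    refine (hm.coderiv (shiftAct S.isInternal (-1)) hf).ext_of_seg S.isInternal (hf.blockComp hn)
      fun a d h n => ?_
    have := F.rel n a d h
    rwa [sum_replaceBlock_eq_coderiv S.isInternal S.m S.m_mem F.f h,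
      sum_composition_eq_blockComp S.isInternal T.isInternal F.f F.f_mem T.m h,
      smul_left_cancel_iff] at this

theorem isUnitalMap_bar {F : AInfHom S T} {η : V} {θ : W} (hη : η ∈ 𝒱 0)
    (h : F.IsStrictlyUnital η θ) : IsUnitalMap η θ F.bar where
  map_unit := (F.bar_singleton η).trans h.map_unit
  vanish l hl hn := by
    have : gradingSign S.isInternal η = η := by
      rw [gradingSign_apply S.isInternal hη, Int.negOnePow_zero, one_smul]
    obtain ⟨j, hj⟩ := List.mem_iff_get.1 (mem_twist this hl)
    exact h.vanish _ (by simpa using hn) _ ⟨j, hj⟩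

section OfBar

variable [CharZero k] {φ : List V → W}
  (hφ : IsBarMap (shiftAct S.isInternal) (shiftAct T.isInternal) S.bar T.bar φ)

theorem toMultilinearMap_mem_of_isBarMap (n : ℕ) (a : Fin n → V) (d : Fin n → ℤ)
    (h : ∀ i, a i ∈ 𝒱 (d i)) :
    (hφ.multilinear.comp_twist (gradingSign S.isInternal)).toMultilinearMap n a ∈
      𝒲 ((∑ i, d i) + 1 - n) := by
  have := toMultilinearMap_comp_twist_mem S.isInternal T.isInternal hφ.multilinear (c := 0)
    (fun u => by rw [zpow_zero]; exact hφ.equivariant u) h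
  rwa [add_zero] at this

/-- The `A_∞`-morphism with given components on the shifted spaces. -/
noncomputable def ofBar : AInfHom S T where
  f := (hφ.multilinear.comp_twist (gradingSign S.isInternal)).toMultilinearMap
  f_zero := toMultilinearMap_zero _ hφ.nil
  f_mem := toMultilinearMap_mem_of_isBarMap hφ
  rel n a d h := by
    rw [sum_replaceBlock_eq_coderiv S.isInternal S.m S.m_mem _ h,
      sum_composition_eq_blockComp S.isInternal T.isInternal _
        (toMultilinearMap_mem_of_isBarMap hφ) T.m h,
      evalList_toMultilinearMap_comp_twist S.isInternal hφ.multilinear]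
    congr 1
    exact hφ.rel _

theorem bar_ofBar : (ofBar hφ).bar = φ :=
  evalList_toMultilinearMap_comp_twist S.isInternal hφ.multilinear

end OfBar

theorem isStrictlyUnital_of_bar {F : AInfHom S T} {η : V} {θ : W} (hη : η ∈ 𝒱 0)
    (h : IsUnitalMap η θ F.bar) : F.IsStrictlyUnital η θ where
  map_unit := (F.bar_singleton η).symm.trans h.map_unit
  vanish n hn a ha := by
    have h1 : gradingSign S.isInternal η = η := by
      rw [gradingSign_apply S.isInternal hη, Int.negOnePow_zero, one_smul]
    have h2 : F.bar (twist (gradingSign S.isInternal) (List.ofFn a)) = F.f n a := by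
      rw [bar, twist_twist (gradingSign_mul_self _)]
      exact evalList_eq _ (by simp) _ (by simp)
    rw [← h2]
    refine h.vanish _ (mem_twist h1 ?_) (by simpa using hn)
    rw [List.mem_ofFn]
    exact ha

end AInfHom

/-! ### Quasi-isomorphisms of complexes -/

section QuasiIso

variable {k : Type v} [Field k] {V : Type u} [AddCommGroup V] [Module k V]
  {W : Type w} [AddCommGroup W] [Module k W] {X : Type*} [AddCommGroup X] [Module k X]
  {δ : V →ₗ[k] V} {ε : W →ₗ[k] W} {ζ : X →ₗ[k] X}

theorem cohomologyClass_eq_zero_iff {z : LinearMap.ker δ} :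
    cohomologyClass δ z = 0 ↔ ∃ y, δ y = z :=
  Submodule.Quotient.mk_eq_zero _

theorem isQuasiIsoMap_iff {φ : V →ₗ[k] W} : IsQuasiIsoMap δ ε φ ↔ (∀ x, φ (δ x) = ε (φ x)) ∧
    (∀ z, δ z = 0 → (∃ w, ε w = φ z) → ∃ y, δ y = z) ∧
    ∀ w, ε w = 0 → ∃ z, δ z = 0 ∧ ∃ y, ε y = w - φ z := by
  have hinj : ∀ h : φ ∘ₗ δ = ε ∘ₗ φ, Function.Injective (cohomologyMap φ h) ↔
      ∀ z, δ z = 0 → (∃ w, ε w = φ z) → ∃ y, δ y = z := by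
    intro h
    rw [injective_iff_map_eq_zero]
    refine ⟨fun H z hz hw => ?_, fun H x hx => ?_⟩
    · exact cohomologyClass_eq_zero_iff.1 (H (cohomologyClass δ ⟨z, hz⟩)
        (cohomologyClass_eq_zero_iff.2 hw))
    · obtain ⟨⟨z, hz⟩, rfl⟩ := Submodule.mkQ_surjective _ x
      exact cohomologyClass_eq_zero_iff.2 (H z hz (cohomologyClass_eq_zero_iff.1 hx))
  have hsurj : ∀ h : φ ∘ₗ δ = ε ∘ₗ φ, Function.Surjective (cohomologyMap φ h) ↔
      ∀ w, ε w = 0 → ∃ z, δ z = 0 ∧ ∃ y, ε y = w - φ z := by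
    intro h
    have h1 : ∀ z (hz : δ z = 0) w (hw : ε w = 0), cohomologyMap φ h (cohomologyClass δ ⟨z, hz⟩) =
        cohomologyClass ε ⟨w, hw⟩ ↔ ∃ y, ε y = w - φ z := by
      intro z hz w hw
      have hφz : φ z ∈ LinearMap.ker ε := by
        rw [LinearMap.mem_ker, ← LinearMap.comp_apply, ← h, LinearMap.comp_apply, hz, map_zero]
      rw [eq_comm, ← sub_eq_zero]
      exact cohomologyClass_eq_zero_iff (δ := ε) (z := ⟨w, hw⟩ - ⟨φ z, hφz⟩)
    refine ⟨fun H w hw => ?_, fun H x => ?_⟩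
    · obtain ⟨x, hx⟩ := H (cohomologyClass ε ⟨w, hw⟩)
      obtain ⟨⟨z, hz⟩, rfl⟩ := Submodule.mkQ_surjective _ x
      exact ⟨z, hz, (h1 z hz w hw).1 hx⟩
    · obtain ⟨⟨w, hw⟩, rfl⟩ := Submodule.mkQ_surjective _ x
      obtain ⟨z, hz, hy⟩ := H w hw
      exact ⟨_, (h1 z hz w hw).2 hy⟩
  constructor
  · rintro ⟨h, hb⟩
    exact ⟨fun x => LinearMap.congr_fun h x, (hinj h).1 hb.1, (hsurj h).1 hb.2⟩
  · rintro ⟨h, h1, h2⟩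
    have h' : φ ∘ₗ δ = ε ∘ₗ φ := LinearMap.ext h
    exact ⟨h', (hinj h').2 h1, (hsurj h').2 h2⟩

theorem IsQuasiIsoMap.comp {φ : V →ₗ[k] W} {ψ : W →ₗ[k] X} (hφ : IsQuasiIsoMap δ ε φ)
    (hψ : IsQuasiIsoMap ε ζ ψ) : IsQuasiIsoMap δ ζ (ψ ∘ₗ φ) := by
  obtain ⟨h, hb⟩ := hφ
  obtain ⟨h', hb'⟩ := hψ
  have hc : (ψ ∘ₗ φ) ∘ₗ δ = ζ ∘ₗ (ψ ∘ₗ φ) := by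
    rw [LinearMap.comp_assoc, h, ← LinearMap.comp_assoc, h', LinearMap.comp_assoc]
  refine ⟨hc, ?_⟩
  have : ⇑(cohomologyMap (ψ ∘ₗ φ) hc) = cohomologyMap ψ h' ∘ cohomologyMap φ h := by
    funext x
    obtain ⟨z, rfl⟩ := Submodule.mkQ_surjective _ x
    rfl
  rw [this]
  exact hb'.comp hb

theorem IsQuasiIsoMap.id (δ : V →ₗ[k] V) : IsQuasiIsoMap δ δ LinearMap.id :=
  isQuasiIsoMap_iff.2 ⟨fun _ => rfl, fun _ _ h => h, fun w hw => ⟨w, hw, 0, by simp⟩⟩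

/-- With zero differentials a complex is its own cohomology. Hence quasi-isomorphisms between
minimal structures have bijective linear part and are invertible. -/
theorem isQuasiIsoMap_zero_iff {φ : V →ₗ[k] W} :
    IsQuasiIsoMap 0 0 φ ↔ Function.Bijective φ := by
  rw [isQuasiIsoMap_iff, Function.Bijective, injective_iff_map_eq_zero]
  simp only [LinearMap.zero_apply, map_zero, exists_const, forall_const, true_and]
  refine and_congr (forall_congr' fun z => imp_congr eq_comm eq_comm)
    (forall_congr' fun w => exists_congr fun z => ?_)
  rw [eq_comm, sub_eq_zero, eq_comm]

end QuasiIso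

/-! ### Splitting a graded complex over a field -/

section Splitting

variable {k : Type v} [Field k] {V : Type u} [AddCommGroup V] [Module k V]
  {W : Type w} [AddCommGroup W] [Module k W] {𝒱 : ℤ → Submodule k V} {𝒲 : ℤ → Submodule k W}

theorem DirectSum.IsInternal.exists_linearMap (h𝒱 : DirectSum.IsInternal 𝒱) (G : ℤ → V →ₗ[k] W) :
    ∃ g : V →ₗ[k] W, ∀ i, ∀ a ∈ 𝒱 i, g a = G i a := by
  refine ⟨DirectSum.toModule k ℤ W (fun i => G i ∘ₗ (𝒱 i).subtype) ∘ₗ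
    (LinearEquiv.ofBijective (DirectSum.coeLinearMap 𝒱) h𝒱).symm.toLinearMap, fun i a ha => ?_⟩
  have h : (LinearEquiv.ofBijective (DirectSum.coeLinearMap 𝒱) h𝒱).symm a =
      DirectSum.lof k ℤ (fun i => 𝒱 i) i ⟨a, ha⟩ := by
    rw [LinearEquiv.symm_apply_eq]
    exact (DirectSum.coeLinearMap_lof 𝒱 i ⟨a, ha⟩).symm
  simp [h]

/-- A section over the range of `f` is extended to `W`. A rank-one term built from a functional that
vanishes on the range but not at `η` then makes it kill `η`. -/
theorem LinearMap.exists_pseudoinverse (f : V →ₗ[k] W) {η : W} (hη : η ∉ LinearMap.range f) :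
    ∃ g : W →ₗ[k] V, (∀ x, f (g (f x)) = f x) ∧ g η = 0 := by
  obtain ⟨s, hs⟩ := f.rangeRestrict.exists_rightInverse_of_surjective f.range_rangeRestrict
  obtain ⟨g, hg⟩ := LinearMap.exists_extend s
  obtain ⟨l, hl, hl'⟩ := Submodule.exists_dual_map_eq_bot_of_notMem hη inferInstance
  have hl0 : ∀ x, l (f x) = 0 := fun x => by
    have : l (f x) ∈ (LinearMap.range f).map l := ⟨f x, ⟨x, rfl⟩, rfl⟩
    rwa [hl', Submodule.mem_bot] at this
  refine ⟨g - (l.smulRight ((l η)⁻¹ • g η)), fun x => ?_, ?_⟩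
  · have h1 := LinearMap.congr_fun hg ⟨f x, x, rfl⟩
    have h2 := congrArg Subtype.val (LinearMap.congr_fun hs ⟨f x, x, rfl⟩)
    simp only [LinearMap.comp_apply, Submodule.subtype_apply] at h1 h2
    rw [LinearMap.sub_apply, LinearMap.smulRight_apply, hl0, zero_smul, sub_zero, h1]
    exact h2
  · simp [smul_smul, mul_inv_cancel₀ hl]

variable {d : V →ₗ[k] V}

/-- A homogeneous splitting of a graded complex annihilating a given cycle. -/
theorem exists_splitting (h𝒱 : DirectSum.IsInternal 𝒱) (hd : ∀ i, ∀ a ∈ 𝒱 i, d a ∈ 𝒱 (i + 1))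
    (hdd : ∀ a, d (d a) = 0) {η : V} (hη0 : η ∈ 𝒱 0) (hdη : d η = 0)
    (hη : η ∉ LinearMap.range d) : ∃ h : V →ₗ[k] V, (∀ i, ∀ a ∈ 𝒱 (i + 1), h a ∈ 𝒱 i) ∧
      (∀ a, d (h (d a)) = d a) ∧ (∀ a, h (d (h a)) = h a) ∧ (∀ a, h (h a) = 0) ∧ h η = 0 := by
  -- Pseudoinverses are taken for the restriction of `d` to each degree, with values in that degree,
  -- so that the assembled map has degree `-1`.
  have hG : ∀ i, ∃ g : V →ₗ[k] 𝒱 i, (∀ x ∈ 𝒱 i, d (g (d x)) = d x) ∧ g η = 0 := by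
    intro i
    obtain ⟨g, h1, h2⟩ := LinearMap.exists_pseudoinverse (d ∘ₗ (𝒱 i).subtype) (η := η)
      fun h => hη (LinearMap.range_comp_le_range _ _ h)
    exact ⟨g, fun x hx => h1 ⟨x, hx⟩, h2⟩
  choose G hG1 hG2 using hG
  obtain ⟨g, hg⟩ := h𝒱.exists_linearMap fun i => (𝒱 (i - 1)).subtype ∘ₗ G (i - 1)
  have hgη : g η = 0 := by
    rw [hg 0 η hη0, LinearMap.comp_apply, hG2, map_zero]
  have hg_mem : ∀ i, ∀ a ∈ 𝒱 (i + 1), g a ∈ 𝒱 i := by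
    intro i a ha
    rw [hg _ a ha, add_sub_cancel_right]
    exact (G i a).2
  have hdgd : ∀ a, d (g (d a)) = d a := fun a => by
    refine LinearMap.congr_fun (h𝒱.linearMap_ext (f := d ∘ₗ g ∘ₗ d) (g := d) fun i a ha => ?_) a
    simp only [LinearMap.comp_apply]
    rw [hg _ _ (hd i a ha), add_sub_cancel_right]
    exact hG1 i a ha
  -- From `d g d = d`, the map `g' = g d g` also satisfies `g' d g' = g'`. Replacing it by `h = g' -
  -- g' g' d` preserves both identities and gives `h h = 0`, since `(1 - g' d) g' = 0`.
  refine ⟨g ∘ₗ d ∘ₗ g - g ∘ₗ d ∘ₗ g ∘ₗ g ∘ₗ d ∘ₗ g ∘ₗ d, fun i a ha => ?_, fun a => ?_,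
    fun a => ?_, fun a => ?_, ?_⟩
  · exact Submodule.sub_mem _ (hg_mem _ _ (hd _ _ (hg_mem _ _ ha)))
      (hg_mem _ _ (hd _ _ (hg_mem _ _ (hg_mem _ _ (hd _ _ (hg_mem _ _ (hd _ _ ha)))))))
  · simp [hdgd, hdd]
  · simp [hdgd, hdd]
  · simp [hdgd]
  · simp [hgη, hdη]

theorem iSupIndep_of_injective (h𝒱 : iSupIndep 𝒱) {ι : W →ₗ[k] V} (hι : Function.Injective ι)
    (h : ∀ i, ∀ x ∈ 𝒲 i, ι x ∈ 𝒱 i) : iSupIndep 𝒲 := by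
  intro i
  rw [Submodule.disjoint_def]
  intro x hx hx'
  refine hι ?_
  rw [map_zero]
  refine Submodule.disjoint_def.1 (h𝒱 i) _ (h i x hx) ?_
  have h1 : ι x ∈ (⨆ j, ⨆ (_ : j ≠ i), 𝒲 j).map ι := ⟨x, hx', rfl⟩
  simp only [Submodule.map_iSup] at h1
  exact iSup₂_mono (fun j _ => Submodule.map_le_iff_le_comap.2 (h j)) h1

/-- A graded complex over a field contracts onto its cohomology. -/
theorem exists_unitalContraction (h𝒱 : DirectSum.IsInternal 𝒱)
    (hd : ∀ i, ∀ a ∈ 𝒱 i, d a ∈ 𝒱 (i + 1)) (hdd : ∀ a, d (d a) = 0) {η : V} (hη0 : η ∈ 𝒱 0)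
    (hdη : d η = 0) (hη : η ∉ LinearMap.range d) :
    ∃ (hH : DirectSum.IsInternal (cohomologyGrading d 𝒱))
      (C : UnitalContraction (shiftAct h𝒱) (shiftAct hH) d η (cohomologyClass d ⟨η, hdη⟩)),
      ∀ x, cohomologyClass d ⟨C.i x, C.d_i x⟩ = x := by
  obtain ⟨h, h_mem, dhd, hdh, hh, hhη⟩ := exists_splitting h𝒱 hd hdd hη0 hdη hη
  -- The projection `π = 1 - d h - h d` picks a canonical cocycle in each class: it kills
  -- coboundaries and changes a cocycle by a coboundary. So `i` is induced by `π` on cocycles, and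
  -- `p` takes the class of `π a`.
  obtain ⟨π, hπ⟩ : ∃ π : V →ₗ[k] V, ∀ a, π a = a - d (h a) - h (d a) :=
    ⟨LinearMap.id - d ∘ₗ h - h ∘ₗ d, fun a => rfl⟩
  have dπ : ∀ a, d (π a) = 0 := fun a => by simp [hπ, dhd, hdd]
  have πd : ∀ a, π (d a) = 0 := fun a => by simp [hπ, dhd, hdd]
  have hπ0 : ∀ a, h (π a) = 0 := fun a => by simp [hπ, hdh, hh]
  have πh : ∀ a, π (h a) = 0 := fun a => by simp [hπ, hdh, hh]
  have ππ : ∀ a, π (π a) = π a := fun a => by rw [hπ (π a), hπ0, dπ, map_zero, map_zero]; simp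
  have π_mem : ∀ i, ∀ a ∈ 𝒱 i, π a ∈ 𝒱 i := by
    intro i a ha
    obtain ⟨j, rfl⟩ : ∃ j, i = j + 1 := ⟨i - 1, by ring⟩
    rw [hπ]
    exact Submodule.sub_mem _ (Submodule.sub_mem _ ha (hd _ _ (h_mem _ _ ha)))
      (h_mem _ _ (hd _ _ ha))
  let p : V →ₗ[k] Cohomology d := cohomologyClass d ∘ₗ π.codRestrict _ dπ
  let i : Cohomology d →ₗ[k] V := Submodule.liftQ _ (π ∘ₗ (LinearMap.ker d).subtype) <| by
    rintro ⟨z, hz⟩ ⟨y, rfl⟩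
    exact πd y
  have hi : ∀ z (hz : d z = 0), i (cohomologyClass d ⟨z, hz⟩) = π z := fun z hz => rfl
  have di : ∀ x, d (i x) = 0 := fun x => by
    obtain ⟨⟨z, hz⟩, rfl⟩ := Submodule.mkQ_surjective _ x
    exact dπ z
  have class_i : ∀ x, cohomologyClass d ⟨i x, di x⟩ = x := fun x => by
    obtain ⟨⟨z, hz⟩, rfl⟩ := Submodule.mkQ_surjective _ x
    change cohomologyClass d _ = cohomologyClass d _
    rw [← sub_eq_zero, ← map_sub, cohomologyClass_eq_zero_iff]
    refine ⟨-h z, ?_⟩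
    change _ = π z - z
    have hz' : d z = 0 := hz
    rw [hπ, hz', map_zero, map_neg]
    abel
  have hp : ∀ a, p a = cohomologyClass d ⟨π a, dπ a⟩ := fun a => rfl
  have πi : ∀ x, π (i x) = i x := fun x => by
    obtain ⟨⟨z, hz⟩, rfl⟩ := Submodule.mkQ_surjective _ x
    exact ππ z
  have p_i : ∀ x, p (i x) = x := fun x => by
    rw [hp]
    simp only [πi]
    exact class_i x
  have i_mem : ∀ j, ∀ x ∈ cohomologyGrading d 𝒱 j, i x ∈ 𝒱 j := by
    rintro j _ ⟨z, hz, rfl⟩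
    exact π_mem j _ hz
  have p_mem : ∀ j, ∀ a ∈ 𝒱 j, p a ∈ cohomologyGrading d 𝒱 j := fun j a ha =>
    ⟨⟨π a, dπ a⟩, π_mem j a ha, rfl⟩
  have hH : DirectSum.IsInternal (cohomologyGrading d 𝒱) := by
    rw [DirectSum.isInternal_submodule_iff_iSupIndep_and_iSup_eq_top] at h𝒱 ⊢
    refine ⟨iSupIndep_of_injective h𝒱.1 (Function.LeftInverse.injective p_i) i_mem, ?_⟩
    have h1 : iSup 𝒱 ≤ (iSup (cohomologyGrading d 𝒱)).comap p :=
      iSup_le fun j a ha => Submodule.mem_iSup_of_mem j (p_mem j a ha)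
    rw [eq_top_iff]
    intro x _
    rw [← p_i x]
    exact h1 (h𝒱.2 ▸ Submodule.mem_top)
  refine ⟨hH, ⟨i, p, h, di, fun a => ?_, p_i, fun a => ?_, fun x => ?_, fun a => ?_, ?_,
    fun u x => ?_, fun u a => ?_, fun u a => ?_, fun u a => ?_, ?_⟩, class_i⟩
  · rw [hp, cohomologyClass_eq_zero_iff]
    exact ⟨0, by simp [πd]⟩
  · rw [hp, cohomologyClass_eq_zero_iff]
    exact ⟨0, by simp [πh]⟩
  · rw [← πi, hπ0]
  · rw [hp, hi _ (dπ a), ππ, hπ]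
    abel
  · rw [hi, hπ, hhη, hdη]
    simp
  · have := shiftAct_comm_of_degree hH h𝒱 (g := i) (c := 0) (fun j x hx => by
      rw [add_zero]
      exact i_mem j x hx) u x
    simpa using this
  · have := shiftAct_comm_of_degree h𝒱 hH (g := p) (c := 0) (fun j x hx => by
      rw [add_zero]
      exact p_mem j x hx) u a
    simpa using this
  · have := shiftAct_comm_of_degree h𝒱 h𝒱 (g := h) (c := -1) (fun j x hx => h_mem _ _ (by
      rwa [neg_add_cancel_right])) u a
    simpa using this
  · have := shiftAct_comm_of_degree h𝒱 h𝒱 (g := d) (c := 1) hd u a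
    simpa using this
  · rw [shiftAct_neg_one h𝒱 hη0]
    simp

end Splitting

/-! ### Minimal models of DG-algebras -/

namespace DGAlgebra

variable {k : Type v} [Field k] (A : DGAlgebra.{v, u} k)

theorem toAInf_isStrictUnit : A.toAInf.IsStrictUnit 1 where
  mem := A.one_mem
  right a := (A.mul_two_apply _).trans (mul_one a)
  left a := (A.mul_two_apply _).trans (one_mul a)
  vanish n hn a ha := by
    change A.mul n a = 0
    by_cases h1 : n = 1
    · subst h1
      obtain ⟨j, hj⟩ := ha
      rw [mul_one_apply, Subsingleton.elim 0 j, hj, A.d_one]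
    · rw [A.mul_eq_zero h1 hn]
      rfl

theorem unitClass_mem : A.unitClass ∈ A.cohGrading 0 := ⟨⟨1, A.d_one⟩, A.one_mem, rfl⟩

/-- The contraction compatible with the unit exists because the unit is not a coboundary. The
transfer is carried out on shifted operations and translated back by `ofBar`; the quasi-isomorphism
properties follow from the homotopy `h`. -/
theorem nonempty_strictlyUnitalMinimalModel [CharZero k] (hA : A.UnitNotCoboundary) :
    Nonempty A.StrictlyUnitalMinimalModel := by
  obtain ⟨hH, C, hC⟩ := exists_unitalContraction A.isInternal (fun i a => A.d_mem) A.d_d A.one_mem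
    A.d_one hA
  obtain ⟨b', φ, ψ, hb', hmin, hunit, hφ, hφp, hφu, hψ, hψi, hψu⟩ :=
    C.exists_minimalModel A.toAInf.isBarOp_bar A.toAInf.bar_singleton
      (AInfStructure.isUnitalOp_bar A.toAInf_isStrictUnit)
  let M := AInfStructure.ofBar hH hb'
  have hM : M.bar = b' := AInfStructure.bar_ofBar hH hb'
  have hψ' : IsBarMap (shiftAct M.isInternal) (shiftAct A.toAInf.isInternal) M.bar A.toAInf.bar ψ :=
    hM.symm ▸ hψ
  have hφ' : IsBarMap (shiftAct A.toAInf.isInternal) (shiftAct M.isInternal) A.toAInf.bar M.bar φ :=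
    hM.symm ▸ hφ
  have hi : ∀ x, (AInfHom.ofBar hψ').linear x = C.i x := fun x => by
    rw [← AInfHom.bar_singleton, AInfHom.bar_ofBar, hψi]
  have hp : ∀ a, (AInfHom.ofBar hφ').linear a = C.p a := fun a => by
    rw [← AInfHom.bar_singleton, AInfHom.bar_ofBar, hφp]
  have hdiff : M.differential = 0 := by
    refine LinearMap.ext fun x => ?_
    rw [← AInfStructure.bar_singleton, hM, hmin]
    rfl
  refine ⟨M, ?_, ?_, AInfHom.ofBar hψ', AInfHom.ofBar hφ', ?_, ?_, ?_, ?_, fun x => ?_, fun x => ?_⟩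
  · rw [(Equiv.symm_apply_eq _).1 hdiff]
    rfl
  · exact AInfStructure.isStrictUnit_of_bar A.unitClass_mem (hM.symm ▸ hunit)
  · rw [AInfHom.IsQuasiIso, isQuasiIsoMap_iff, hdiff]
    refine ⟨fun x => ?_, fun z _ hw => ?_, fun w hw => ⟨C.p w, rfl, C.h w, ?_⟩⟩
    · rw [hi, hi, LinearMap.zero_apply, map_zero]
      exact (C.d_i x).symm
    · obtain ⟨w, hw⟩ := hw
      refine ⟨0, ?_⟩
      rw [hi] at hw
      rw [map_zero, ← C.p_i z, ← hw]
      exact (C.p_d w).symm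
    · have hw' : A.d w = 0 := hw
      rw [hi, ← C.homotopy, hw', map_zero, add_zero]
      rfl
  · rw [AInfHom.IsQuasiIso, isQuasiIsoMap_iff, hdiff]
    refine ⟨fun x => ?_, fun z hz hw => ⟨C.h z, ?_⟩, fun w hw => ⟨C.i w, C.d_i w, 0, ?_⟩⟩
    · rw [hp]
      exact C.p_d x
    · obtain ⟨w, hw⟩ := hw
      rw [hp] at hw
      have hz' : A.d z = 0 := hz
      have := C.homotopy z
      rw [← hw, hz', map_zero, LinearMap.zero_apply, map_zero, add_zero, sub_zero] at this
      exact this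
    · rw [hp, C.p_i, sub_self, map_zero]
  · exact AInfHom.isStrictlyUnital_of_bar A.unitClass_mem (by rwa [AInfHom.bar_ofBar])
  · exact AInfHom.isStrictlyUnital_of_bar A.one_mem (by rwa [AInfHom.bar_ofBar])
  · refine ⟨?_, ?_⟩
    · rw [hi]
      exact C.d_i x
    · simp only [hi]
      exact hC x
  · rw [hi, hp, C.p_i]

variable {A} {B : DGAlgebra.{v, u} k}

/-- A morphism of DG-algebras as components of a morphism of `A_∞`-algebras. -/
theorem Hom.isBarMap (f : Hom A B) : IsBarMap (shiftAct A.isInternal) (shiftAct B.isInternal)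
    A.toAInf.bar B.toAInf.bar (onSingle f.toAlgHom.toLinearMap) where
  multilinear := .onSingle _
  nil := rfl
  equivariant u := .onSingle fun x => by
    have := shiftAct_comm_of_degree A.isInternal B.isInternal (g := f.toAlgHom.toLinearMap) (c := 0)
      (fun i a ha => by
        rw [add_zero]
        exact f.map_mem ha) u x
    rwa [zpow_zero, Units.val_one] at this
  rel l := by
    by_cases hl : l = []
    · subst hl
      rw [coderiv_nil, blockComp_nil, AInfStructure.bar_nil]
    rw [coderiv_onSingle _ _ _ hl, onSingle_blockComp _ B.toAInf.isBarOp_bar.multilinear]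
    have htw : ∀ l : List A.carrier, twist (gradingSign B.isInternal) (l.map f.toAlgHom.toLinearMap) =
        (twist (gradingSign A.isInternal) l).map f.toAlgHom.toLinearMap := by
      have hpow : ∀ (n : ℕ) (a : A.carrier), f.toAlgHom ((gradingSign A.isInternal ^ n) a) =
          (gradingSign B.isInternal ^ n) (f.toAlgHom a) := by
        intro n a
        refine LinearMap.congr_fun (A.isInternal.linearMap_ext
          (f := f.toAlgHom.toLinearMap ∘ₗ (gradingSign A.isInternal ^ n))
          (g := (gradingSign B.isInternal ^ n) ∘ₗ f.toAlgHom.toLinearMap) fun i a ha => ?_) a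
        rw [LinearMap.comp_apply, LinearMap.comp_apply, gradingSign_pow_apply _ ha,
          gradingSign_pow_apply (a := f.toAlgHom.toLinearMap a) _ (f.map_mem ha), negOnePow_smul_eq (k := k),
          negOnePow_smul_eq (k := k), map_smul]
      intro l
      induction l with
      | nil => rfl
      | cons a l ih =>
        rw [List.map_cons, twist, twist, ih, List.map_cons, List.length_map]
        exact congrArg (· :: _) (hpow _ a).symm
    have hev : ∀ l : List A.carrier, f.toAlgHom (evalList A.mul l) =
        evalList B.mul (l.map f.toAlgHom.toLinearMap) := by
      intro l
      match l with
      | [] => exact map_zero f.toAlgHom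
      | [a] => exact f.map_d a
      | [a, b] =>
        rw [evalList_eq A.mul (n := 2) rfl ![a, b] (fun i hi => by interval_cases i <;> rfl),
          evalList_eq B.mul (n := 2) rfl ![f.toAlgHom a, f.toAlgHom b]
            (fun i hi => by interval_cases i <;> rfl), mul_two_apply, mul_two_apply]
        exact map_mul f.toAlgHom a b
      | a :: b :: c :: _ => exact map_zero f.toAlgHom
    change f.toAlgHom (evalList A.mul _) = evalList B.mul _
    rw [hev]
    exact congrArg _ (htw l).symm

theorem Hom.isUnitalMap (f : Hom A B) :
    IsUnitalMap 1 1 (onSingle f.toAlgHom.toLinearMap) where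
  map_unit := map_one f.toAlgHom
  vanish _ _ hl := onSingle_of_length_ne _ hl

/-- A morphism sends the class of the unit to that of the unit, and it is injective on cohomology.
This provides models for the intermediate algebras of a zigzag. -/
theorem Hom.IsQuasiIso.unitNotCoboundary_iff {f : Hom A B} (hf : f.IsQuasiIso) :
    A.UnitNotCoboundary ↔ B.UnitNotCoboundary := by
  refine not_congr ⟨?_, ?_⟩
  · rintro ⟨a, ha⟩
    exact ⟨f.toAlgHom a, by rw [← f.map_d, ha, map_one]⟩
  · rintro ⟨b, hb⟩
    exact (isQuasiIsoMap_iff.1 hf).2.1 1 A.d_one ⟨b, hb.trans (map_one f.toAlgHom).symm⟩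

namespace StrictlyUnitalMinimalModel

theorem differential_eq_zero (M : A.StrictlyUnitalMinimalModel) : M.str.differential = 0 := by
  rw [AInfStructure.differential, M.minimal]
  rfl

/-- The existence of a strictly unital isomorphism between minimal models. -/
def Isomorphic (M : A.StrictlyUnitalMinimalModel) (N : B.StrictlyUnitalMinimalModel) : Prop :=
  ∃ φ, IsBarMap (shiftAct M.str.isInternal) (shiftAct N.str.isInternal) M.str.bar N.str.bar φ ∧
    IsUnitalMap A.unitClass B.unitClass φ ∧ Function.Bijective fun a => φ [a]

theorem Isomorphic.symm {M : A.StrictlyUnitalMinimalModel} {N : B.StrictlyUnitalMinimalModel} :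
    M.Isomorphic N → N.Isomorphic M := by
  rintro ⟨φ, h1, h2, h3⟩
  obtain ⟨ψ, h4, h5, h6⟩ := h1.exists_inverse M.str.bar_nil N.str.isBarOp_bar.multilinear
    (LinearEquiv.ofBijective ((h1.multilinear [] []).mk' _) h3) fun a => rfl
  refine ⟨ψ, h4, h6 _ _ h2, ?_⟩
  simp only [h5]
  exact LinearEquiv.bijective _

theorem Isomorphic.trans {C : DGAlgebra.{v, u} k} {M : A.StrictlyUnitalMinimalModel}
    {N : B.StrictlyUnitalMinimalModel} {P : C.StrictlyUnitalMinimalModel} :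
    M.Isomorphic N → N.Isomorphic P → M.Isomorphic P := by
  rintro ⟨φ, h1, h2, h3⟩ ⟨ψ, h4, h5, h6⟩
  refine ⟨blockComp φ ψ, h1.comp h4 P.str.isBarOp_bar.multilinear, h2.comp h5 h4.multilinear, ?_⟩
  simp only [blockComp_singleton]
  exact h6.comp h3

/-- The isomorphism is the composite of `M.incl`, `f` and `N.proj`. Its linear part is a
quasi-isomorphism between complexes with zero differential, hence bijective. -/
theorem isomorphic_of_isQuasiIso {f : Hom A B} (hf : f.IsQuasiIso)
    (M : A.StrictlyUnitalMinimalModel) (N : B.StrictlyUnitalMinimalModel) : M.Isomorphic N := by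
  have h1 := f.isBarMap.comp N.proj.isBarMap_bar N.str.isBarOp_bar.multilinear
  refine ⟨_, M.incl.isBarMap_bar.comp h1 N.str.isBarOp_bar.multilinear, ?_, ?_⟩
  · exact (AInfHom.isUnitalMap_bar A.unitClass_mem M.incl_unital).comp
      (f.isUnitalMap.comp (AInfHom.isUnitalMap_bar B.one_mem N.proj_unital)
        N.proj.isBarMap_bar.multilinear) h1.multilinear
  · have h2 := (M.incl_isQuasiIso.comp hf).comp N.proj_isQuasiIso
    rw [differential_eq_zero, differential_eq_zero, isQuasiIsoMap_zero_iff] at h2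
    simp only [blockComp_singleton, AInfHom.bar_singleton]
    exact h2

/-- The statement for all pairs of models is carried along the zigzag together with the condition on
the unit, which guarantees that a middle algebra has a model through which to compose. -/
theorem isomorphic_of_quasiIsomorphic [CharZero k] (h : QuasiIsomorphic A B) :
    (A.UnitNotCoboundary ↔ B.UnitNotCoboundary) ∧ (A.UnitNotCoboundary →
      ∀ (M : A.StrictlyUnitalMinimalModel) (N : B.StrictlyUnitalMinimalModel), M.Isomorphic N) := by
  induction h with
  | rel A B h =>
    obtain ⟨f, hf⟩ := h
    exact ⟨hf.unitNotCoboundary_iff, fun _ => isomorphic_of_isQuasiIso hf⟩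
  | refl A =>
    -- Two possibly different models of the same algebra are compared through its identity morphism.
    exact ⟨Iff.rfl, fun _ => isomorphic_of_isQuasiIso (f := ⟨AlgHom.id k _, id, fun _ => rfl⟩) (.id _)⟩
  | symm A B _ ih =>
    exact ⟨ih.1.symm, fun hB M N => (ih.2 (ih.1.2 hB) N M).symm⟩
  | trans A B C _ _ ih ih' =>
    refine ⟨ih.1.trans ih'.1, fun hA M P => ?_⟩
    obtain ⟨N⟩ := B.nonempty_strictlyUnitalMinimalModel (ih.1.1 hA)
    exact (ih.2 hA M N).trans (ih'.2 (ih.1.1 hA) N P)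

end StrictlyUnitalMinimalModel

end DGAlgebra

/-! ### Restriction to the unitally positive parts -/

section Restrict

variable {k : Type v} [Field k] {V : Type u} [AddCommGroup V] [Module k V]
  {W : Type w} [AddCommGroup W] [Module k W] {𝒱 : ℤ → Submodule k V} {𝒲 : ℤ → Submodule k W}

theorem mem_unitalPositivePart_of_pos {η x : V} {i : ℤ} (hi : 0 < i) (hx : x ∈ 𝒱 i) :
    x ∈ unitalPositivePart 𝒱 η :=
  Submodule.mem_sup_right (Submodule.mem_iSup_of_mem (⟨i, hi⟩ : {i : ℤ // 0 < i}) hx)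

theorem self_mem_unitalPositivePart (η : V) : η ∈ unitalPositivePart 𝒱 η :=
  Submodule.mem_sup_left (Submodule.mem_span_singleton_self η)

theorem unitalPositivePart_le {η : V} {N : Submodule k V} (h0 : η ∈ N)
    (h : ∀ i : ℤ, 0 < i → 𝒱 i ≤ N) : unitalPositivePart 𝒱 η ≤ N :=
  sup_le (by simpa using h0) (iSup_le fun i => h i i.2)

theorem MultilinearMap.mem_of_mem_unitalPositivePart {n : ℕ}
    (f : MultilinearMap k (fun _ : Fin n => V) W) {η : V} {N : Submodule k W}
    (base : ∀ b : Fin n → V, (∀ i, b i = η ∨ ∃ e : ℤ, 0 < e ∧ b i ∈ 𝒱 e) → f b ∈ N)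
    {a : Fin n → V} (ha : ∀ i, a i ∈ unitalPositivePart 𝒱 η) : f a ∈ N := by
  have step : ∀ (t : Finset (Fin n)) (b : Fin n → V), (∀ i ∈ t, b i ∈ unitalPositivePart 𝒱 η) →
      (∀ i, i ∉ t → b i = η ∨ ∃ e : ℤ, 0 < e ∧ b i ∈ 𝒱 e) → f b ∈ N := by
    intro t
    induction t using Finset.induction_on with
    | empty => exact fun b _ hb => base b fun i => hb i (Finset.notMem_empty i)
    | insert j t hjt ih =>
      intro b hb hb'
      have hx : ∀ x, (x = η ∨ ∃ e : ℤ, 0 < e ∧ x ∈ 𝒱 e) → f (Function.update b j x) ∈ N := by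
        intro x hx
        refine ih _ (fun i hi => ?_) fun i hi => ?_
        · rw [Function.update_of_ne fun h : i = j => hjt (h ▸ hi)]
          exact hb i (Finset.mem_insert_of_mem hi)
        · by_cases hij : i = j
          · subst hij
            simpa using hx
          · rw [Function.update_of_ne hij]
            exact hb' i (by simp [hij, hi])
      have hle : unitalPositivePart 𝒱 η ≤ N.comap (f.toLinearMap b j) :=
        unitalPositivePart_le (hx η (Or.inl rfl)) fun e he x hxe => hx x (Or.inr ⟨e, he, hxe⟩)
      simpa using hle (hb j (Finset.mem_insert_self j t))
  exact step Finset.univ a (fun i _ => ha i) fun i hi => absurd (Finset.mem_univ i) hi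

namespace AInfHom

variable {S : AInfStructure 𝒱} {T : AInfStructure 𝒲} {η : V} {θ : W}

/-- By multilinearity each entry may be taken to be `η` or of positive degree. In the absence of `η`
the total degree is at least `n`, so the value has degree at least `n + 1 - n = 1`. -/
theorem IsStrictlyUnital.mem_unitalPositivePart {F : AInfHom S T} (hF : F.IsStrictlyUnital η θ)
    (n : ℕ) (a : Fin n → V) (ha : ∀ i, a i ∈ unitalPositivePart 𝒱 η) :
    F.f n a ∈ unitalPositivePart 𝒲 θ := by
  refine (F.f n).mem_of_mem_unitalPositivePart (fun b hb => ?_) ha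
  by_cases hu : ∃ j, b j = η
  · by_cases h1 : n = 1
    · subst h1
      obtain ⟨j, hj⟩ := hu
      have : F.f 1 b = F.linear (b j) := congrArg (F.f 1) (funext fun i => by
        rw [Subsingleton.elim i j])
      rw [this, hj, hF.map_unit]
      exact self_mem_unitalPositivePart θ
    · rw [hF.vanish n h1 b hu]
      exact zero_mem _
  · choose e he hbe using fun i => (hb i).resolve_left fun h => hu ⟨i, h⟩
    refine mem_unitalPositivePart_of_pos ?_ (F.f_mem n b e hbe)
    have : ∑ _i : Fin n, (1 : ℤ) ≤ ∑ i, e i := Finset.sum_le_sum fun i _ => he i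
    simp at this
    omega

/-- The restriction of a strictly unital morphism to the unitally positive parts. -/
def unitalPositive (F : AInfHom S T) (hη : S.IsStrictUnit η) (hθ : T.IsStrictUnit θ)
    (hF : F.IsStrictlyUnital η θ) : AInfHom (S.unitalPositive hη) (T.unitalPositive hθ) where
  f n := ((F.f n).compLinearMap fun _ => (unitalPositivePart 𝒱 η).subtype).codRestrict
    (unitalPositivePart 𝒲 θ) fun a => hF.mem_unitalPositivePart n _ fun i => (a i).2
  f_zero := by
    ext a
    simp [F.f_zero]
  f_mem n a d h := F.f_mem n (fun i => (a i : V)) d h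
  rel n a d h := by
    apply Subtype.ext
    have h1 := F.rel n (fun i => (a i : V)) d h
    have hs : ∀ (e : ℤˣ) (x : unitalPositivePart 𝒲 θ), ((e • x : unitalPositivePart 𝒲 θ) : W) =
        e • (x : W) := by
      intro e x
      rcases Int.units_eq_one_or e with rfl | rfl <;> simp
    rw [AddSubmonoidClass.coe_finsetSum, AddSubmonoidClass.coe_finsetSum]
    refine Eq.trans (Finset.sum_congr rfl fun s _ => ?_) (h1.trans ?_)
    · rw [AddSubmonoidClass.coe_finsetSum]
      refine Finset.sum_congr rfl fun r _ => ?_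
      rw [hs]
      congr 1
      change F.f _ _ = F.f _ _
      congr 1
      funext i
      simp only [replaceBlock, Submodule.subtype_apply]
      split_ifs <;> rfl
    · refine Finset.sum_congr rfl fun c _ => ?_
      rw [hs]
      rfl

/-- The linear part commutes with the scalar actions. If it is injective, the action on `x` is thus
determined by the degree of its image, and in characteristic zero this fixes the degree of `x`. -/
theorem mem_of_linear_mem [CharZero k] {F : AInfHom S T} (hF : Function.Injective F.linear) {i : ℤ}
    {x : V} (hx : F.linear x ∈ 𝒲 i) : x ∈ 𝒱 i := by
  refine mem_of_shiftAct_eq S.isInternal fun u => hF ?_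
  have h := (F.isBarMap_bar.equivariant u).apply_one [x]
  rw [List.map_singleton, bar_singleton, bar_singleton, shiftAct_apply T.isInternal u hx] at h
  rw [h, map_smul]

/-- For surjectivity, the preimage of an element of positive degree has the same degree by
`mem_of_linear_mem`, and the unit is the image of the unit. -/
theorem unitalPositive_linear_bijective [CharZero k] {F : AInfHom S T} (hη : S.IsStrictUnit η)
    (hθ : T.IsStrictUnit θ) (hF : F.IsStrictlyUnital η θ) (hb : Function.Bijective F.linear) :
    Function.Bijective (F.unitalPositive hη hθ hF).linear := by
  refine ⟨fun x y h => Subtype.ext (hb.1 (congrArg Subtype.val h)), fun y => ?_⟩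
  have hle : unitalPositivePart 𝒲 θ ≤ (unitalPositivePart 𝒱 η).map F.linear := by
    refine unitalPositivePart_le ⟨η, self_mem_unitalPositivePart η, hF.map_unit⟩ fun i hi y hy => ?_
    obtain ⟨x, rfl⟩ := hb.2 y
    exact ⟨x, mem_unitalPositivePart_of_pos hi (mem_of_linear_mem hb.1 hy), rfl⟩
  obtain ⟨x, hx, hxy⟩ := hle y.2
  exact ⟨⟨x, hx⟩, Subtype.ext hxy⟩

end AInfHom

end Restrict

namespace DGAlgebra.StrictlyUnitalMinimalModel

variable {k : Type v} [Field k] {A B : DGAlgebra.{v, u} k}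

theorem unitallyPositive_differential (M : A.StrictlyUnitalMinimalModel) :
    M.unitallyPositive.differential = 0 := by
  refine LinearMap.ext fun x => Subtype.ext ?_
  exact LinearMap.congr_fun M.differential_eq_zero x.1

theorem Isomorphic.exists_unitallyPositive [CharZero k] {M : A.StrictlyUnitalMinimalModel}
    {N : B.StrictlyUnitalMinimalModel} :
    M.Isomorphic N → ∃ F : AInfHom M.unitallyPositive N.unitallyPositive, F.IsQuasiIso := by
  rintro ⟨φ, hφ, hu, hb⟩
  have hF : (AInfHom.ofBar hφ).IsStrictlyUnital A.unitClass B.unitClass :=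
    AInfHom.isStrictlyUnital_of_bar A.unitClass_mem (by rwa [AInfHom.bar_ofBar])
  refine ⟨(AInfHom.ofBar hφ).unitalPositive M.strictUnit N.strictUnit hF, ?_⟩
  change IsQuasiIsoMap M.unitallyPositive.differential N.unitallyPositive.differential _
  rw [unitallyPositive_differential, unitallyPositive_differential,
    isQuasiIsoMap_zero_iff]
  refine AInfHom.unitalPositive_linear_bijective _ _ _ ?_
  convert hb using 2 with a
  rw [← AInfHom.bar_singleton, AInfHom.bar_ofBar]

end DGAlgebra.StrictlyUnitalMinimalModel

theorem proposition4 (A B : DGAlgebra.{0, u} ℂ)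
    (hA : A.UnitNotCoboundary) (hB : B.UnitNotCoboundary)
    (hAB : DGAlgebra.QuasiIsomorphic A B) :
    Nonempty A.StrictlyUnitalMinimalModel ∧ Nonempty B.StrictlyUnitalMinimalModel ∧
      ∀ (M : A.StrictlyUnitalMinimalModel) (N : B.StrictlyUnitalMinimalModel),
        ∃ F : AInfHom M.unitallyPositive N.unitallyPositive, F.IsQuasiIso :=
  ⟨A.nonempty_strictlyUnitalMinimalModel hA, B.nonempty_strictlyUnitalMinimalModel hB, fun M N =>
    ((DGAlgebra.StrictlyUnitalMinimalModel.isomorphic_of_quasiIsomorphic hAB).2 hA M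
      N).exists_unitallyPositive⟩
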